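/- Let $-1<\beta,\lambda<0$ with $\beta\ne\lambda$, and let $H=\{z=(x,y)\in\mathbb R^2: y>0\}$, so that $d(z)=y$ is the distance of $z=(x,y)$ to $\partial H$. **Notions.** For a continuous $\rho:H\to(0,\infty)$ let $d_\rho(z,w)=\inf_\gamma\int_\gamma\rho\,ds$, the infimum over rectifiable curves $\gamma$ in $H$ joining $z$ to $w$; let $\overline H_\rho$ be the metric completion of $(H,d_\rho)$ and $\partial_\rho H=\overline H_\rho\setminus H$. Call $\rho$ a *density* if every sequence in $H$ that converges in $\overline H_\rho$ converges in $\mathbb R^2$, every sequence in $H$ that converges in $\mathbb R^2$ has at most one accumulation point in $\partial_\rho H$, and $\partial_\rho H\neq\emptyset$. A point $\xi\in\partial_\rho H$ *lies over* $x\in\mathbb R$ if $(x,0)$ is the value at $\xi$ of the continuous extension of the identity $(H,d_\rho)\to(H,|\cdot|)$. A positive function $\rho$ on a set $U\subset H$ satisfies the *Harnack inequality* on $U$ if there is $1\le c_0<\infty$ with $c_0^{-1}\le\rho(w)/\rho(z)\le c_0$ for all $z,w\in U$ with $|w-z|<d(z)/2$. A density $\rho$ on $H$ is *conformal* if it satisfies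 the Harnack inequality on $H$ and there is $c_1<\infty$ with $\int_{B_\rho(z,r)}\rho^2\,d\mathcal L^2\le c_1r^2$ for all $z\in H$ and $r>0$, where $B_\rho(z,r)=\{w\in H:d_\rho(z,w)<r\}$. **Construction.** For $\mathbf i=(i_1,\dots,i_n)\in\{0,1,2\}^n$, $n\ge0$, let $I_{\mathbf i}=\big[\sum_k i_k3^{-k},\,\sum_k i_k3^{-k}+3^{-n}\big]$ be the triadic interval with address $\mathbf i$, let $Q_{\mathbf i}=I_{\mathbf i}\times[|I_{\mathbf i}|,3|I_{\mathbf i}|]$, let $x_{\mathbf i}$ be the centre of $Q_{\mathbf i}$, and let $\rho_\varnothing=1$, $\rho_{\mathbf i0}=\rho_{\mathbf i2}=3^{-\lambda}\rho_{\mathbf i}$, $\rho_{\mathbf i1}=3^{-\beta}\rho_{\mathbf i}$. Let $\mathcal R$ be the set of continuous functions $\rho_0:[0,1]\times(0,3]\to(0,\infty)$ that satisfy the Harnack inequality on $[0,1]\times(0,3]$ and $\rho_0(x_{\mathbf i})=\rho_{\mathbf i}$ for all $\mathbf i$. Let $\mathcal C$ be the set of continuous functions $\rho:H\to(0,\infty)$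 that satisfy the Harnack inequality on $H$ and $\rho(x_{\mathbf i}+(m,0))=\rho_{\mathbf i}$ for all $\mathbf i$ and all $m\in\mathbb Z$, and that are bounded above and bounded away from $0$ on $\{(x,y):y\ge3\}$. **Statement.** The set $\mathcal R$ is nonempty, and every $\rho_0\in\mathcal R$ is the restriction to $[0,1]\times(0,3]$ of some $\rho\in\mathcal C$. Every $\rho\in\mathcal C$ has the following properties. 1. $\rho$ is a density on $H$ and satisfies the Harnack inequality on $H$. 2. (Gehring–Hayman estimate) Over every $x\in\mathbb R$ lies a point of $\partial_\rho H$, and every point of $\partial_\rho H$ lies over a point of $\mathbb R$. There is $1\le c<\infty$ such that for all $\xi,\eta\in\partial_\rho H$, lying over $x$ and $y$ respectively, $$c^{-1}d_\rho(\xi,\eta)\le\int_0^{|x-y|}\rho(x,t)\,dt+\int_0^{|x-y|}\rho(y,t)\,dt\le c\,d_\rho(\xi,\eta).$$ 3. If $\beta,\lambda>-\tfrac12$, then $\rho$ is a conformal density. 4. The Hausdorff dimension of $\partial_\rho H$ with respect to $d_\rho$ is $$\dim_\rho(\partial_\rho H)=f(\beta,\lambda):=\max_{0\le t\le1}\frac{-t\log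 t+(t-1)\log\frac{1-t}{2}}{(1+t\beta+(1-t)\lambda)\log3},$$ where $0\log0=0$ and the maximum is attained. -/

import Mathlib

open Set Filter Topology MeasureTheory
open scoped ENNReal

noncomputable section

/-- The open upper half-plane `H`, as a subset of the Euclidean plane `ℂ = ℝ²`.  The Euclidean
distance from `z ∈ H` to the boundary of `H` is `z.im`, and the internal metric of `H` is the
Euclidean one, since `H` is convex. -/
def upperHalf : Set ℂ := {z | 0 < z.im}

/-- A continuous function `ρ : H → (0, ∞)` (values outside `H` are irrelevant). -/
structure HalfPlaneWeight where
  toFun : ℂ → ℝ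
  continuousOn_toFun : ContinuousOn toFun upperHalf
  pos_toFun : ∀ z ∈ upperHalf, 0 < toFun z

instance : CoeFun HalfPlaneWeight (fun _ => ℂ → ℝ) := ⟨HalfPlaneWeight.toFun⟩

/-- `γ : [0, L] → H` is a rectifiable curve of length `L`, parametrized by arc length, that joins
`z` to `w` in `H`. -/
def IsArcIn (γ : ℝ → ℂ) (L : ℝ) (z w : ℂ) : Prop :=
  0 ≤ L ∧ HasUnitSpeedOn γ (Icc 0 L) ∧ γ 0 = z ∧ γ L = w ∧ ∀ t ∈ Icc 0 L, γ t ∈ upperHalf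

/-- The `ρ`-length of a curve parametrized by arc length on `[0, L]`. -/
def rhoLength (ρ : ℂ → ℝ) (γ : ℝ → ℂ) (L : ℝ) : ℝ≥0∞ :=
  ∫⁻ t in Icc 0 L, ENNReal.ofReal (ρ (γ t))

/-- The distance `d_ρ`: the infimum of the `ρ`-lengths of the curves in `H` joining two points. -/
def rhoEDist (ρ : ℂ → ℝ) (z w : ℂ) : ℝ≥0∞ :=
  ⨅ (γ : ℝ → ℂ) (L : ℝ) (_ : IsArcIn γ L z w), rhoLength ρ γ L

theorem rhoEDist_self (ρ : ℂ → ℝ) {z : ℂ} (hz : z ∈ upperHalf) : rhoEDist ρ z z = 0 := by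
  refine le_antisymm ?_ bot_le
  have h : IsArcIn (fun _ => z) 0 z z := by
    refine ⟨le_rfl, ?_, rfl, rfl, fun _ _ => hz⟩
    exact hasConstantSpeedOnWith_of_subsingleton _ (by simp) 1
  refine (iInf₂_le_of_le (fun _ => z) 0 (iInf_le _ h)).trans ?_
  simp [rhoLength]

theorem rhoEDist_le_symm (ρ : ℂ → ℝ) (z w : ℂ) : rhoEDist ρ w z ≤ rhoEDist ρ z w := by
  refine le_iInf fun γ => le_iInf fun L => le_iInf fun h => ?_
  obtain ⟨hL, hu, h0, h1, hm⟩ := h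
  have hr : IsArcIn (fun t => γ (L - t)) L w z := by
    refine ⟨hL, ?_, by simpa using h1, by simpa using h0, fun t ht => hm _ ⟨?_, ?_⟩⟩
    · intro x hx y hy
      have hsub : (fun t : ℝ => L - t) '' (Icc 0 L ∩ Icc x y)
          = Icc 0 L ∩ Icc (L - y) (L - x) := by
        rw [Icc_inter_Icc, Icc_inter_Icc, image_const_sub_Icc]
        congr 1
        · rcases le_total L y with h | h
          · rw [min_eq_left h, max_eq_left (by linarith)]; ring
          · rw [min_eq_right h, max_eq_right (by linarith)]
        · rcases le_total 0 x with h | h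
          · rw [max_eq_right h, min_eq_right (by linarith)]
          · rw [max_eq_left h, min_eq_left (by linarith)]; ring
      have hanti : AntitoneOn (fun t : ℝ => L - t) (Icc 0 L ∩ Icc x y) :=
        fun a _ b _ hab => sub_le_sub_left hab L
      have := eVariationOn.comp_eq_of_antitoneOn γ (fun t : ℝ => L - t) hanti
      rw [hsub] at this
      refine Eq.trans this ?_
      rw [hu ⟨by linarith [hy.2], by linarith [hy.1]⟩ ⟨by linarith [hx.2], by linarith [hx.1]⟩]
      congr 2
      ring
    · linarith [ht.2]
    · linarith [ht.1]
  refine (iInf₂_le_of_le _ L (iInf_le _ hr)).trans (le_of_eq ?_)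
  have hmp : MeasurePreserving (fun t : ℝ => L - t) volume volume :=
    Measure.measurePreserving_sub_left volume L
  have := hmp.setLIntegral_comp_preimage_emb
    (MeasurableEquiv.subLeft L).measurableEmbedding
    (fun t => ENNReal.ofReal (ρ (γ t))) (Icc 0 L)
  have hpre : (fun t : ℝ => L - t) ⁻¹' Icc 0 L = Icc 0 L := by
    rw [preimage_const_sub_Icc]; simp
  rw [hpre] at this
  exact this

theorem rhoEDist_triangle (ρ : ℂ → ℝ) (z w v : ℂ) :
    rhoEDist ρ z v ≤ rhoEDist ρ z w + rhoEDist ρ w v := by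
  have key : ∀ (γ : ℝ → ℂ) (L : ℝ), IsArcIn γ L z w → ∀ (η : ℝ → ℂ) (M : ℝ), IsArcIn η M w v →
      rhoEDist ρ z v ≤ rhoLength ρ γ L + rhoLength ρ η M := by
    rintro γ L ⟨hL, hu, h0, h1, hm⟩ η M ⟨hM, ku, k0, k1, km⟩
    let c : ℝ → ℂ := fun t => if t ≤ L then γ t else η (t - L)
    have c1 : EqOn c γ (Icc 0 L) := fun t ht => if_pos ht.2
    have c2 : EqOn c (fun t => η (t - L)) (Icc L (L + M)) := by
      intro t ht
      rcases eq_or_lt_of_le ht.1 with h | h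
      · subst h
        simp [c, h1, k0]
      · exact if_neg (not_le.2 h)
    have hc : IsArcIn c (L + M) z v := by
      refine ⟨by linarith, ?_, ?_, ?_, ?_⟩
      · refine HasConstantSpeedOnWith.Icc_Icc (y := L) ?_ ?_
        · intro x hx y hy
          rw [eVariationOn.congr (c1.mono inter_subset_left)]
          exact hu hx hy
        · intro x hx y hy
          rw [eVariationOn.congr (c2.mono inter_subset_left)]
          have hmono : MonotoneOn (fun t : ℝ => t - L) (Icc L (L + M) ∩ Icc x y) :=
            fun a _ b _ hab => by simpa using hab
          have := eVariationOn.comp_eq_of_monotoneOn η (fun t : ℝ => t - L) hmono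
          have him : (fun t : ℝ => t - L) '' (Icc L (L + M) ∩ Icc x y)
              = Icc 0 M ∩ Icc (x - L) (y - L) := by
            rw [Icc_inter_Icc, Icc_inter_Icc, image_sub_const_Icc]
            congr 1
            · rw [← max_sub_sub_right]; simp
            · rw [← min_sub_sub_right]; simp
          rw [him] at this
          refine Eq.trans this ?_
          rw [ku ⟨by linarith [hx.1], by linarith [hx.2]⟩ ⟨by linarith [hy.1], by linarith [hy.2]⟩]
          congr 2
          ring
      · rw [c1 ⟨le_rfl, hL⟩, h0]
      · rw [c2 ⟨by linarith, le_rfl⟩]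
        simpa using k1
      · intro t ht
        rcases le_total t L with h | h
        · rw [c1 ⟨ht.1, h⟩]; exact hm _ ⟨ht.1, h⟩
        · rw [c2 ⟨h, ht.2⟩]; exact km _ ⟨by linarith, by linarith [ht.2]⟩
    refine (iInf₂_le_of_le c (L + M) (iInf_le _ hc)).trans ?_
    unfold rhoLength
    rw [← Icc_union_Icc_eq_Icc (a := (0 : ℝ)) (b := L) (c := L + M) hL (by linarith)]
    refine (lintegral_union_le _ _ _).trans (add_le_add ?_ ?_)
    · exact le_of_eq (setLIntegral_congr_fun measurableSet_Icc fun t ht => by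
        simp only [c1 ht])
    · have e1 : ∫⁻ t in Icc L (L + M), ENNReal.ofReal (ρ (c t))
          = ∫⁻ t in Icc L (L + M), ENNReal.ofReal (ρ (η (t - L))) :=
        setLIntegral_congr_fun measurableSet_Icc fun t ht => by simp only [c2 ht]
      rw [e1]
      have hmp : MeasurePreserving (fun t : ℝ => t - L) volume volume :=
        measurePreserving_sub_right volume L
      have := hmp.setLIntegral_comp_preimage_emb
        (MeasurableEquiv.subRight L).measurableEmbedding
        (fun t => ENNReal.ofReal (ρ (η t))) (Icc 0 M)
      have hpre : (fun t : ℝ => t - L) ⁻¹' Icc 0 M = Icc L (L + M) := by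
        rw [preimage_sub_const_Icc]
        congr 1
        · ring
        · ring
      rw [hpre] at this
      exact le_of_eq this
  conv_rhs => unfold rhoEDist
  simp only [ENNReal.iInf_add, ENNReal.add_iInf]
  exact le_iInf fun η => le_iInf fun M => le_iInf fun k =>
    le_iInf fun γ => le_iInf fun L => le_iInf fun h => key γ L h η M k

theorem exists_isArcIn {z w : ℂ} (hz : z ∈ upperHalf) (hw : w ∈ upperHalf) :
    ∃ (γ : ℝ → ℂ) (L : ℝ), IsArcIn γ L z w ∧ Continuous γ := by
  by_cases hzw : z = w
  · subst hzw
    exact ⟨fun _ => z, 0, ⟨le_rfl, hasConstantSpeedOnWith_of_subsingleton _ (by simp) 1, rfl, rfl,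
      fun _ _ => hz⟩, continuous_const⟩
  have hn : 0 < ‖w - z‖ := norm_pos_iff.2 (sub_ne_zero.2 (Ne.symm hzw))
  have hne : ‖w - z‖ ≠ 0 := hn.ne'
  let γ : ℝ → ℂ := fun t => z + (t / ‖w - z‖) • (w - z)
  have hiso : ∀ s t, edist (γ s) (γ t) = edist s t := by
    intro s t
    have : dist (γ s) (γ t) = dist s t := by
      have e : γ s - γ t = ((s - t) / ‖w - z‖) • (w - z) := by
        simp only [γ, sub_div, sub_smul]; abel
      rw [dist_eq_norm, e, norm_smul, Real.norm_eq_abs, abs_div, abs_norm, Real.dist_eq,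
        div_mul_cancel₀ _ hne]
    rw [edist_dist, edist_dist, this]
  refine ⟨γ, ‖w - z‖, ⟨hn.le, ?_, by simp [γ], by simp [γ, hne], ?_⟩, by fun_prop⟩
  · intro x hx y hy
    have e : eVariationOn γ (Icc 0 ‖w - z‖ ∩ Icc x y)
        = eVariationOn (id : ℝ → ℝ) (Icc 0 ‖w - z‖ ∩ Icc x y) := by
      simp only [eVariationOn, hiso, id]
    rw [e]
    rcases le_total x y with hxy | hxy
    · rw [NNReal.coe_one, one_mul]
      exact (monotone_id.monotoneOn _).eVariationOn_eq hx hy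
    · rw [ENNReal.ofReal_of_nonpos (by simpa using hxy)]
      refine eVariationOn.subsingleton _ fun a ha b hb => ?_
      linarith [ha.2.1, ha.2.2, hb.2.1, hb.2.2]
  · intro t ht
    have h1 : t / ‖w - z‖ ≤ 1 := (div_le_one hn).2 ht.2
    have h0 : 0 ≤ t / ‖w - z‖ := div_nonneg ht.1 hn.le
    simp only [upperHalf, mem_ofPred_eq] at hz hw ⊢
    have : (γ t).im = (1 - t / ‖w - z‖) * z.im + (t / ‖w - z‖) * w.im := by
      simp [γ]; ring
    rw [this]
    rcases eq_or_lt_of_le h0 with h | h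
    · rw [← h]; simpa using hz
    · have := mul_pos h hw
      nlinarith [mul_nonneg (sub_nonneg.2 h1) hz.le]

theorem rhoEDist_ne_top (ρ : HalfPlaneWeight) {z w : ℂ} (hz : z ∈ upperHalf)
    (hw : w ∈ upperHalf) : rhoEDist ρ z w ≠ ⊤ := by
  obtain ⟨γ, L, h, hγ⟩ := exists_isArcIn hz hw
  refine ne_top_of_le_ne_top ?_ (iInf₂_le_of_le γ L (iInf_le _ h))
  have hc : ContinuousOn (fun t => ρ (γ t)) (Icc 0 L) :=
    ρ.continuousOn_toFun.comp hγ.continuousOn h.2.2.2.2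
  exact (hc.integrableOn_compact isCompact_Icc).lintegral_lt_top.ne

/-- The half-plane `H`, to be equipped with the metric `d_ρ`. -/
def RhoSpace (_ρ : HalfPlaneWeight) : Type := upperHalf

/-- The underlying point of the Euclidean plane. -/
def RhoSpace.pt {ρ : HalfPlaneWeight} (z : RhoSpace ρ) : ℂ := Subtype.val z

instance (ρ : HalfPlaneWeight) : PseudoEMetricSpace (RhoSpace ρ) where
  edist z w := rhoEDist ρ z.pt w.pt
  edist_self z := rhoEDist_self ρ z.2
  edist_comm z w := le_antisymm (rhoEDist_le_symm ρ _ _) (rhoEDist_le_symm ρ _ _)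
  edist_triangle z w v := rhoEDist_triangle ρ _ _ _

/-- `(H, d_ρ)`, with `edist z w = d_ρ(z, w)` by definition. -/
instance (ρ : HalfPlaneWeight) : PseudoMetricSpace (RhoSpace ρ) :=
  PseudoEMetricSpace.toPseudoMetricSpace fun z w => rhoEDist_ne_top ρ z.2 w.2

/-- The metric completion of `(H, d_ρ)`; its metric is the extension of `d_ρ`. -/
abbrev RhoClosure (ρ : HalfPlaneWeight) : Type := UniformSpace.Completion (RhoSpace ρ)

/-- The `ρ`-boundary `∂_ρ H`: the completion of `(H, d_ρ)` with `H` removed. -/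
def rhoBoundary (ρ : HalfPlaneWeight) : Set (RhoClosure ρ) :=
  (range ((↑) : RhoSpace ρ → RhoClosure ρ))ᶜ

/-- The boundary point `ξ` of the completion lies over the real point `x`: the value at `ξ` of the
continuous extension of the identity `(H, d_ρ) → (H, |·|)` is `x`. -/
def LiesOver {ρ : HalfPlaneWeight} (ξ : RhoClosure ρ) (x : ℝ) : Prop :=
  Tendsto (RhoSpace.pt : RhoSpace ρ → ℂ)
    (comap ((↑) : RhoSpace ρ → RhoClosure ρ) (𝓝 ξ)) (𝓝 (x : ℂ))

/-- `ρ` is a density on `H`: besides being continuous and positive, every sequence in `H` that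
converges in the `d_ρ`-completion converges in the Euclidean plane; every sequence in `H` that
converges in the Euclidean plane has at most one accumulation point in `∂_ρ H`; and `∂_ρ H` is
nonempty. -/
def IsDensity (ρ : HalfPlaneWeight) : Prop :=
  (∀ u : ℕ → RhoSpace ρ,
    (∃ ξ : RhoClosure ρ, Tendsto (fun n => (u n : RhoClosure ρ)) atTop (𝓝 ξ)) →
      ∃ a : ℂ, Tendsto (fun n => (u n).pt) atTop (𝓝 a)) ∧
  (∀ u : ℕ → RhoSpace ρ, (∃ a : ℂ, Tendsto (fun n => (u n).pt) atTop (𝓝 a)) →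
    ∀ ξ ∈ rhoBoundary ρ, ∀ η ∈ rhoBoundary ρ,
      MapClusterPt ξ atTop (fun n => (u n : RhoClosure ρ)) →
      MapClusterPt η atTop (fun n => (u n : RhoClosure ρ)) → ξ = η) ∧
  (rhoBoundary ρ).Nonempty

/-- The Harnack inequality for `ρ` on `U ⊆ H`: for some `c ≥ 1`, all `z ∈ U` and all
`w ∈ U` in the ball of radius `d(z) / 2 = z.im / 2` around `z`, one has
`c⁻¹ ≤ ρ(w) / ρ(z) ≤ c`. -/
def HarnackOn (ρ : ℂ → ℝ) (U : Set ℂ) : Prop :=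
  ∃ c : ℝ, 1 ≤ c ∧ ∀ z ∈ U, ∀ w ∈ U, dist w z < z.im / 2 → c⁻¹ ≤ ρ w / ρ z ∧ ρ w / ρ z ≤ c

/-- The `ρ`-length of the vertical segment of height `r` above the real point `x`. -/
def verticalLength (ρ : ℂ → ℝ) (x r : ℝ) : ℝ≥0∞ :=
  ∫⁻ t in Ioc 0 r, ENNReal.ofReal (ρ (x + t * Complex.I))

/-- The Gehring–Hayman estimate on `H`: up to a constant factor, the `d_ρ`-distance of two points
of `∂_ρ H`, lying over `x` and `y`, is the sum of the `ρ`-lengths of the vertical segments of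
height `|x - y|` above `x` and `y`. -/
def GehringHayman (ρ : HalfPlaneWeight) : Prop :=
  ∃ c : ℝ, 1 ≤ c ∧ ∀ ξ ∈ rhoBoundary ρ, ∀ η ∈ rhoBoundary ρ, ∃ x y : ℝ,
    LiesOver ξ x ∧ LiesOver η y ∧
    ENNReal.ofReal c⁻¹ * edist ξ η ≤ verticalLength ρ x |x - y| + verticalLength ρ y |x - y| ∧
    verticalLength ρ x |x - y| + verticalLength ρ y |x - y| ≤ ENNReal.ofReal c * edist ξ η

/-- The volume growth condition in dimension two: `μ_ρ(B_ρ(z, r)) ≤ c r²` for all `z ∈ H` and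
`r > 0`, where `μ_ρ(E) = ∫_E ρ²`. -/
def VolumeGrowth (ρ : HalfPlaneWeight) : Prop :=
  ∃ c : ℝ, 1 ≤ c ∧ ∀ (z : RhoSpace ρ) (r : ℝ), 0 < r →
    ∫⁻ w in RhoSpace.pt '' Metric.ball z r, ENNReal.ofReal (ρ w ^ 2) ≤ ENNReal.ofReal (c * r ^ 2)

/-- Conformal densities on `H`. -/
def IsConformalDensity (ρ : HalfPlaneWeight) : Prop :=
  IsDensity ρ ∧ HarnackOn ρ upperHalf ∧ VolumeGrowth ρ

/-- The left endpoint `∑ₖ iₖ 3⁻ᵏ` of the triadic interval `I_𝐢 ⊆ [0, 1]`, of length `3⁻ⁿ`, with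
address `𝐢 = (i₁, …, iₙ) ∈ {0, 1, 2}ⁿ`. -/
def triadicLeft {n : ℕ} (w : Fin n → Fin 3) : ℝ :=
  ∑ k : Fin n, ((w k : ℕ) : ℝ) / 3 ^ ((k : ℕ) + 1)

/-- The weight `ρ_𝐢`: a factor `3 ^ (-β)` for each digit `1` and a factor `3 ^ (-lam)` for each
digit `0` or `2`. -/
def triadicWeight (β lam : ℝ) {n : ℕ} (w : Fin n → Fin 3) : ℝ :=
  ∏ k : Fin n, if w k = 1 then (3 : ℝ) ^ (-β) else (3 : ℝ) ^ (-lam)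

/-- The centre of the box `Q_𝐢 = I_𝐢 × [|I_𝐢|, 3 |I_𝐢|]`. -/
def triadicCentre {n : ℕ} (w : Fin n → Fin 3) : ℂ :=
  ⟨triadicLeft w + (1 / 3) ^ n / 2, 2 * (1 / 3) ^ n⟩

/-- The rectangle `[0, 1] × (0, 3]`. -/
def baseRect : Set ℂ := {z | 0 ≤ z.re ∧ z.re ≤ 1 ∧ 0 < z.im ∧ z.im ≤ 3}

/-- A function on `[0, 1] × (0, 3]` as in the construction: continuous, positive, equal to `ρ_𝐢` at
the centre of each box `Q_𝐢`, and satisfying the Harnack inequality. -/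
def IsTriadicOnRect (β lam : ℝ) (ρ : ℂ → ℝ) : Prop :=
  ContinuousOn ρ baseRect ∧ (∀ z ∈ baseRect, 0 < ρ z) ∧ HarnackOn ρ baseRect ∧
  ∀ (n : ℕ) (w : Fin n → Fin 3), ρ (triadicCentre w) = triadicWeight β lam w

/-- A function on the whole half-plane as in the construction: the prescribed values are repeated
over the integer translates of `[0, 1]`, the function is bounded and bounded away from zero at
heights at least `3`, and the Harnack inequality holds on `H`. -/
def IsTriadicOnHalfPlane (β lam : ℝ) (ρ : HalfPlaneWeight) : Prop :=
  HarnackOn ρ upperHalf ∧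
  (∀ (m : ℤ) (n : ℕ) (w : Fin n → Fin 3), ρ (m + triadicCentre w) = triadicWeight β lam w) ∧
  ∃ C : ℝ, 1 ≤ C ∧ ∀ z : ℂ, 3 ≤ z.im → C⁻¹ ≤ ρ z ∧ ρ z ≤ C

/-- The ratio `(-t log t + (t - 1) log ((1 - t) / 2)) / ((1 + t β + (1 - t) λ) log 3)`, with
`0 log 0 = 0`. -/
def entropyRatio (β lam t : ℝ) : ℝ :=
  (-t * Real.log t + (t - 1) * Real.log ((1 - t) / 2)) /
    ((1 + t * β + (1 - t) * lam) * Real.log 3)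

end

/-! Write a_n(x) for the weight of the level-n triadic interval containing x, and σ = max(-β, -λ),
so 0 < σ < 1. Digits 0 and 2 carry the same factor, hence neighbouring intervals of one level have
weights within a factor 3 (`triadicValue_adjacent`), and the level-n weights of points at distance R
/ 3^n are within a factor 9 (2 + R) (`triadicAt_compare`). The Harnack inequality expresses
large-scale Lipschitz control of log ρ in the hyperbolic metric, so a function on the rectangle
arises by Lipschitz extension of the logarithms of the weights from the box centres
(`exists_lipschitz_log`). The same digit symmetry makes the weights invariant under x ↦ 1 - x, so
folding the half-plane onto the rectangle extends any such function.

For ρ on the half-plane, Harnack chains give a_n(x) / A ≤ ρ ≤ A a_n(x) (3^n y)^(-σ) at height y ≤ 3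
/ 3^n and horizontal distance at most 3 / 3^n from x (`TriadicBounds`): weights never decrease from
parent to child and grow by at most 3^σ. Since σ < 1, vertical segments have finite length, of order
a_n(x) / 3^n for height about 3^(-n). Going up, across and down bounds d_ρ from above, and the lower
bound on ρ bounds it from below: boundary points over x and y with |x - y| about 3^(-n) ≤ 1 are at
distance about a_n(x) / 3^n. This identifies the boundary with ℝ and yields the Gehring–Hayman
estimate. If moreover 2σ < 1, then ρ² is integrable down to the boundary with the same scaling,
which is the volume growth condition.

For the dimension, let s solve the Moran equation 3^(-(1+β)s) + 2 · 3^(-(1+λ)s) = 1. Then (a_n /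
3^n)^s is additive over children; it is the mass of a self-similar measure with distribution
function F. Hence |F(x) - F(y)| is comparable to the s-th power of the distance of the boundary
points over x and y when |x - y| ≤ 1, and F is a snowflake-type equivalence from pieces of the
boundary onto intervals. The dimension is therefore s (`le_dimH_rhoBoundary`,
`dimH_rhoBoundary_le`), and the Gibbs inequality identifies s with the maximum of the entropy ratio
(`MoranExponent.isMaxOn_entropyRatio`). -/

/-- The range of exponents: `-1 < β, λ < 0`. -/
structure ExponentRange (β lam : ℝ) : Prop where
  beta_gt : -1 < β
  beta_neg : β < 0
  lam_gt : -1 < lam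
  lam_neg : lam < 0

/-- The larger of the two growth exponents `-β` and `-λ`. -/
noncomputable def growthExponent (β lam : ℝ) : ℝ := max (-β) (-lam)

theorem ExponentRange.growth_pos {β lam : ℝ} (h : ExponentRange β lam) :
    0 < growthExponent β lam :=
  lt_max_of_lt_left (by linarith [h.beta_neg])

theorem ExponentRange.growth_lt_one {β lam : ℝ} (h : ExponentRange β lam) :
    growthExponent β lam < 1 :=
  max_lt (by linarith [h.beta_gt]) (by linarith [h.lam_gt])

/-- The factor by which the weight grows when passing to the child with last digit `j % 3`. -/
noncomputable def digitFactor (β lam : ℝ) (j : ℤ) : ℝ :=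
  if j % 3 = 1 then (3 : ℝ) ^ (-β) else (3 : ℝ) ^ (-lam)

/-- The weight of the triadic interval `[j / 3 ^ n, (j + 1) / 3 ^ n]`. -/
noncomputable def triadicValue (β lam : ℝ) : ℕ → ℤ → ℝ
  | 0, _ => 1
  | n + 1, j => triadicValue β lam n (j / 3) * digitFactor β lam j

/-- The weight of the triadic interval of level `n` that contains `x`. -/
noncomputable def triadicAt (β lam : ℝ) (n : ℕ) (x : ℝ) : ℝ :=
  triadicValue β lam n ⌊(3 : ℝ) ^ n * x⌋

/-! ### Growth and comparison of the triadic weights -/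

section weights

variable {β lam : ℝ} (h : ExponentRange β lam)
include h

theorem one_le_digitFactor (j : ℤ) : 1 ≤ digitFactor β lam j := by
  unfold digitFactor
  split_ifs
  · exact Real.one_le_rpow (by norm_num) (by linarith [h.beta_neg])
  · exact Real.one_le_rpow (by norm_num) (by linarith [h.lam_neg])

omit h in
theorem digitFactor_le (j : ℤ) : digitFactor β lam j ≤ 3 ^ growthExponent β lam := by
  unfold digitFactor
  split_ifs
  · exact Real.rpow_le_rpow_of_exponent_le (by norm_num) (le_max_left _ _)
  · exact Real.rpow_le_rpow_of_exponent_le (by norm_num) (le_max_right _ _)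

theorem three_rpow_growth_le : (3 : ℝ) ^ growthExponent β lam ≤ 3 := by
  simpa using Real.rpow_le_rpow_of_exponent_le (x := (3 : ℝ)) (by norm_num) h.growth_lt_one.le

theorem digitFactor_le_three (j : ℤ) : digitFactor β lam j ≤ 3 :=
  (digitFactor_le j).trans (three_rpow_growth_le h)

theorem one_le_triadicValue (n : ℕ) (j : ℤ) : 1 ≤ triadicValue β lam n j := by
  induction n generalizing j with
  | zero => exact le_rfl
  | succ n ih => exact one_le_mul_of_one_le_of_one_le (ih _) (one_le_digitFactor h j)

theorem triadicValue_pos (n : ℕ) (j : ℤ) : 0 < triadicValue β lam n j :=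
  one_pos.trans_le (one_le_triadicValue h n j)

theorem triadicValue_parent_le (n : ℕ) (j : ℤ) :
    triadicValue β lam n (j / 3) ≤ triadicValue β lam (n + 1) j :=
  le_mul_of_one_le_right (triadicValue_pos h _ _).le (one_le_digitFactor h j)

theorem triadicValue_succ_le (n : ℕ) (j : ℤ) :
    triadicValue β lam (n + 1) j ≤ 3 ^ growthExponent β lam * triadicValue β lam n (j / 3) := by
  rw [mul_comm]
  exact mul_le_mul_of_nonneg_left (digitFactor_le j) (triadicValue_pos h _ _).le

theorem triadicValue_succ_le_three (n : ℕ) (j : ℤ) :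
    triadicValue β lam (n + 1) j ≤ 3 * triadicValue β lam n (j / 3) :=
  (triadicValue_succ_le h n j).trans
    (mul_le_mul_of_nonneg_right (three_rpow_growth_le h) (triadicValue_pos h _ _).le)

/-- Siblings differ by the ratio of two factors in [1, 3]. If the parents differ, the last digits
are 2 and 0, whose factors agree, so the ratio is exactly that of the two adjacent parents and no
constant accumulates. -/
theorem triadicValue_adjacent (n : ℕ) (j : ℤ) :
    triadicValue β lam n (j + 1) ≤ 3 * triadicValue β lam n j ∧
      triadicValue β lam n j ≤ 3 * triadicValue β lam n (j + 1) := by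
  induction n generalizing j with
  | zero => simp [triadicValue]
  | succ n ih =>
    have hcase : (j + 1) / 3 = j / 3 ∨
        ((j + 1) / 3 = j / 3 + 1 ∧ (j + 1) % 3 ≠ 1 ∧ j % 3 ≠ 1) := by omega
    have p0 := triadicValue_pos h n (j / 3)
    have a1 := one_le_digitFactor h j
    have a2 := one_le_digitFactor h (j + 1)
    have b1 := digitFactor_le_three h j
    have b2 := digitFactor_le_three h (j + 1)
    rcases hcase with e | ⟨e, e1, e2⟩
    · simp only [triadicValue, e]
      constructor <;> nlinarith
    · have f1 : digitFactor β lam (j + 1) = digitFactor β lam j := by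
        simp [digitFactor, e1, e2]
      simp only [triadicValue, e, f1]
      obtain ⟨i1, i2⟩ := ih (j / 3)
      constructor <;> nlinarith

/-- As long as the parents are not equal or adjacent, one step to the children at least triples the
index distance minus one, which pays for the factor 3 that the weight may gain; subtracting one
makes this induction close without loss. Once the parents are equal or adjacent, 9 = 3 · 3 accounts
for one generation and one adjacency. -/
theorem triadicValue_le_of_ne (n : ℕ) (j k : ℤ) :
    triadicValue β lam n j ≤ 9 * max 1 (|(j : ℝ) - k| - 1) * triadicValue β lam n k := by
  induction n generalizing j k with
  | zero =>
    simp only [triadicValue]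
    nlinarith [le_max_left (1 : ℝ) (|(j : ℝ) - k| - 1)]
  | succ n ih =>
    have pk := triadicValue_pos h (n + 1) k
    by_cases hd : |j / 3 - k / 3| ≤ 1
    · have hadj : triadicValue β lam n (j / 3) ≤ 3 * triadicValue β lam n (k / 3) := by
        have hc : j / 3 = k / 3 ∨ j / 3 = k / 3 + 1 ∨ k / 3 = j / 3 + 1 := by
          rw [abs_le] at hd
          omega
        rcases hc with e | e | e
        · rw [e]
          linarith [triadicValue_pos h n (k / 3)]
        · rw [e]
          exact (triadicValue_adjacent h n _).1
        · rw [e]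
          exact (triadicValue_adjacent h n _).2
      have h1 := triadicValue_succ_le_three h n j
      have h2 := triadicValue_parent_le h n k
      have h3 := mul_le_mul_of_nonneg_right (le_max_left (1 : ℝ) (|(j : ℝ) - k| - 1)) pk.le
      nlinarith
    · have hd2 : 3 * (|j / 3 - k / 3| - 1) ≤ |j - k| - 1 := by
        rcases abs_cases (j / 3 - k / 3) with ⟨e, _⟩ | ⟨e, _⟩ <;>
        rcases abs_cases (j - k) with ⟨e', _⟩ | ⟨e', _⟩ <;> omega
      have hd3 : (1 : ℝ) ≤ |((j / 3 : ℤ) : ℝ) - (k / 3 : ℤ)| - 1 := by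
        have : 1 ≤ |j / 3 - k / 3| - 1 := by omega
        exact_mod_cast this
      have hd4 : 3 * (|((j / 3 : ℤ) : ℝ) - (k / 3 : ℤ)| - 1) ≤ |(j : ℝ) - k| - 1 := by
        exact_mod_cast hd2
      have h1 := triadicValue_succ_le_three h n j
      have h2 := triadicValue_parent_le h n k
      have h3 := ih (j / 3) (k / 3)
      rw [max_eq_right hd3] at h3
      calc triadicValue β lam (n + 1) j ≤ 3 * triadicValue β lam n (j / 3) := h1
        _ ≤ 3 * (9 * (|((j / 3 : ℤ) : ℝ) - (k / 3 : ℤ)| - 1) * triadicValue β lam n (k / 3)) := by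
          gcongr
        _ = 9 * (3 * (|((j / 3 : ℤ) : ℝ) - (k / 3 : ℤ)| - 1)) * triadicValue β lam n (k / 3) := by
          ring
        _ ≤ 9 * max 1 (|(j : ℝ) - k| - 1) * triadicValue β lam (n + 1) k := by
          gcongr
          · exact (triadicValue_pos h _ _).le
          · exact hd4.trans (le_max_right _ _)

theorem triadicValue_compare (n : ℕ) (j k : ℤ) :
    triadicValue β lam n j ≤ 9 * (1 + |(j : ℝ) - k|) * triadicValue β lam n k := by
  refine (triadicValue_le_of_ne h n j k).trans ?_
  have := triadicValue_pos h n k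
  gcongr
  exact max_le (by linarith [abs_nonneg ((j : ℝ) - k)]) (by linarith)

omit h in
theorem floor_three_pow_succ (n : ℕ) (x : ℝ) :
    ⌊(3 : ℝ) ^ (n + 1) * x⌋ / 3 = ⌊(3 : ℝ) ^ n * x⌋ := by
  have := Int.floor_div_natCast ((3 : ℝ) ^ (n + 1) * x) 3
  rw [show (3 : ℝ) ^ (n + 1) * x / (3 : ℕ) = 3 ^ n * x by push_cast; ring] at this
  exact this.symm

theorem triadicAt_pos (n : ℕ) (x : ℝ) : 0 < triadicAt β lam n x := triadicValue_pos h _ _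

omit h in
theorem triadicAt_zero (x : ℝ) : triadicAt β lam 0 x = 1 := rfl

theorem triadicAt_le_succ (n : ℕ) (x : ℝ) : triadicAt β lam n x ≤ triadicAt β lam (n + 1) x := by
  have := triadicValue_parent_le h n ⌊(3 : ℝ) ^ (n + 1) * x⌋
  rwa [floor_three_pow_succ] at this

theorem triadicAt_mono (x : ℝ) : Monotone fun n => triadicAt β lam n x :=
  monotone_nat_of_le_succ fun n => triadicAt_le_succ h n x

theorem triadicAt_succ_le (n : ℕ) (x : ℝ) :
    triadicAt β lam (n + 1) x ≤ 3 ^ growthExponent β lam * triadicAt β lam n x := by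
  have := triadicValue_succ_le h n ⌊(3 : ℝ) ^ (n + 1) * x⌋
  rwa [floor_three_pow_succ] at this

theorem triadicAt_add_le (n k : ℕ) (x : ℝ) :
    triadicAt β lam (n + k) x ≤ (3 ^ growthExponent β lam) ^ k * triadicAt β lam n x := by
  induction k with
  | zero => simp
  | succ k ih =>
    calc triadicAt β lam (n + k + 1) x
        ≤ 3 ^ growthExponent β lam * triadicAt β lam (n + k) x := triadicAt_succ_le h _ _
      _ ≤ 3 ^ growthExponent β lam * ((3 ^ growthExponent β lam) ^ k * triadicAt β lam n x) := by
        gcongr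
      _ = _ := by ring

theorem triadicAt_compare (n : ℕ) {x y R : ℝ} (hxy : |x - y| ≤ R / 3 ^ n) :
    triadicAt β lam n x ≤ 9 * (2 + R) * triadicAt β lam n y := by
  refine (triadicValue_compare h n _ ⌊(3 : ℝ) ^ n * y⌋).trans ?_
  have := triadicValue_pos h n ⌊(3 : ℝ) ^ n * y⌋
  have h3 : (0 : ℝ) < 3 ^ n := by positivity
  have h1 : |(3 : ℝ) ^ n * x - 3 ^ n * y| ≤ R := by
    rw [← mul_sub, abs_mul, abs_of_pos h3]
    rwa [le_div_iff₀ h3, mul_comm] at hxy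
  have h2 : |(⌊(3 : ℝ) ^ n * x⌋ : ℝ) - ⌊(3 : ℝ) ^ n * y⌋| ≤ R + 1 := by
    rw [abs_le] at h1 ⊢
    have := Int.floor_le ((3 : ℝ) ^ n * x)
    have := Int.lt_floor_add_one ((3 : ℝ) ^ n * x)
    have := Int.floor_le ((3 : ℝ) ^ n * y)
    have := Int.lt_floor_add_one ((3 : ℝ) ^ n * y)
    constructor <;> linarith
  exact mul_le_mul_of_nonneg_right (by linarith) this.le

end weights

/-! ### Addresses -/

theorem triadicLeft_snoc {n : ℕ} (w : Fin n → Fin 3) (d : Fin 3) :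
    triadicLeft (Fin.snoc w d : Fin (n + 1) → Fin 3)
      = triadicLeft w + ((d : ℕ) : ℝ) / 3 ^ (n + 1) := by
  simp [triadicLeft, Fin.sum_univ_castSucc]

theorem triadicWeight_snoc (β lam : ℝ) {n : ℕ} (w : Fin n → Fin 3) (d : Fin 3) :
    triadicWeight β lam (Fin.snoc w d : Fin (n + 1) → Fin 3)
      = triadicWeight β lam w * if d = 1 then (3 : ℝ) ^ (-β) else (3 : ℝ) ^ (-lam) := by
  simp [triadicWeight, Fin.prod_univ_castSucc]

theorem digitFactor_three_mul_add (β lam : ℝ) (j : ℤ) (d : Fin 3) :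
    digitFactor β lam (3 * j + (d : ℕ)) = if d = 1 then (3 : ℝ) ^ (-β) else (3 : ℝ) ^ (-lam) := by
  unfold digitFactor
  fin_cases d <;> simp

theorem triadicValue_three_mul_add (β lam : ℝ) (n : ℕ) (j : ℤ) (d : Fin 3) :
    triadicValue β lam (n + 1) (3 * j + (d : ℕ))
      = triadicValue β lam n j * if d = 1 then (3 : ℝ) ^ (-β) else (3 : ℝ) ^ (-lam) := by
  rw [triadicValue, digitFactor_three_mul_add]
  congr 2
  have := d.2
  omega

/-- The centre of the box over the triadic interval `[j / 3 ^ n, (j + 1) / 3 ^ n]`. -/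
noncomputable def boxCentre (n : ℕ) (j : ℤ) : ℂ := ⟨(j + 1 / 2) / 3 ^ n, 2 / 3 ^ n⟩

theorem boxCentre_im_pos (n : ℕ) (j : ℤ) : 0 < (boxCentre n j).im := by
  simp only [boxCentre]
  positivity

/-- Arbitrary integer indices encode words together with an integer translation: the last n ternary
digits form the word and the remaining quotient is m. Floor division makes this uniform in the sign
of j. -/
theorem exists_address (β lam : ℝ) (n : ℕ) (j : ℤ) :
    ∃ (m : ℤ) (w : Fin n → Fin 3), (m : ℝ) + triadicLeft w = j / 3 ^ n ∧
      triadicWeight β lam w = triadicValue β lam n j := by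
  induction n generalizing j with
  | zero => exact ⟨j, Fin.elim0, by simp [triadicLeft], by simp [triadicWeight, triadicValue]⟩
  | succ n ih =>
    obtain ⟨m, w, h1, h2⟩ := ih (j / 3)
    obtain ⟨d, hd⟩ : ∃ d : Fin 3, j = 3 * (j / 3) + (d : ℕ) :=
      ⟨⟨(j % 3).toNat, by omega⟩, by simp only; omega⟩
    refine ⟨m, Fin.snoc w d, ?_, ?_⟩
    · rw [triadicLeft_snoc, ← add_assoc, h1]
      conv_rhs => rw [hd]
      push_cast
      field_simp
      ring
    · rw [triadicWeight_snoc, h2]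
      conv_rhs => rw [hd, triadicValue_three_mul_add]

theorem exists_index (β lam : ℝ) {n : ℕ} (w : Fin n → Fin 3) :
    ∃ j : ℤ, 0 ≤ j ∧ j < 3 ^ n ∧ triadicLeft w = j / 3 ^ n ∧
      triadicWeight β lam w = triadicValue β lam n j := by
  induction n with
  | zero => exact ⟨0, by simp [triadicLeft, triadicWeight, triadicValue]⟩
  | succ n ih =>
    induction w using Fin.snocCases with
    | _ w d =>
    obtain ⟨j, h0, h3, h1, h2⟩ := ih w
    have := d.2
    refine ⟨3 * j + (d : ℕ), by omega, by rw [pow_succ]; omega, ?_, ?_⟩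
    · rw [triadicLeft_snoc, h1]
      push_cast
      field_simp
      ring
    · rw [triadicWeight_snoc, h2, triadicValue_three_mul_add]

theorem add_triadicCentre_eq {n : ℕ} {w : Fin n → Fin 3} {m j : ℤ}
    (h : (m : ℝ) + triadicLeft w = j / 3 ^ n) :
    (m : ℂ) + triadicCentre w = boxCentre n j := by
  apply Complex.ext
  · simp only [triadicCentre, boxCentre, Complex.add_re, Complex.intCast_re, one_div, inv_pow]
    rw [← add_assoc, h]
    field_simp
  · simp [triadicCentre, boxCentre]
    rfl

/-! ### Existence of a function on the base rectangle -/

theorem triadicAt_boxCentre (β lam : ℝ) (n : ℕ) (j : ℤ) :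
    triadicAt β lam n (boxCentre n j).re = triadicValue β lam n j := by
  have : ⌊(3 : ℝ) ^ n * (boxCentre n j).re⌋ = j := by
    rw [show (3 : ℝ) ^ n * (boxCentre n j).re = j + 1 / 2 by simp only [boxCentre]; field_simp]
    rw [Int.floor_eq_iff]
    constructor <;> linarith
  rw [triadicAt, this]

/-- The centre of a box as a point of Mathlib's upper half-plane. -/
noncomputable def hypCentre (p : ℕ × ℤ) : UpperHalfPlane :=
  ⟨boxCentre p.1 p.2, boxCentre_im_pos _ _⟩

theorem hypCentre_im (p : ℕ × ℤ) : (hypCentre p).im = 2 / 3 ^ p.1 := rfl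

theorem coe_hypCentre (p : ℕ × ℤ) : (hypCentre p : ℂ) = boxCentre p.1 p.2 := rfl

/-- The logarithm of the ratio of two heights is at most the hyperbolic distance, so that distance
controls the number of generations between two boxes. -/
theorem pow_le_exp_dist {p q : ℕ × ℤ} (hpq : q.1 ≤ p.1) :
    (3 : ℝ) ^ (p.1 - q.1) ≤ Real.exp (dist (hypCentre p) (hypCentre q)) := by
  have h1 := UpperHalfPlane.im_le_im_mul_exp_dist (hypCentre q) (hypCentre p)
  rw [hypCentre_im, hypCentre_im, dist_comm] at h1
  rw [pow_sub₀ _ (by norm_num) hpq]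
  field_simp at h1 ⊢
  linarith

theorem abs_re_sub_le_exp_dist (p q : ℕ × ℤ) :
    |(boxCentre p.1 p.2).re - (boxCentre q.1 q.2).re|
      ≤ 2 * (Real.exp (dist (hypCentre p) (hypCentre q)) - 1) / 3 ^ q.1 := by
  have h1 := UpperHalfPlane.dist_coe_le (hypCentre p) (hypCentre q)
  rw [hypCentre_im, Complex.dist_eq] at h1
  have h2 := Complex.abs_re_le_norm ((hypCentre p : ℂ) - hypCentre q)
  rw [Complex.sub_re, coe_hypCentre, coe_hypCentre] at h2
  refine h2.trans (h1.trans (le_of_eq ?_))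
  ring

/-- Distinct centres are uniformly separated: their heights differ by a factor of at least 3, or
they have equal height and are at least one box width apart. The gap serves to absorb a
multiplicative constant into a Lipschitz constant. -/
theorem three_halves_le_exp_dist {p q : ℕ × ℤ} (hpq : p ≠ q) :
    3 / 2 ≤ Real.exp (dist (hypCentre p) (hypCentre q)) := by
  wlog hle : q.1 ≤ p.1 generalizing p q
  · rw [dist_comm]
    exact this hpq.symm (by omega)
  rcases hle.lt_or_eq with hlt | heq
  · have h1 := pow_le_exp_dist hle
    have h2 : (3 : ℝ) ^ 1 ≤ 3 ^ (p.1 - q.1) := pow_le_pow_right₀ (by norm_num) (by omega)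
    linarith
  · have hne : p.2 ≠ q.2 := fun h => hpq (Prod.ext heq.symm h)
    have h1 := abs_re_sub_le_exp_dist p q
    have h2 : (boxCentre p.1 p.2).re - (boxCentre q.1 q.2).re
        = ((p.2 : ℝ) - q.2) / 3 ^ q.1 := by
      simp only [boxCentre, ← heq]
      ring
    rw [h2, abs_div, abs_of_pos (show (0 : ℝ) < 3 ^ q.1 by positivity)] at h1
    rw [div_le_div_iff_of_pos_right (by positivity)] at h1
    have h3 : (1 : ℝ) ≤ |(p.2 : ℝ) - q.2| := by
      exact_mod_cast Int.one_le_abs (sub_ne_zero.2 hne)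
    linarith

theorem hypCentre_injective : Function.Injective hypCentre := by
  intro p q hpq
  by_contra hne
  have := three_halves_le_exp_dist hne
  rw [hpq, dist_self, Real.exp_zero] at this
  norm_num at this

/-- With D the hyperbolic distance, one factor exp D pays for the change of level and the other for
the horizontal displacement, since 9 (2 + 2 (exp D - 1)) = 18 exp D. -/
theorem triadicValue_le_exp_dist {β lam : ℝ} (h : ExponentRange β lam) (p q : ℕ × ℤ) :
    triadicValue β lam p.1 p.2
      ≤ 18 * Real.exp (2 * dist (hypCentre p) (hypCentre q)) * triadicValue β lam q.1 q.2 := by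
  set D := dist (hypCentre p) (hypCentre q) with hD
  have hD1 : 1 ≤ Real.exp D := Real.one_le_exp dist_nonneg
  have he : Real.exp (2 * D) = Real.exp D * Real.exp D := by rw [← Real.exp_add]; ring_nf
  rw [← triadicAt_boxCentre, ← triadicAt_boxCentre β lam q.1, he]
  have pq := triadicAt_pos h q.1 (boxCentre q.1 q.2).re
  rcases le_total q.1 p.1 with hle | hle
  · have h1 := pow_le_exp_dist hle
    have h2 := triadicAt_add_le h q.1 (p.1 - q.1) (boxCentre p.1 p.2).re
    rw [Nat.add_sub_cancel' hle] at h2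
    have h3 := triadicAt_compare h q.1 (abs_re_sub_le_exp_dist p q)
    have h4 : ((3 : ℝ) ^ growthExponent β lam) ^ (p.1 - q.1) ≤ Real.exp D :=
      (pow_le_pow_left₀ (by positivity) (three_rpow_growth_le h) _).trans h1
    have pp := triadicAt_pos h q.1 (boxCentre p.1 p.2).re
    calc _ ≤ _ := h2
      _ ≤ Real.exp D * (9 * (2 + 2 * (Real.exp D - 1))
            * triadicAt β lam q.1 (boxCentre q.1 q.2).re) := by gcongr
      _ = _ := by ring
  · have h2 := triadicAt_mono h (boxCentre q.1 q.2).re hle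
    have h3 := triadicAt_compare h p.1 (y := (boxCentre q.1 q.2).re)
      (R := 2 * (Real.exp D - 1)) (by
        have := abs_re_sub_le_exp_dist q p
        rwa [abs_sub_comm, dist_comm] at this)
    calc _ ≤ _ := h3
      _ ≤ 9 * (2 + 2 * (Real.exp D - 1)) * triadicAt β lam q.1 (boxCentre q.1 q.2).re := by
        gcongr
      _ = 18 * (1 * Real.exp D) * triadicAt β lam q.1 (boxCentre q.1 q.2).re := by ring
      _ ≤ _ := by gcongr

/-- The logarithm of the weight is Lipschitz on the discrete set of centres in the hyperbolic
metric, and a real-valued Lipschitz function on a subset extends. Its exponential is the required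
function, because Euclidean balls of radius half the height have bounded hyperbolic size. -/
theorem exists_lipschitz_log {β lam : ℝ} (h : ExponentRange β lam) :
    ∃ (C : NNReal) (g : UpperHalfPlane → ℝ), LipschitzWith C g ∧
      ∀ p : ℕ × ℤ, g (hypCentre p) = Real.log (triadicValue β lam p.1 p.2) := by
  have hlog : 0 < Real.log (3 / 2) := Real.log_pos (by norm_num)
  have hlog18 : 0 < Real.log 18 := Real.log_pos (by norm_num)
  -- The bound 2 D + log 18 becomes linear in D because D ≥ log (3 / 2) at distinct centres.
  set C : ℝ := 2 + Real.log 18 / Real.log (3 / 2) with hC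
  have hC0 : 0 ≤ C := by positivity
  set f : UpperHalfPlane → ℝ :=
    Function.extend hypCentre (fun p => Real.log (triadicValue β lam p.1 p.2)) 0 with hf
  have hfp : ∀ p, f (hypCentre p) = Real.log (triadicValue β lam p.1 p.2) :=
    fun p => hypCentre_injective.extend_apply _ _ _
  have hL : LipschitzOnWith (Real.toNNReal C) f (range hypCentre) := by
    refine LipschitzOnWith.of_le_add_mul _ ?_
    rintro _ ⟨p, rfl⟩ _ ⟨q, rfl⟩
    rw [hfp, hfp, Real.coe_toNNReal _ hC0]
    by_cases hpq : p = q
    · subst hpq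
      simp
    have h1 := triadicValue_le_exp_dist h p q
    have h2 := three_halves_le_exp_dist hpq
    set D := dist (hypCentre p) (hypCentre q)
    have hq := triadicValue_pos h q.1 q.2
    have h3 := Real.log_le_log (triadicValue_pos h p.1 p.2) h1
    rw [Real.log_mul (by positivity) hq.ne', Real.log_mul (by norm_num) (by positivity),
      Real.log_exp] at h3
    have h4 : Real.log (3 / 2) ≤ D := by
      have := Real.log_le_log (by norm_num) h2
      rwa [Real.log_exp] at this
    have h5 : Real.log 18 ≤ Real.log 18 / Real.log (3 / 2) * D := by
      rw [div_mul_eq_mul_div, le_div_iff₀ hlog]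
      gcongr
    have : C * D = 2 * D + Real.log 18 / Real.log (3 / 2) * D := by rw [hC]; ring
    linarith
  obtain ⟨g, hg, hgf⟩ := hL.extend_real
  exact ⟨_, g, hg, fun p => (hgf ⟨p, rfl⟩).symm.trans (hfp p)⟩

theorem hyp_dist_le_one {z w : UpperHalfPlane} (hzw : dist (w : ℂ) z < z.im / 2) :
    dist w z ≤ 1 := by
  have hz := z.im_pos
  have h1 : z.im / 2 ≤ w.im := by
    have := Complex.abs_im_le_norm ((w : ℂ) - z)
    rw [← Complex.dist_eq, Complex.sub_im, abs_le] at this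
    have e1 : (w : ℂ).im = w.im := rfl
    have e2 : (z : ℂ).im = z.im := rfl
    linarith [this.1]
  refine (UpperHalfPlane.dist_le_dist_coe_div_sqrt w z).trans ?_
  have h2 : z.im / 2 ≤ √(w.im * z.im) := Real.le_sqrt_of_sq_le (by nlinarith)
  rw [div_le_one (by linarith)]
  linarith

theorem exists_isTriadicOnRect {β lam : ℝ} (h : ExponentRange β lam) :
    ∃ ρ₀ : ℂ → ℝ, IsTriadicOnRect β lam ρ₀ := by
  obtain ⟨C, g, hg, hgp⟩ := exists_lipschitz_log h
  have hof : ∀ z ∈ baseRect, 0 < z.im := fun z hz => hz.2.2.1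
  refine ⟨fun z => Real.exp (g (UpperHalfPlane.ofComplex z)), ?_, fun _ _ => Real.exp_pos _,
    ⟨Real.exp C, Real.one_le_exp C.2, ?_⟩, ?_⟩
  · intro z hz
    refine ContinuousAt.continuousWithinAt ?_
    refine (Real.continuous_exp.comp hg.continuous).continuousAt.comp ?_
    exact (UpperHalfPlane.contMDiffAt_ofComplex (n := 0) (hof z hz)).continuousAt
  · intro z hz w hw hzw
    simp only [UpperHalfPlane.ofComplex_apply_of_im_pos (hof z hz),
      UpperHalfPlane.ofComplex_apply_of_im_pos (hof w hw), ← Real.exp_sub]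
    have h1 : dist (⟨w, hof w hw⟩ : UpperHalfPlane) ⟨z, hof z hz⟩ ≤ 1 := hyp_dist_le_one hzw
    have h2 := (hg.dist_le_mul (⟨w, hof w hw⟩ : UpperHalfPlane) ⟨z, hof z hz⟩).trans
      (mul_le_mul_of_nonneg_left h1 C.2)
    rw [Real.dist_eq, mul_one, abs_le] at h2
    rw [← Real.exp_neg, Real.exp_le_exp, Real.exp_le_exp]
    exact h2
  · intro n w
    obtain ⟨j, -, -, h1, h2⟩ := exists_index β lam w
    have h3 : triadicCentre w = boxCentre n j := by
      have := add_triadicCentre_eq (m := 0) (w := w) (j := j) (by simpa using h1)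
      simpa using this
    simp only [h3, UpperHalfPlane.ofComplex_apply_of_im_pos (boxCentre_im_pos n j), h2]
    rw [← Real.exp_log (triadicValue_pos h n j), ← hgp (n, j)]
    rfl

/-! ### Extension to the half-plane by reflection -/

/-- Reflecting the unit interval exchanges the digits 0 and 2, which have equal factors. Hence
folding at the integers reproduces the prescribed values over odd translates too. -/
theorem triadicValue_reflect (β lam : ℝ) (n : ℕ) (j : ℤ) :
    triadicValue β lam n (3 ^ n - 1 - j) = triadicValue β lam n j := by
  induction n generalizing j with
  | zero => rfl
  | succ n ih =>
    have e1 : ((3 : ℤ) ^ (n + 1) - 1 - j) / 3 = 3 ^ n - 1 - j / 3 := by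
      rw [pow_succ]
      omega
    have e2 : ((3 : ℤ) ^ (n + 1) - 1 - j) % 3 = 1 ↔ j % 3 = 1 := by
      rw [pow_succ]
      omega
    simp only [triadicValue, e1, ih, digitFactor, e2]

theorem exists_word_of_lt (β lam : ℝ) {n : ℕ} {j : ℤ} (h0 : 0 ≤ j) (h1 : j < 3 ^ n) :
    ∃ w : Fin n → Fin 3, triadicCentre w = boxCentre n j ∧
      triadicWeight β lam w = triadicValue β lam n j := by
  obtain ⟨m, w, hw, hv⟩ := exists_address β lam n j
  obtain ⟨i, hi0, hi1, hi, -⟩ := exists_index β lam w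
  have hm : m = 0 := by
    rw [hi] at hw
    have h3 : (3 : ℝ) ^ n ≠ 0 := by positivity
    field_simp at hw
    have hw' : (3 : ℤ) ^ n * m + i = j := by exact_mod_cast (by linarith : (3 : ℝ) ^ n * m + i = j)
    have h3' : (0 : ℤ) < 3 ^ n := by positivity
    by_contra hne
    rcases lt_or_gt_of_ne hne with hlt | hgt
    · nlinarith
    · nlinarith
  refine ⟨w, ?_, hv⟩
  have := add_triadicCentre_eq hw
  rwa [hm, Int.cast_zero, zero_add] at this

/-- The distance from `x` to the nearest even integer. -/
noncomputable def triangleWave (x : ℝ) : ℝ := 2 * |x / 2 - round (x / 2)|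

theorem triangleWave_nonneg (x : ℝ) : 0 ≤ triangleWave x := by
  unfold triangleWave
  positivity

theorem triangleWave_le_one (x : ℝ) : triangleWave x ≤ 1 := by
  have := abs_sub_round (x / 2)
  unfold triangleWave
  linarith

theorem triangleWave_le (x : ℝ) (m : ℤ) : triangleWave x ≤ |x - 2 * m| := by
  have := round_le (x / 2) m
  have e : |x - 2 * m| = 2 * |x / 2 - m| := by
    rw [← abs_two, ← abs_mul, abs_two]
    ring_nf
  unfold triangleWave
  linarith

theorem triangleWave_lipschitz (x y : ℝ) : |triangleWave x - triangleWave y| ≤ |x - y| := by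
  have key : ∀ x y : ℝ, triangleWave x ≤ |x - y| + triangleWave y := by
    intro x y
    refine (triangleWave_le x (round (y / 2))).trans ?_
    have e : triangleWave y = |y - 2 * round (y / 2)| := by
      rw [triangleWave, ← abs_two, ← abs_mul, abs_two]
      ring_nf
    rw [e]
    exact abs_sub_le _ _ _
  rw [abs_le]
  have h1 := key x y
  have h2 := key y x
  rw [abs_sub_comm y x] at h2
  constructor <;> linarith

theorem triangleWave_eq {x y : ℝ} (h0 : 0 ≤ y) (h1 : y ≤ 1) (m : ℤ)
    (h : x = 2 * m + y ∨ x = 2 * m - y) : triangleWave x = y := by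
  refine le_antisymm ((triangleWave_le x m).trans ?_) ?_
  · rcases h with rfl | rfl <;> ring_nf
    · rw [abs_of_nonneg h0]
    · rw [abs_neg, abs_of_nonneg h0]
  · have e : triangleWave x = |x - 2 * round (x / 2)| := by
      rw [triangleWave, ← abs_two, ← abs_mul, abs_two]
      ring_nf
    rw [e]
    generalize round (x / 2) = k
    rcases lt_trichotomy m k with hk | rfl | hk
    · have : (m : ℝ) + 1 ≤ k := by exact_mod_cast hk
      refine le_trans ?_ (neg_le_abs _)
      rcases h with rfl | rfl <;> linarith
    · rcases h with rfl | rfl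
      · exact le_trans (by linarith) (le_abs_self _)
      · exact le_trans (by linarith) (neg_le_abs _)
    · have : (k : ℝ) + 1 ≤ m := by exact_mod_cast hk
      refine le_trans ?_ (le_abs_self _)
      rcases h with rfl | rfl <;> linarith

/-- The folding map of the half-plane onto the base rectangle. -/
noncomputable def foldRect (z : ℂ) : ℂ := ⟨triangleWave z.re, min z.im 3⟩

theorem foldRect_mem {z : ℂ} (hz : z ∈ upperHalf) : foldRect z ∈ baseRect :=
  ⟨triangleWave_nonneg _, triangleWave_le_one _, lt_min hz (by norm_num), min_le_right _ _⟩

theorem foldRect_of_mem {z : ℂ} (hz : z ∈ baseRect) : foldRect z = z := by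
  refine Complex.ext ?_ ?_
  · exact triangleWave_eq hz.1 hz.2.1 0 (by simp)
  · exact min_eq_left hz.2.2.2

theorem continuous_foldRect : Continuous foldRect := by
  have h1 : Continuous triangleWave := by
    refine (LipschitzWith.of_dist_le_mul (K := 1) fun x y => ?_).continuous
    simpa [Real.dist_eq] using triangleWave_lipschitz x y
  have : foldRect = fun z => Complex.equivRealProdCLM.symm (triangleWave z.re, min z.im 3) := by
    funext z
    apply Complex.ext <;> simp [foldRect]
  rw [this]
  refine Complex.equivRealProdCLM.symm.continuous.comp (Continuous.prodMk ?_ ?_)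
  · exact h1.comp Complex.continuous_re
  · exact Complex.continuous_im.min continuous_const

theorem abs_min_sub_min_le (a b c : ℝ) : |min a c - min b c| ≤ |a - b| := by
  simpa using abs_min_sub_min_le_max a c b c

theorem dist_foldRect_le (z w : ℂ) : dist (foldRect z) (foldRect w) ≤ dist z w := by
  rw [Complex.dist_eq_re_im, Complex.dist_eq_re_im]
  apply Real.sqrt_le_sqrt
  have h1 := sq_le_sq.2 (triangleWave_lipschitz z.re w.re)
  have h2 := sq_le_sq.2 (abs_min_sub_min_le z.im w.im 3)
  simpa [foldRect] using add_le_add h1 h2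

/-- Folding does not increase distances and keeps heights up to 3, so below height 3 the inequality
is inherited. Above height 3 the folded centre has height 3 and the folded pair differs by at most 1
horizontally and 3 / 2 vertically; this may exceed the admissible radius 3 / 2, but two steps
through the midpoint suffice, at the cost of squaring the constant. -/
theorem harnackOn_comp_foldRect {ρ₀ : ℂ → ℝ} (hpos : ∀ z ∈ baseRect, 0 < ρ₀ z)
    (hH : HarnackOn ρ₀ baseRect) : HarnackOn (fun z => ρ₀ (foldRect z)) upperHalf := by
  obtain ⟨c, hc, hH⟩ := hH
  refine ⟨c * c, one_le_mul_of_one_le_of_one_le hc hc, fun z hz w hw hzw => ?_⟩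
  have c0 : 0 < c := by linarith
  have mz := foldRect_mem hz
  have mw := foldRect_mem hw
  have hzim : 0 < z.im := hz
  have him : |w.im - z.im| < z.im / 2 := by
    refine lt_of_le_of_lt ?_ hzw
    rw [Complex.dist_eq, ← Complex.sub_im]
    exact Complex.abs_im_le_norm _
  have hinv : c⁻¹ ≤ 1 := inv_le_one_of_one_le₀ hc
  have hinv0 : 0 < c⁻¹ := inv_pos.2 c0
  by_cases h3 : z.im ≤ 3
  · have hd : dist (foldRect w) (foldRect z) < (foldRect z).im / 2 := by
      refine (dist_foldRect_le w z).trans_lt ?_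
      simpa [foldRect, min_eq_left h3] using hzw
    obtain ⟨h1, h2⟩ := hH _ mz _ mw hd
    refine ⟨le_trans ?_ h1, h2.trans ?_⟩
    · rw [mul_inv]
      nlinarith
    · nlinarith
  · push Not at h3
    rw [abs_lt] at him
    have w1 : 3 / 2 ≤ (foldRect w).im := le_min (by linarith [him.1]) (by norm_num)
    have w2 : (foldRect w).im ≤ 3 := min_le_right _ _
    have z1 : (foldRect z).im = 3 := min_eq_right h3.le
    set a := foldRect z with ha
    set b := foldRect w with hb
    set v : ℂ := ⟨(a.re + b.re) / 2, (a.im + b.im) / 2⟩ with hv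
    have mv : v ∈ baseRect := by
      obtain ⟨q1, q2, q3, q4⟩ := mz
      obtain ⟨r1, r2, r3, r4⟩ := mw
      refine ⟨?_, ?_, ?_, ?_⟩ <;> simp only [hv] <;> linarith
    have hsq : (a.re - b.re) ^ 2 ≤ 1 := by
      have := mz.1; have := mz.2.1; have := mw.1; have := mw.2.1
      nlinarith
    have hsq2 : (a.im - b.im) ^ 2 ≤ (3 / 2) ^ 2 := by nlinarith
    have d1 : dist v a < a.im / 2 := by
      rw [z1, Complex.dist_eq_re_im, Real.sqrt_lt' (by norm_num)]
      simp only [hv]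
      nlinarith
    have d2 : dist b v < v.im / 2 := by
      have : (9 / 4 : ℝ) ≤ v.im := by simp only [hv]; linarith
      refine lt_of_lt_of_le ?_ (by linarith : (9 / 8 : ℝ) ≤ v.im / 2)
      rw [Complex.dist_eq_re_im, Real.sqrt_lt' (by norm_num)]
      simp only [hv]
      nlinarith
    obtain ⟨h1, h2⟩ := hH _ mz _ mv d1
    obtain ⟨h3, h4⟩ := hH _ mv _ mw d2
    have e : ρ₀ b / ρ₀ a = (ρ₀ b / ρ₀ v) * (ρ₀ v / ρ₀ a) := by
      have := hpos _ mv
      field_simp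
    change (c * c)⁻¹ ≤ ρ₀ b / ρ₀ a ∧ ρ₀ b / ρ₀ a ≤ c * c
    rw [e, mul_inv]
    exact ⟨mul_le_mul h3 h1 hinv0.le (hinv0.le.trans h3),
      mul_le_mul h4 h2 (hinv0.le.trans h1) c0.le⟩

theorem exists_extension_of_isTriadicOnRect {β lam : ℝ} {ρ₀ : ℂ → ℝ}
    (h₀ : IsTriadicOnRect β lam ρ₀) :
    ∃ ρ : HalfPlaneWeight, IsTriadicOnHalfPlane β lam ρ ∧ EqOn ρ ρ₀ baseRect := by
  obtain ⟨hcont, hpos, hH, hval⟩ := h₀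
  have hc : ContinuousOn (fun z => ρ₀ (foldRect z)) upperHalf :=
    hcont.comp continuous_foldRect.continuousOn fun z hz => foldRect_mem hz
  refine ⟨⟨fun z => ρ₀ (foldRect z), hc, fun z hz => hpos _ (foldRect_mem hz)⟩,
    ⟨harnackOn_comp_foldRect hpos hH, ?_, ?_⟩, fun z hz => congrArg ρ₀ (foldRect_of_mem hz)⟩
  · intro m n w
    obtain ⟨j, hj0, hj1, hj, hv⟩ := exists_index β lam w
    have hcw : triadicCentre w = boxCentre n j := by
      have := add_triadicCentre_eq (m := 0) (w := w) (j := j) (by simpa using hj)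
      simpa using this
    have h3 : (0 : ℝ) < 3 ^ n := by positivity
    have h31 : (1 : ℝ) ≤ 3 ^ n := one_le_pow₀ (by norm_num)
    have him : ∀ k : ℤ, min (((m : ℂ) + boxCentre n j).im) 3 = (boxCentre n k).im := by
      intro k
      have : (2 : ℝ) / 3 ^ n ≤ 3 := by
        rw [div_le_iff₀ h3]
        linarith
      simpa [boxCentre] using this
    have hj0' : (0 : ℝ) ≤ j := by exact_mod_cast hj0
    have hj1' : (j : ℝ) + 1 ≤ 3 ^ n := by exact_mod_cast hj1
    have hu0 : 0 ≤ ((j : ℝ) + 1 / 2) / 3 ^ n := by positivity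
    have hu1 : ((j : ℝ) + 1 / 2) / 3 ^ n ≤ 1 := by
      rw [div_le_one h3]
      linarith
    change ρ₀ (foldRect (m + triadicCentre w)) = _
    rw [hcw, hv]
    -- Even translates fold back by a translation, odd ones by a reflection, which sends index j to
    -- 3^n - 1 - j.
    rcases Int.even_or_odd' m with ⟨k, rfl | rfl⟩
    · have : foldRect (((2 * k : ℤ) : ℂ) + boxCentre n j) = boxCentre n j := by
        refine Complex.ext ?_ (him j)
        exact triangleWave_eq hu0 hu1 k (Or.inl (by simp [boxCentre]))
      rw [this, ← hcw, hval, hv]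
    · have : foldRect (((2 * k + 1 : ℤ) : ℂ) + boxCentre n j) = boxCentre n (3 ^ n - 1 - j) := by
        refine Complex.ext ?_ (him _)
        have e : (boxCentre n (3 ^ n - 1 - j)).re = 1 - ((j : ℝ) + 1 / 2) / 3 ^ n := by
          simp only [boxCentre]
          push_cast
          field_simp
          ring
        rw [e]
        refine triangleWave_eq (by linarith) (by linarith) (k + 1) (Or.inr ?_)
        simp [boxCentre]
        ring
      obtain ⟨w', hw', hv'⟩ := exists_word_of_lt β lam (n := n) (j := 3 ^ n - 1 - j)
        (by omega) (by omega)
      rw [this, ← hw', hval, hv', triadicValue_reflect]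
  -- Everything at height at least 3 folds onto the compact top edge of the rectangle.
  · have hK : IsCompact ((fun t : ℝ => (⟨t, 3⟩ : ℂ)) '' Icc 0 1) := by
      refine isCompact_Icc.image ?_
      have : (fun t : ℝ => (⟨t, 3⟩ : ℂ)) = fun t : ℝ => (t : ℂ) + 3 * Complex.I := by
        funext t
        apply Complex.ext <;> simp
      rw [this]
      fun_prop
    have hKsub : (fun t : ℝ => (⟨t, 3⟩ : ℂ)) '' Icc 0 1 ⊆ baseRect := by
      rintro _ ⟨t, ht, rfl⟩
      exact ⟨ht.1, ht.2, by norm_num, le_rfl⟩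
    obtain ⟨a, ha, hmin⟩ := hK.exists_isMinOn ⟨_, mem_image_of_mem _ ⟨le_rfl, zero_le_one⟩⟩
      (hcont.mono hKsub)
    obtain ⟨b, hb, hmax⟩ := hK.exists_isMaxOn ⟨_, mem_image_of_mem _ ⟨le_rfl, zero_le_one⟩⟩
      (hcont.mono hKsub)
    have ha0 := hpos a (hKsub ha)
    refine ⟨max 1 (max (ρ₀ a)⁻¹ (ρ₀ b)), le_max_left _ _, fun z hz => ?_⟩
    have hmem : foldRect z ∈ (fun t : ℝ => (⟨t, 3⟩ : ℂ)) '' Icc 0 1 :=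
      ⟨triangleWave z.re, ⟨triangleWave_nonneg _, triangleWave_le_one _⟩, by
        simp [foldRect, min_eq_right hz]⟩
    constructor
    · refine le_trans ?_ (isMinOn_iff.1 hmin _ hmem)
      rw [inv_le_comm₀ (by positivity) ha0]
      exact (le_max_left _ _).trans (le_max_right _ _)
    · exact (isMaxOn_iff.1 hmax _ hmem).trans ((le_max_right _ _).trans (le_max_right _ _))

/-! ### Two-sided bounds for the weight -/

theorem HarnackOn.exists_le_mul {ρ : HalfPlaneWeight} (hH : HarnackOn ρ upperHalf) :
    ∃ c : ℝ, 1 ≤ c ∧ ∀ z ∈ upperHalf, ∀ w ∈ upperHalf, dist w z < z.im / 2 →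
      ρ w ≤ c * ρ z ∧ ρ z ≤ c * ρ w := by
  obtain ⟨c, hc, h⟩ := hH
  refine ⟨c, hc, fun z hz w hw hzw => ?_⟩
  obtain ⟨h1, h2⟩ := h z hz w hw hzw
  have pz := ρ.pos_toFun z hz
  rw [div_le_iff₀ pz] at h2
  rw [le_div_iff₀ pz, inv_mul_le_iff₀ (by linarith)] at h1
  exact ⟨h2, h1⟩

/-- Cut the segment into N equal pieces of length at most m / 3. By convexity each division point
has height at least m, so each piece is strictly shorter than half the height and costs one Harnack
factor. -/
theorem harnack_chain {ρ : HalfPlaneWeight} {c : ℝ} (hc : 1 ≤ c)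
    (hH : ∀ z ∈ upperHalf, ∀ w ∈ upperHalf, dist w z < z.im / 2 → ρ w ≤ c * ρ z ∧ ρ z ≤ c * ρ w)
    (N : ℕ) {m : ℝ} (hm : 0 < m) (z w : ℂ) (hz : m ≤ z.im) (hw : m ≤ w.im)
    (hd : dist w z ≤ N * (m / 3)) : ρ w ≤ c ^ N * ρ z := by
  induction N generalizing z with
  | zero =>
    have : w = z := dist_le_zero.1 (by simpa using hd)
    simp [this]
  | succ N ih =>
    set s : ℝ := 1 / (N + 1) with hs
    have hN : (0 : ℝ) < N + 1 := by positivity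
    have hs0 : 0 ≤ s := by positivity
    have hs1 : s ≤ 1 := by
      rw [hs, div_le_one hN]
      linarith [Nat.cast_nonneg (α := ℝ) N]
    set v : ℂ := z + s • (w - z) with hv
    have hvim : m ≤ v.im := by
      have : v.im = (1 - s) * z.im + s * w.im := by simp [hv]; ring
      rw [this]
      nlinarith
    have d1 : dist v z = s * dist w z := by
      rw [dist_eq_norm, dist_eq_norm, hv, add_sub_cancel_left, norm_smul, Real.norm_of_nonneg hs0]
    have d2 : dist w v = (1 - s) * dist w z := by
      rw [dist_eq_norm, dist_eq_norm, hv, ← Real.norm_of_nonneg (sub_nonneg.2 hs1), ← norm_smul,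
        sub_smul, one_smul]
      congr 1
      abel
    push_cast at hd
    have hsd : s * dist w z ≤ m / 3 := by
      rw [hs, div_mul_eq_mul_div, one_mul, div_le_iff₀ hN]
      linarith
    have hd' : (1 - s) * dist w z ≤ N * (m / 3) := by
      have h1 : (1 - s) = N * s := by
        rw [hs]
        field_simp
        ring
      rw [h1, mul_assoc]
      gcongr
    have i1 := ih v hvim (d2.trans_le hd')
    have i2 := (hH z (hm.trans_le hz) v (hm.trans_le hvim) (by rw [d1]; linarith)).1
    calc ρ w ≤ c ^ N * ρ v := i1
      _ ≤ c ^ N * (c * ρ z) := by gcongr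
      _ = _ := by ring

theorem exists_level {n : ℕ} {y : ℝ} (hy0 : 0 < y) (hy : y ≤ 3 / 3 ^ n) :
    ∃ m, n ≤ m ∧ 1 / 3 ^ m ≤ y ∧ y ≤ 3 / 3 ^ m := by
  have h3 : (0 : ℝ) < 3 ^ n := by positivity
  rw [le_div_iff₀ h3] at hy
  obtain ⟨k, hk1, hk2⟩ := exists_nat_pow_near_of_lt_one (x := y * 3 ^ n / 3) (y := (1 / 3 : ℝ))
    (by positivity) (by linarith) (by norm_num) (by norm_num)
  refine ⟨n + k, Nat.le_add_right _ _, ?_, ?_⟩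
  · rw [pow_succ, one_div_pow] at hk1
    rw [pow_add, div_le_iff₀ (by positivity)]
    field_simp at hk1
    nlinarith
  · rw [one_div_pow] at hk2
    rw [pow_add, le_div_iff₀ (by positivity)]
    field_simp at hk2
    nlinarith

theorem IsTriadicOnHalfPlane.apply_boxCentre {β lam : ℝ} {ρ : HalfPlaneWeight}
    (hρ : IsTriadicOnHalfPlane β lam ρ) (n : ℕ) (j : ℤ) :
    ρ (boxCentre n j) = triadicValue β lam n j := by
  obtain ⟨m, w, h1, h2⟩ := exists_address β lam n j
  rw [← add_triadicCentre_eq h1, hρ.2.1, h2]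

/-- Two-sided bounds, with constant `A`, of a function on the half-plane by the triadic weights. -/
structure TriadicBounds (β lam : ℝ) (ρ : ℂ → ℝ) (A : ℝ) : Prop where
  one_le : 1 ≤ A
  lower : ∀ (n : ℕ) (x : ℝ) (z : ℂ), 0 < z.im → z.im ≤ 3 / 3 ^ n → |z.re - x| ≤ 3 / 3 ^ n →
    triadicAt β lam n x ≤ A * ρ z
  lower_one : ∀ z ∈ upperHalf, 1 ≤ A * ρ z
  upper : ∀ (n : ℕ) (x : ℝ) (z : ℂ), 0 < z.im → z.im ≤ 3 / 3 ^ n → |z.re - x| ≤ 3 / 3 ^ n →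
    ρ z ≤ A * triadicAt β lam n x * (3 ^ n * z.im) ^ (-growthExponent β lam)
  upper_one : ∀ z : ℂ, 1 ≤ z.im → ρ z ≤ A

theorem TriadicBounds.pos {β lam : ℝ} {ρ : ℂ → ℝ} {A : ℝ} (hA : TriadicBounds β lam ρ A) :
    0 < A := one_pos.trans_le hA.one_le

theorem IsTriadicOnHalfPlane.exists_box_bounds {β lam : ℝ} {ρ : HalfPlaneWeight}
    (hρ : IsTriadicOnHalfPlane β lam ρ) :
    ∃ K : ℝ, 1 ≤ K ∧ ∀ (n : ℕ) (z : ℂ), 1 / 3 ^ n ≤ z.im → z.im ≤ 3 / 3 ^ n →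
      ρ z ≤ K * triadicAt β lam n z.re ∧ triadicAt β lam n z.re ≤ K * ρ z := by
  obtain ⟨c, hc, hH⟩ := hρ.1.exists_le_mul
  refine ⟨c ^ 5, one_le_pow₀ hc, fun n z h1 h2 => ?_⟩
  have h3 : (0 : ℝ) < 3 ^ n := by positivity
  set j := ⌊(3 : ℝ) ^ n * z.re⌋ with hj
  have hm : (0 : ℝ) < 1 / 3 ^ n := by positivity
  have hcim : 1 / 3 ^ n ≤ (boxCentre n j).im := by
    simp only [boxCentre]
    gcongr
    norm_num
  -- The centre is at most half a side away horizontally and one side vertically, and 1 / 2 + 1 ≤ 5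
  -- / 3.
  have hd : dist z (boxCentre n j) ≤ (5 : ℕ) * (1 / 3 ^ n / 3) := by
    rw [Complex.dist_eq]
    refine (Complex.norm_le_abs_re_add_abs_im _).trans ?_
    have a1 : |(z - boxCentre n j).re| ≤ (1 / 2) / 3 ^ n := by
      rw [le_div_iff₀ h3, ← abs_of_pos h3, ← abs_mul]
      have e : (z - boxCentre n j).re * 3 ^ n = 3 ^ n * z.re - (j + 1 / 2) := by
        simp only [boxCentre, Complex.sub_re]
        field_simp
      rw [e]
      have := Int.floor_le ((3 : ℝ) ^ n * z.re)
      have := Int.lt_floor_add_one ((3 : ℝ) ^ n * z.re)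
      exact abs_le.2 ⟨by linarith, by linarith⟩
    have a2 : |(z - boxCentre n j).im| ≤ 1 / 3 ^ n := by
      simp only [boxCentre, Complex.sub_im]
      refine abs_le.2 ⟨?_, ?_⟩
      · have : (2 : ℝ) / 3 ^ n = 1 / 3 ^ n + 1 / 3 ^ n := by ring
        linarith
      · have : (3 : ℝ) / 3 ^ n = 2 / 3 ^ n + 1 / 3 ^ n := by ring
        linarith
    refine (add_le_add a1 a2).trans ?_
    have : (0 : ℝ) < 1 / 3 ^ n := by positivity
    push_cast
    have e : (1 / 2 : ℝ) / 3 ^ n = 1 / 2 * (1 / 3 ^ n) := by ring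
    rw [e]
    linarith
  have i1 := harnack_chain hc hH 5 hm (boxCentre n j) z hcim h1 hd
  have i2 := harnack_chain hc hH 5 hm z (boxCentre n j) h1 hcim (by rwa [dist_comm])
  rw [hρ.apply_boxCentre] at i1 i2
  exact ⟨i1, i2⟩

/-- A point at height about 3^(-m) has ρ comparable to its weight at level m. For m ≥ n that weight
is at least the one at level n, and at most (3^σ)^(m - n) times it, where the power is comparable to
(3^n y)^(-σ). -/
theorem IsTriadicOnHalfPlane.exists_triadicBounds {β lam : ℝ} (h : ExponentRange β lam)
    {ρ : HalfPlaneWeight} (hρ : IsTriadicOnHalfPlane β lam ρ) :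
    ∃ A, TriadicBounds β lam ρ A := by
  obtain ⟨K, hK, hbox⟩ := hρ.exists_box_bounds
  obtain ⟨C, hC, hCb⟩ := hρ.2.2
  have K0 : 0 < K := by linarith
  have C0 : 0 < C := by linarith
  have hKC : K ≤ K * C := le_mul_of_one_le_right K0.le hC
  have hCK : C ≤ K * C := le_mul_of_one_le_left C0.le hK
  have hlow : ∀ (n : ℕ) (x : ℝ) (z : ℂ), 0 < z.im → z.im ≤ 3 / 3 ^ n → |z.re - x| ≤ 3 / 3 ^ n →
      triadicAt β lam n x ≤ 45 * K * ρ z := by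
    intro n x z h0 h1 h2
    obtain ⟨m, hnm, m1, m2⟩ := exists_level h0 h1
    have i1 := (hbox m z m1 m2).2
    have i2 := triadicAt_mono h z.re hnm
    rw [abs_sub_comm] at h2
    have i3 := triadicAt_compare h n h2
    simp only at i2
    nlinarith
  have hlow1 : ∀ z ∈ upperHalf, 1 ≤ 45 * (K * C) * ρ z := by
    intro z hz
    have pz := ρ.pos_toFun z hz
    rcases le_total z.im 3 with h3 | h3
    · have := hlow 0 z.re z hz (by simpa using h3) (by simp)
      rw [triadicAt_zero] at this
      nlinarith
    · have := (hCb z h3).1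
      rw [inv_le_iff_one_le_mul₀ C0] at this
      nlinarith
  -- 45 = 9 (2 + 3) compares weights at horizontal distance 3 / 3^n; the further factor 3 bounds
  -- 3^σ, lost when the height is rounded to a power of 3.
  refine ⟨135 * (K * C), by nlinarith, fun n x z h0 h1 h2 => ?_, fun z hz => ?_,
    fun n x z h0 h1 h2 => ?_, fun z h1 => ?_⟩
  · have := hlow n x z h0 h1 h2
    have pz := ρ.pos_toFun z h0
    nlinarith [mul_le_mul_of_nonneg_right hKC pz.le, mul_pos K0 pz]
  · have := hlow1 z hz
    nlinarith
  · obtain ⟨m, hnm, m1, m2⟩ := exists_level h0 h1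
    have i1 := (hbox m z m1 m2).1
    have i2 := triadicAt_add_le h n (m - n) z.re
    rw [Nat.add_sub_cancel' hnm] at i2
    have i3 := triadicAt_compare h n h2
    have h3 : (0 : ℝ) < 3 ^ n := by positivity
    have hs := h.growth_pos
    set σ := growthExponent β lam with hσ
    set P := (3 ^ n * z.im) ^ (-σ) with hP
    have hP0 : 0 < P := Real.rpow_pos_of_pos (by positivity) _
    have i4 : ((3 : ℝ) ^ σ) ^ (m - n) ≤ 3 * P := by
      have e1 : ((3 : ℝ) ^ σ) ^ (m - n) = ((3 : ℝ) ^ (m - n)) ^ σ := by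
        rw [← Real.rpow_natCast, ← Real.rpow_mul (by norm_num), mul_comm, Real.rpow_mul (by norm_num),
          Real.rpow_natCast]
      have e2 : (3 : ℝ) ^ (m - n) ≤ 3 * (3 ^ n * z.im)⁻¹ := by
        rw [pow_sub₀ _ (by norm_num) hnm, mul_inv]
        rw [le_div_iff₀ (by positivity)] at m2
        have : (3 : ℝ) ^ m ≤ 3 * z.im⁻¹ := by
          rw [← div_eq_mul_inv, le_div_iff₀ h0]
          linarith
        calc (3 : ℝ) ^ m * (3 ^ n)⁻¹ ≤ 3 * z.im⁻¹ * (3 ^ n)⁻¹ := by gcongr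
          _ = _ := by ring
      rw [e1, hP, Real.rpow_neg (by positivity), ← Real.inv_rpow (by positivity)]
      refine (Real.rpow_le_rpow (by positivity) e2 hs.le).trans ?_
      rw [Real.mul_rpow (by norm_num) (by positivity)]
      gcongr
      exact three_rpow_growth_le h
    have pr := triadicAt_pos h n z.re
    have px := triadicAt_pos h n x
    calc ρ z ≤ K * triadicAt β lam m z.re := i1
      _ ≤ K * (3 * P * (9 * (2 + 3) * triadicAt β lam n x)) := by
        gcongr
        refine i2.trans ?_
        gcongr
      _ = 135 * K * triadicAt β lam n x * P := by ring
      _ ≤ _ := by gcongr 135 * ?_ * _ * _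
  · rcases le_total z.im 3 with h3 | h3
    · have := (hbox 0 z (by simpa using h1) (by simpa using h3)).1
      rw [triadicAt_zero] at this
      nlinarith
    · have := (hCb z h3).2
      nlinarith

/-! ### Estimates for curves -/

theorem IsArcIn.dist_le {γ : ℝ → ℂ} {L : ℝ} {z w : ℂ} (h : IsArcIn γ L z w) {t : ℝ}
    (ht : t ∈ Icc 0 L) : dist (γ t) z ≤ t := by
  obtain ⟨hL, hu, h0, -, -⟩ := h
  have h1 : edist (γ t) (γ 0) ≤ eVariationOn γ (Icc 0 L ∩ Icc 0 t) :=
    eVariationOn.edist_le γ ⟨ht, ht.1, le_rfl⟩ ⟨⟨le_rfl, hL⟩, le_rfl, ht.1⟩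
  rw [hu ⟨le_rfl, hL⟩ ht, h0, NNReal.coe_one, one_mul, sub_zero, edist_dist] at h1
  exact (ENNReal.ofReal_le_ofReal_iff ht.1).1 h1

/-- A curve from z to w has Euclidean length at least the distance of its endpoints, and in
arc-length parametrization it stays in the ball of radius R about z for all times below R. -/
theorem le_rhoEDist {ρ : ℂ → ℝ} {z w : ℂ} {κ R : ℝ} (hκ0 : 0 ≤ κ)
    (hκ : ∀ v ∈ upperHalf, dist v z < R → κ ≤ ρ v) :
    ENNReal.ofReal (κ * min R (dist w z)) ≤ rhoEDist ρ z w := by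
  refine le_iInf fun γ => le_iInf fun L => le_iInf fun h => ?_
  set m := min R (dist w z) with hm
  have hmL : m ≤ L := by
    have := h.dist_le (t := L) ⟨h.1, le_rfl⟩
    rw [h.2.2.2.1] at this
    exact (min_le_right _ _).trans this
  -- The right end is left out so that the curve stays strictly inside the ball.
  calc ENNReal.ofReal (κ * m) = ∫⁻ _ in Ico 0 m, ENNReal.ofReal κ := by
        rw [setLIntegral_const, Real.volume_Ico, sub_zero, ENNReal.ofReal_mul hκ0]
    _ ≤ ∫⁻ t in Ico 0 m, ENNReal.ofReal (ρ (γ t)) := by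
        refine setLIntegral_mono' measurableSet_Ico fun t ht => ENNReal.ofReal_le_ofReal ?_
        have htL : t ∈ Icc 0 L := ⟨ht.1, ht.2.le.trans hmL⟩
        exact hκ _ (h.2.2.2.2 t htL)
          (((h.dist_le htL).trans_lt ht.2).trans_le (min_le_left _ _))
    _ ≤ rhoLength ρ γ L :=
        lintegral_mono_set fun t ht => ⟨ht.1, ht.2.le.trans hmL⟩

theorem isArcIn_line {z u : ℂ} (hu : ‖u‖ = 1) {L : ℝ} (hL : 0 ≤ L)
    (hm : ∀ t ∈ Icc 0 L, z + (t : ℂ) * u ∈ upperHalf) :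
    IsArcIn (fun t : ℝ => z + (t : ℂ) * u) L z (z + (L : ℂ) * u) := by
  refine ⟨hL, ?_, by simp, rfl, hm⟩
  have hiso : Isometry fun t : ℝ => z + (t : ℂ) * u := by
    refine Isometry.of_dist_eq fun s t => ?_
    rw [dist_eq_norm, add_sub_add_left_eq_sub, ← sub_mul, norm_mul, hu, mul_one,
      ← Complex.ofReal_sub, Complex.norm_real, Real.dist_eq, Real.norm_eq_abs]
  intro x hx y hy
  have e : eVariationOn (fun t : ℝ => z + (t : ℂ) * u) (Icc 0 L ∩ Icc x y)
      = eVariationOn (id : ℝ → ℝ) (Icc 0 L ∩ Icc x y) := by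
    have := fun s t => hiso.edist_eq s t
    simp only [eVariationOn, this, id]
  rw [e]
  rcases le_total x y with hxy | hxy
  · rw [NNReal.coe_one, one_mul]
    exact (monotone_id.monotoneOn _).eVariationOn_eq hx hy
  · rw [ENNReal.ofReal_of_nonpos (by simpa using hxy)]
    refine eVariationOn.subsingleton _ fun a ha b hb => ?_
    linarith [ha.2.1, ha.2.2, hb.2.1, hb.2.2]

theorem rhoEDist_le_line (ρ : ℂ → ℝ) {z u : ℂ} (hu : ‖u‖ = 1) {L : ℝ} (hL : 0 ≤ L)
    (hm : ∀ t ∈ Icc 0 L, z + (t : ℂ) * u ∈ upperHalf) :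
    rhoEDist ρ z (z + (L : ℂ) * u)
      ≤ ∫⁻ t in Icc 0 L, ENNReal.ofReal (ρ (z + (t : ℂ) * u)) :=
  iInf₂_le_of_le _ L (iInf_le _ (isArcIn_line hu hL hm))

theorem rhoEDist_le_of_le_on_segment {ρ : ℂ → ℝ} {z w : ℂ} {M : ℝ} (hM : 0 ≤ M)
    (hz : z ∈ upperHalf) (hw : w ∈ upperHalf) (h : ∀ v ∈ segment ℝ z w, ρ v ≤ M) :
    rhoEDist ρ z w ≤ ENNReal.ofReal (M * dist z w) := by
  rcases eq_or_ne z w with rfl | hne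
  · rw [rhoEDist_self ρ hz]
    exact bot_le
  set L := dist z w with hL
  have hL0 : 0 < L := dist_pos.2 hne
  have hnorm : ‖w - z‖ = L := by rw [hL, dist_comm, dist_eq_norm]
  set u : ℂ := (L⁻¹ : ℝ) * (w - z) with hu
  have hu1 : ‖u‖ = 1 := by
    rw [hu, norm_mul, hnorm, Complex.norm_real, Real.norm_of_nonneg (by positivity),
      inv_mul_cancel₀ hL0.ne']
  have hw' : z + (L : ℂ) * u = w := by
    rw [hu, ← mul_assoc, ← Complex.ofReal_mul, mul_inv_cancel₀ hL0.ne']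
    simp
  have hseg : ∀ t ∈ Icc 0 L, z + (t : ℂ) * u ∈ segment ℝ z w := by
    intro t ht
    rw [segment_eq_image']
    refine ⟨t / L, ⟨div_nonneg ht.1 hL0.le, (div_le_one hL0).2 ht.2⟩, ?_⟩
    simp only [hu, Complex.real_smul, ← mul_assoc, ← Complex.ofReal_mul, div_eq_mul_inv]
  have hconv : Convex ℝ upperHalf := convex_halfSpace_im_gt 0
  have := rhoEDist_le_line ρ hu1 hL0.le fun t ht => hconv.segment_subset hz hw (hseg t ht)
  rw [hw'] at this
  refine this.trans ?_
  calc ∫⁻ t in Icc 0 L, ENNReal.ofReal (ρ (z + (t : ℂ) * u))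
      ≤ ∫⁻ _ in Icc 0 L, ENNReal.ofReal M :=
        setLIntegral_mono' measurableSet_Icc fun t ht => ENNReal.ofReal_le_ofReal (h _ (hseg t ht))
    _ = ENNReal.ofReal (M * L) := by
        rw [setLIntegral_const, Real.volume_Icc, sub_zero, ENNReal.ofReal_mul hM]

/-- The point `x + t i`. -/
noncomputable def vpt (x t : ℝ) : ℂ := x + t * Complex.I

@[simp] theorem vpt_re (x t : ℝ) : (vpt x t).re = x := by simp [vpt]

@[simp] theorem vpt_im (x t : ℝ) : (vpt x t).im = t := by simp [vpt]

theorem vpt_mem {x t : ℝ} (ht : 0 < t) : vpt x t ∈ upperHalf := by simpa [upperHalf] using ht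

theorem vpt_re_im (z : ℂ) : vpt z.re z.im = z := Complex.re_add_im z

theorem rhoEDist_comm (ρ : ℂ → ℝ) (z w : ℂ) : rhoEDist ρ z w = rhoEDist ρ w z :=
  le_antisymm (rhoEDist_le_symm ρ _ _) (rhoEDist_le_symm ρ _ _)

theorem verticalLength_mono (ρ : ℂ → ℝ) (x : ℝ) : Monotone (verticalLength ρ x) :=
  fun _ _ h => lintegral_mono_set (Ioc_subset_Ioc_right h)

theorem rhoEDist_le_verticalLength (ρ : ℂ → ℝ) (x : ℝ) {s t : ℝ} (hs : 0 < s) (hst : s ≤ t) :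
    rhoEDist ρ (vpt x s) (vpt x t) ≤ verticalLength ρ x t := by
  have e : ∀ r : ℝ, vpt x s + (r : ℂ) * Complex.I = vpt x (s + r) := by
    intro r
    simp only [vpt]
    push_cast
    ring
  have h1 := rhoEDist_le_line ρ (z := vpt x s) Complex.norm_I (sub_nonneg.2 hst) fun r hr => by
    rw [e]
    exact vpt_mem (by linarith [hr.1])
  simp only [e, add_sub_cancel] at h1
  refine h1.trans ?_
  have hmp := measurePreserving_add_left (volume : Measure ℝ) s
  have h2 := hmp.setLIntegral_comp_preimage_emb (MeasurableEquiv.addLeft s).measurableEmbedding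
    (fun t => ENNReal.ofReal (ρ (vpt x t))) (Icc s t)
  have hpre : (fun r : ℝ => s + r) ⁻¹' Icc s t = Icc 0 (t - s) := by
    rw [preimage_const_add_Icc, sub_self]
  rw [hpre] at h2
  rw [h2]
  exact lintegral_mono_set fun r hr => ⟨hs.trans_le hr.1, hr.2⟩

theorem setLIntegral_rpow_neg {p r : ℝ} (hp : p < 1) (hr : 0 ≤ r) :
    ∫⁻ t in Ioc 0 r, ENNReal.ofReal (t ^ (-p)) = ENNReal.ofReal (r ^ (1 - p) / (1 - p)) := by
  have hint : IntervalIntegrable (fun t : ℝ => t ^ (-p)) volume 0 r :=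
    intervalIntegral.intervalIntegrable_rpow' (by linarith)
  have h0 : 0 ≤ᵐ[volume.restrict (Ioc 0 r)] fun t : ℝ => t ^ (-p) :=
    (ae_restrict_iff' measurableSet_Ioc).2 (ae_of_all _ fun t ht => Real.rpow_nonneg ht.1.le _)
  rw [← ofReal_integral_eq_lintegral_ofReal
    ((intervalIntegrable_iff_integrableOn_Ioc_of_le hr).1 hint) h0,
    ← intervalIntegral.integral_of_le hr, integral_rpow (Or.inl (by linarith)),
    Real.zero_rpow (by linarith), sub_zero, neg_add_eq_sub]

theorem setLIntegral_scaled_rpow_neg_le {p : ℝ} (hp0 : 0 ≤ p) (hp : p < 1) (n : ℕ) :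
    ∫⁻ t in Ioc 0 ((3 : ℝ) / 3 ^ n), ENNReal.ofReal ((3 ^ n * t) ^ (-p))
      ≤ ENNReal.ofReal (3 / (1 - p) / 3 ^ n) := by
  have h3 : (0 : ℝ) < 3 ^ n := by positivity
  have e : ∫⁻ t in Ioc 0 ((3 : ℝ) / 3 ^ n), ENNReal.ofReal ((3 ^ n * t) ^ (-p))
      = ENNReal.ofReal (((3 : ℝ) ^ n) ^ (-p)) *
        ∫⁻ t in Ioc 0 ((3 : ℝ) / 3 ^ n), ENNReal.ofReal (t ^ (-p)) := by
    rw [← lintegral_const_mul' _ _ ENNReal.ofReal_ne_top]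
    refine setLIntegral_congr_fun measurableSet_Ioc fun t ht => ?_
    rw [← ENNReal.ofReal_mul (by positivity), Real.mul_rpow h3.le ht.1.le]
  rw [e, setLIntegral_rpow_neg hp (by positivity), ← ENNReal.ofReal_mul (by positivity)]
  apply ENNReal.ofReal_le_ofReal
  have hp1 : 0 < 1 - p := by linarith
  have e2 : ((3 : ℝ) / 3 ^ n) ^ (1 - p) = 3 / 3 ^ n * ((3 : ℝ) ^ (-p) / ((3 : ℝ) ^ n) ^ (-p)) := by
    rw [sub_eq_add_neg, Real.rpow_add (by positivity), Real.rpow_one,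
      Real.div_rpow (by norm_num) h3.le]
  have h4 : (3 : ℝ) ^ (-p) ≤ 1 := Real.rpow_le_one_of_one_le_of_nonpos (by norm_num) (by linarith)
  have h5 : 0 < ((3 : ℝ) ^ n) ^ (-p) := Real.rpow_pos_of_pos h3 _
  rw [e2]
  calc _ = 3 / (1 - p) / 3 ^ n * (3 : ℝ) ^ (-p) := by field_simp
    _ ≤ _ := mul_le_of_le_one_right (by positivity) h4

/-! ### Vertical segments and `d_ρ` at a triadic scale -/

section

variable {β lam : ℝ} {ρ : ℂ → ℝ} {A : ℝ}

/-- The constant `3 A / (1 - σ)` in the bound for the length of vertical segments. -/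
noncomputable def columnConst (β lam A : ℝ) : ℝ := 3 * A / (1 - growthExponent β lam)

theorem columnConst_pos (h : ExponentRange β lam) (hA : TriadicBounds β lam ρ A) :
    0 < columnConst β lam A := by
  have := h.growth_lt_one
  have := hA.pos
  exact div_pos (by positivity) (by linarith)

/-- The upper bound on ρ has the singularity t^(-σ), integrable at 0 because σ < 1. This makes the
boundary lie at finite `d_ρ`-distance. -/
theorem verticalLength_le (h : ExponentRange β lam) (hA : TriadicBounds β lam ρ A) (n : ℕ)
    (x : ℝ) : verticalLength ρ x (3 / 3 ^ n)
      ≤ ENNReal.ofReal (columnConst β lam A * (triadicAt β lam n x / 3 ^ n)) := by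
  have hp := triadicAt_pos h n x
  have h1 := h.growth_lt_one
  have hA0 := hA.pos
  calc verticalLength ρ x (3 / 3 ^ n)
      ≤ ∫⁻ t in Ioc 0 ((3 : ℝ) / 3 ^ n), ENNReal.ofReal (A * triadicAt β lam n x) *
          ENNReal.ofReal ((3 ^ n * t) ^ (-growthExponent β lam)) := by
        refine setLIntegral_mono' measurableSet_Ioc fun t ht => ?_
        rw [← ENNReal.ofReal_mul (by positivity)]
        apply ENNReal.ofReal_le_ofReal
        have := hA.upper n x (vpt x t) (by simpa using ht.1) (by simpa using ht.2)
          (by rw [vpt_re, sub_self, abs_zero]; positivity)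
        rwa [vpt_im] at this
    _ = ENNReal.ofReal (A * triadicAt β lam n x) * ∫⁻ t in Ioc 0 ((3 : ℝ) / 3 ^ n),
          ENNReal.ofReal ((3 ^ n * t) ^ (-growthExponent β lam)) :=
        lintegral_const_mul' _ _ ENNReal.ofReal_ne_top
    _ ≤ ENNReal.ofReal (A * triadicAt β lam n x) *
          ENNReal.ofReal (3 / (1 - growthExponent β lam) / 3 ^ n) := by
        gcongr
        exact setLIntegral_scaled_rpow_neg_le h.growth_pos.le h1 n
    _ = _ := by
        rw [← ENNReal.ofReal_mul (by positivity), columnConst]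
        congr 1
        ring

theorem le_verticalLength_of_le {x r κ : ℝ} (hκ : 0 ≤ κ)
    (hb : ∀ t ∈ Ioc 0 r, κ ≤ ρ (vpt x t)) : ENNReal.ofReal (κ * r) ≤ verticalLength ρ x r := by
  calc ENNReal.ofReal (κ * r) = ∫⁻ _ in Ioc 0 r, ENNReal.ofReal κ := by
        rw [setLIntegral_const, Real.volume_Ioc, sub_zero, ENNReal.ofReal_mul hκ]
    _ ≤ _ := setLIntegral_mono' measurableSet_Ioc fun t ht => ENNReal.ofReal_le_ofReal (hb t ht)

theorem le_verticalLength (h : ExponentRange β lam) (hA : TriadicBounds β lam ρ A) {n : ℕ}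
    {x r : ℝ} (hr : r ≤ 3 / 3 ^ n) :
    ENNReal.ofReal (triadicAt β lam n x / A * r) ≤ verticalLength ρ x r := by
  have hA0 := hA.pos
  refine le_verticalLength_of_le (div_nonneg (triadicAt_pos h n x).le hA0.le) fun t ht => ?_
  rw [div_le_iff₀' hA0]
  exact hA.lower n x (vpt x t) (by simpa using ht.1) (by simpa using ht.2.trans hr)
    (by rw [vpt_re, sub_self, abs_zero]; positivity)

theorem le_verticalLength_one (hA : TriadicBounds β lam ρ A) (x r : ℝ) :
    ENNReal.ofReal (1 / A * r) ≤ verticalLength ρ x r := by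
  have hA0 := hA.pos
  refine le_verticalLength_of_le (by positivity) fun t ht => ?_
  rw [div_le_iff₀' hA0]
  exact hA.lower_one _ (vpt_mem ht.1)

theorem verticalLength_le_of_one_le (h : ExponentRange β lam) (hA : TriadicBounds β lam ρ A)
    (x : ℝ) {r : ℝ} (hr : 1 ≤ r) :
    verticalLength ρ x r ≤ ENNReal.ofReal (columnConst β lam A + A * r) := by
  have hA0 := hA.pos
  have h1 : verticalLength ρ x 1 ≤ ENNReal.ofReal (columnConst β lam A) := by
    have := verticalLength_le h hA 0 x
    simp only [triadicAt_zero, pow_zero, div_one, mul_one] at this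
    exact (verticalLength_mono ρ x (by norm_num)).trans this
  have h2 : ∫⁻ t in Ioc 1 r, ENNReal.ofReal (ρ (x + t * Complex.I)) ≤ ENNReal.ofReal (A * r) := by
    calc _ ≤ ∫⁻ _ in Ioc 1 r, ENNReal.ofReal A :=
          setLIntegral_mono' measurableSet_Ioc fun t ht =>
            ENNReal.ofReal_le_ofReal (hA.upper_one (vpt x t) (by simpa using ht.1.le))
      _ = ENNReal.ofReal (A * (r - 1)) := by
          rw [setLIntegral_const, Real.volume_Ioc, ENNReal.ofReal_mul hA0.le]
      _ ≤ _ := ENNReal.ofReal_le_ofReal (by nlinarith)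
  rw [ENNReal.ofReal_add (columnConst_pos h hA).le (by positivity)]
  refine le_trans ?_ (add_le_add h1 h2)
  rw [verticalLength, verticalLength, ← Ioc_union_Ioc_eq_Ioc zero_le_one hr]
  exact lintegral_union_le _ _ _

/-- The competitor rises vertically to height r, crosses horizontally and descends. -/
theorem rhoEDist_le_through {x y s t r M : ℝ} (hs : 0 < s) (ht : 0 < t) (hsr : s ≤ r)
    (htr : t ≤ r) (hM0 : 0 ≤ M) (hM : ∀ u ∈ uIcc x y, ρ (vpt u r) ≤ M) :
    rhoEDist ρ (vpt x s) (vpt y t)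
      ≤ verticalLength ρ x r + ENNReal.ofReal (M * |x - y|) + verticalLength ρ y r := by
  have hr : 0 < r := hs.trans_le hsr
  have hd : dist (vpt x r) (vpt y r) = |x - y| := by
    rw [Complex.dist_of_im_eq (by simp), vpt_re, vpt_re, Real.dist_eq]
  have h2 : rhoEDist ρ (vpt x r) (vpt y r) ≤ ENNReal.ofReal (M * |x - y|) := by
    rw [← hd]
    refine rhoEDist_le_of_le_on_segment hM0 (vpt_mem hr) (vpt_mem hr) fun v hv => ?_
    obtain ⟨a, b, ha, hb, hab, rfl⟩ := hv
    have e : a • vpt x r + b • vpt y r = vpt (a * x + b * y) r := by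
      apply Complex.ext
      · simp
      · simp [← add_mul, hab]
    rw [e]
    refine hM _ ?_
    rw [← segment_eq_uIcc]
    exact ⟨a, b, ha, hb, hab, rfl⟩
  calc rhoEDist ρ (vpt x s) (vpt y t)
      ≤ rhoEDist ρ (vpt x s) (vpt x r) + rhoEDist ρ (vpt x r) (vpt y t) :=
        rhoEDist_triangle _ _ _ _
    _ ≤ rhoEDist ρ (vpt x s) (vpt x r) +
          (rhoEDist ρ (vpt x r) (vpt y r) + rhoEDist ρ (vpt y r) (vpt y t)) := by
        gcongr
        exact rhoEDist_triangle _ _ _ _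
    _ ≤ verticalLength ρ x r + (ENNReal.ofReal (M * |x - y|) + verticalLength ρ y r) := by
        gcongr
        · exact rhoEDist_le_verticalLength ρ x hs hsr
        · rw [rhoEDist_comm]
          exact rhoEDist_le_verticalLength ρ y ht htr
    _ = _ := (add_assoc _ _ _).symm

/-- The crossing is at height 3^(-n), where ρ is at most A times the weight. In 28 = 1 + 27 the
terms belong to the columns over x and y, with 27 = 9 (2 + 1) comparing the weight at y to that at
x. -/
theorem rhoEDist_le_scale (h : ExponentRange β lam) (hA : TriadicBounds β lam ρ A) {n : ℕ}
    {x y s t : ℝ} (hs : 0 < s) (ht : 0 < t) (hsr : s ≤ 1 / 3 ^ n) (htr : t ≤ 1 / 3 ^ n)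
    (hxy : |x - y| ≤ 1 / 3 ^ n) :
    rhoEDist ρ (vpt x s) (vpt y t)
      ≤ ENNReal.ofReal ((28 * columnConst β lam A + A) * (triadicAt β lam n x / 3 ^ n)) := by
  have h3 : (0 : ℝ) < 3 ^ n := by positivity
  have h13 : (1 : ℝ) / 3 ^ n ≤ 3 / 3 ^ n := by gcongr; norm_num
  have px := triadicAt_pos h n x
  have hC := columnConst_pos h hA
  have hA0 := hA.pos
  have hyx : triadicAt β lam n y ≤ 27 * triadicAt β lam n x := by
    have := triadicAt_compare h n (x := y) (y := x) (R := 1) (by rwa [abs_sub_comm])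
    linarith
  refine (rhoEDist_le_through (M := A * triadicAt β lam n x) hs ht hsr htr (by positivity) ?_).trans
    ?_
  · intro u hu
    have hux : |u - x| ≤ 3 / 3 ^ n := by
      refine le_trans ?_ (hxy.trans h13)
      rw [abs_sub_comm x y]
      exact abs_sub_left_of_mem_uIcc hu
    have := hA.upper n x (vpt u (1 / 3 ^ n)) (by simp) (by simpa using h13) (by simpa using hux)
    simpa [mul_inv_cancel₀ h3.ne'] using this
  · have v1 := (verticalLength_mono ρ x h13).trans (verticalLength_le h hA n x)
    have v2 := (verticalLength_mono ρ y h13).trans (verticalLength_le h hA n y)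
    refine (add_le_add (add_le_add v1 le_rfl) v2).trans ?_
    have py := triadicAt_pos h n y
    rw [← ENNReal.ofReal_add (by positivity) (by positivity),
      ← ENNReal.ofReal_add (by positivity) (by positivity)]
    apply ENNReal.ofReal_le_ofReal
    have e1 : A * triadicAt β lam n x * |x - y| ≤ A * triadicAt β lam n x * (1 / 3 ^ n) := by
      gcongr
    have e2 : columnConst β lam A * (triadicAt β lam n y / 3 ^ n)
        ≤ columnConst β lam A * (27 * triadicAt β lam n x / 3 ^ n) := by gcongr
    calc _ ≤ columnConst β lam A * (triadicAt β lam n x / 3 ^ n)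
          + A * triadicAt β lam n x * (1 / 3 ^ n)
          + columnConst β lam A * (27 * triadicAt β lam n x / 3 ^ n) := by gcongr
      _ = _ := by ring

theorem rhoEDist_le_far (h : ExponentRange β lam) (hA : TriadicBounds β lam ρ A)
    {x y s t : ℝ} (hs : 0 < s) (ht : 0 < t) (hsr : s ≤ 1) (htr : t ≤ 1) :
    rhoEDist ρ (vpt x s) (vpt y t)
      ≤ ENNReal.ofReal (2 * columnConst β lam A + A * |x - y|) := by
  have hC := columnConst_pos h hA
  have hA0 := hA.pos
  refine (rhoEDist_le_through (M := A) hs ht hsr htr hA0.le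
    fun u _ => hA.upper_one _ (by simp)).trans ?_
  have key : ∀ x, verticalLength ρ x 1 ≤ ENNReal.ofReal (columnConst β lam A) := by
    intro x
    have := verticalLength_le h hA 0 x
    simp only [triadicAt_zero, pow_zero, div_one, mul_one] at this
    exact (verticalLength_mono ρ x (by norm_num)).trans this
  refine (add_le_add (add_le_add (key x) le_rfl) (key y)).trans (le_of_eq ?_)
  rw [← ENNReal.ofReal_add (by positivity) (by positivity),
      ← ENNReal.ofReal_add (by positivity) (by positivity)]
  congr 1
  ring

/-- The ball of radius 2 / 3^n about z stays below height 3 / 3^n, where the lower triadic bound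
holds. -/
theorem le_rhoEDist_scale (h : ExponentRange β lam) (hA : TriadicBounds β lam ρ A) {n : ℕ}
    {z : ℂ} (w : ℂ) (hz : z.im ≤ 1 / 3 ^ n) :
    ENNReal.ofReal (triadicAt β lam n z.re / A * min (2 / 3 ^ n) (dist w z))
      ≤ rhoEDist ρ z w := by
  have hA0 := hA.pos
  refine le_rhoEDist (div_nonneg (triadicAt_pos h n _).le hA0.le) fun v hv hvz => ?_
  rw [div_le_iff₀' hA0]
  have h1 := (Complex.abs_re_le_norm (v - z)).trans_lt (by rwa [← Complex.dist_eq])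
  have h2 := (Complex.abs_im_le_norm (v - z)).trans_lt (by rwa [← Complex.dist_eq])
  rw [Complex.sub_re] at h1
  rw [Complex.sub_im, abs_lt] at h2
  have e : (3 : ℝ) / 3 ^ n = 2 / 3 ^ n + 1 / 3 ^ n := by ring
  have e2 : (0 : ℝ) < 1 / 3 ^ n := by positivity
  exact hA.lower n z.re v hv (by linarith [h2.2]) (by linarith)

theorem le_rhoEDist_far (hA : TriadicBounds β lam ρ A) (z w : ℂ) :
    ENNReal.ofReal (1 / A * dist w z) ≤ rhoEDist ρ z w := by
  have hA0 := hA.pos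
  have := le_rhoEDist (ρ := ρ) (z := z) (w := w) (κ := 1 / A) (R := dist w z) (by positivity)
    fun v hv _ => by
      rw [div_le_iff₀' hA0]
      exact hA.lower_one v hv
  rwa [min_self] at this

end

/-! ### The boundary of the completion -/

section

variable {β lam : ℝ} {ρ : HalfPlaneWeight} {A : ℝ}

theorem RhoSpace.edist_def (z w : RhoSpace ρ) : edist z w = rhoEDist ρ z.pt w.pt := rfl

theorem RhoSpace.pt_mem (z : RhoSpace ρ) : z.pt ∈ upperHalf := z.2

/-- The point of `(H, d_ρ)` with given underlying point. -/
def RhoSpace.mk (z : ℂ) (hz : z ∈ upperHalf) : RhoSpace ρ := ⟨z, hz⟩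

@[simp] theorem RhoSpace.pt_mk (z : ℂ) (hz : z ∈ upperHalf) :
    (RhoSpace.mk z hz : RhoSpace ρ).pt = z := rfl

/-- Since ρ ≥ 1 / A everywhere, the identity to the Euclidean plane is Lipschitz and extends
continuously to the completion. -/
theorem RhoSpace.lipschitzWith_pt (hA : TriadicBounds β lam ρ A) :
    LipschitzWith A.toNNReal (RhoSpace.pt : RhoSpace ρ → ℂ) := by
  intro z w
  have hA0 := hA.pos
  have h1 := le_rhoEDist_far hA w.pt z.pt
  rw [edist_comm z w, RhoSpace.edist_def, edist_dist]
  calc ENNReal.ofReal (dist z.pt w.pt)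
      = ENNReal.ofReal A * ENNReal.ofReal (1 / A * dist z.pt w.pt) := by
        rw [← ENNReal.ofReal_mul hA0.le]
        congr 1
        field_simp
    _ ≤ _ := by
        gcongr
        exact le_of_eq rfl

/-- The continuous extension of the identity `(H, d_ρ) → (H, |·|)` to the completion. -/
noncomputable def boundaryProj (ρ : HalfPlaneWeight) : RhoClosure ρ → ℂ :=
  UniformSpace.Completion.extension (RhoSpace.pt : RhoSpace ρ → ℂ)

theorem boundaryProj_coe (hA : TriadicBounds β lam ρ A) (z : RhoSpace ρ) :
    boundaryProj ρ z = z.pt :=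
  UniformSpace.Completion.extension_coe (RhoSpace.lipschitzWith_pt hA).uniformContinuous z

theorem continuous_boundaryProj : Continuous (boundaryProj ρ) :=
  UniformSpace.Completion.continuous_extension

theorem tendsto_pt_comap_coe (hA : TriadicBounds β lam ρ A) (ξ : RhoClosure ρ) :
    Tendsto (RhoSpace.pt : RhoSpace ρ → ℂ)
      (comap ((↑) : RhoSpace ρ → RhoClosure ρ) (𝓝 ξ)) (𝓝 (boundaryProj ρ ξ)) := by
  have := (continuous_boundaryProj.tendsto ξ).comp
    (tendsto_comap (f := ((↑) : RhoSpace ρ → RhoClosure ρ)))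
  exact this.congr fun z => boundaryProj_coe hA z

theorem comap_coe_neBot (ξ : RhoClosure ρ) :
    (comap ((↑) : RhoSpace ρ → RhoClosure ρ) (𝓝 ξ)).NeBot :=
  UniformSpace.Completion.isDenseInducing_coe.comap_nhds_neBot ξ

theorem liesOver_iff (hA : TriadicBounds β lam ρ A) {ξ : RhoClosure ρ} {x : ℝ} :
    LiesOver ξ x ↔ boundaryProj ρ ξ = x := by
  have := comap_coe_neBot ξ
  constructor
  · intro h
    exact tendsto_nhds_unique (tendsto_pt_comap_coe hA ξ) h
  · intro h
    rw [LiesOver, ← h]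
    exact tendsto_pt_comap_coe hA ξ

theorem boundaryProj_im_nonneg (hA : TriadicBounds β lam ρ A) (ξ : RhoClosure ρ) :
    0 ≤ (boundaryProj ρ ξ).im := by
  have := comap_coe_neBot ξ
  refine ge_of_tendsto ((Complex.continuous_im.tendsto _).comp (tendsto_pt_comap_coe hA ξ)) ?_
  exact Eventually.of_forall fun z => (RhoSpace.pt_mem z).le

theorem isOpen_upperHalf : IsOpen upperHalf := isOpen_lt continuous_const Complex.continuous_im

/-- Near an interior point ρ is bounded, so Euclidean convergence implies `d_ρ`-convergence. -/
theorem tendsto_coe_of_mem {a : ℂ} (ha : a ∈ upperHalf) :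
    Tendsto ((↑) : RhoSpace ρ → RhoClosure ρ) (comap RhoSpace.pt (𝓝 a))
      (𝓝 ((RhoSpace.mk a ha : RhoSpace ρ) : RhoClosure ρ)) := by
  have hcont : ContinuousAt ρ a := ρ.continuousOn_toFun.continuousAt (isOpen_upperHalf.mem_nhds ha)
  set M := ρ a + 1 with hM
  have hM0 : 0 < M := by
    have := ρ.pos_toFun a ha
    linarith
  obtain ⟨δ, hδ, hball⟩ := Metric.mem_nhds_iff.1
    (inter_mem (isOpen_upperHalf.mem_nhds ha) (hcont.eventually_lt_const (show ρ a < M by linarith)))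
  have hT : Tendsto (fun z : RhoSpace ρ => ENNReal.ofReal (M * dist z.pt a))
      (comap RhoSpace.pt (𝓝 a)) (𝓝 0) := by
    have h1 : Tendsto (fun z : ℂ => ENNReal.ofReal (M * dist z a)) (𝓝 a) (𝓝 0) := by
      have : Continuous fun z : ℂ => ENNReal.ofReal (M * dist z a) :=
        ENNReal.continuous_ofReal.comp (by fun_prop)
      simpa using this.tendsto a
    exact h1.comp tendsto_comap
  rw [tendsto_iff_edist_tendsto_0]
  refine tendsto_of_tendsto_of_tendsto_of_le_of_le' tendsto_const_nhds hT
    (Eventually.of_forall fun _ => bot_le) ?_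
  filter_upwards [preimage_mem_comap (Metric.ball_mem_nhds a hδ)] with z hz
  rw [UniformSpace.Completion.edist_eq]
  refine rhoEDist_le_of_le_on_segment hM0.le z.pt_mem ha fun v hv => ?_
  exact (hball ((convex_ball a δ).segment_subset hz (Metric.mem_ball_self hδ) hv)).2.le

theorem comap_pt_neBot {a : ℂ} (ha : 0 ≤ a.im) :
    (comap (RhoSpace.pt : RhoSpace ρ → ℂ) (𝓝 a)).NeBot := by
  rw [comap_neBot_iff]
  intro t ht
  have hcont : Continuous fun s : ℝ => a + s * Complex.I := by fun_prop
  have h0 : Tendsto (fun s : ℝ => a + s * Complex.I) (𝓝[>] 0) (𝓝 a) := by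
    have := hcont.tendsto 0
    simp only [Complex.ofReal_zero, zero_mul, add_zero] at this
    exact this.mono_left nhdsWithin_le_nhds
  obtain ⟨s, hs, hs0⟩ := ((h0.eventually ht).and self_mem_nhdsWithin).exists
  refine ⟨RhoSpace.mk (a + s * Complex.I) ?_, hs⟩
  have : 0 < s := hs0
  simp only [upperHalf, mem_ofPred_eq, Complex.add_im, Complex.mul_im, Complex.ofReal_re,
    Complex.I_im, mul_one, Complex.ofReal_im, Complex.I_re, mul_zero, add_zero]
  linarith

theorem tendsto_triadicAt_bound (h : ExponentRange β lam) (C : ℝ) :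
    Tendsto (fun n : ℕ => C * (((3 : ℝ) ^ growthExponent β lam) ^ n / 3 ^ n)) atTop (𝓝 0) := by
  have h1 : (3 : ℝ) ^ growthExponent β lam / 3 < 1 := by
    rw [div_lt_one (by norm_num)]
    simpa using Real.rpow_lt_rpow_of_exponent_lt (x := (3 : ℝ)) (by norm_num) h.growth_lt_one
  have h2 := (tendsto_pow_atTop_nhds_zero_of_lt_one (by positivity) h1).const_mul C
  simpa [div_pow] using h2

theorem triadicAt_le_pow (h : ExponentRange β lam) (n : ℕ) (x : ℝ) :
    triadicAt β lam n x ≤ ((3 : ℝ) ^ growthExponent β lam) ^ n := by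
  have := triadicAt_add_le h 0 n x
  rwa [zero_add, triadicAt_zero, mul_one] at this

/-- Small Euclidean neighbourhoods of x in H have small `d_ρ`-diameter, of order at most 3^(σ n) /
3^n, which tends to 0 because σ < 1. Their filter is therefore Cauchy. -/
theorem exists_tendsto_coe_real (h : ExponentRange β lam) (hA : TriadicBounds β lam ρ A) (x : ℝ) :
    ∃ ξ, Tendsto ((↑) : RhoSpace ρ → RhoClosure ρ) (comap RhoSpace.pt (𝓝 (x : ℂ))) (𝓝 ξ) := by
  have hne := comap_pt_neBot (ρ := ρ) (a := (x : ℂ)) (by simp)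
  have hC := columnConst_pos h hA
  have hA0 := hA.pos
  set C := 28 * columnConst β lam A + A with hCdef
  have hcau : Cauchy (comap (RhoSpace.pt : RhoSpace ρ → ℂ) (𝓝 (x : ℂ))) := by
    refine EMetric.cauchy_iff.2 ⟨hne.ne, fun ε hε => ?_⟩
    obtain ⟨r, hr0, hr⟩ := ENNReal.lt_iff_exists_nnreal_btwn.1 hε
    have hr0' : (0 : ℝ) < r := by exact_mod_cast hr0
    obtain ⟨n, hn⟩ := ((tendsto_triadicAt_bound h C).eventually_lt_const hr0').exists
    have h3 : (0 : ℝ) < 3 ^ n := by positivity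
    refine ⟨_, preimage_mem_comap (Metric.ball_mem_nhds (x : ℂ)
      (show (0 : ℝ) < 1 / 2 / 3 ^ n by positivity)), ?_⟩
    have hsmall : ∀ z ∈ Metric.ball (x : ℂ) (1 / 2 / 3 ^ n),
        |z.re - x| ≤ 1 / 2 / 3 ^ n ∧ z.im ≤ 1 / 3 ^ n := by
      intro z hz
      rw [Metric.mem_ball, Complex.dist_eq] at hz
      have a1 := (Complex.abs_re_le_norm _).trans hz.le
      have a2 := ((le_abs_self _).trans (Complex.abs_im_le_norm _)).trans hz.le
      simp only [Complex.sub_re, Complex.ofReal_re, Complex.sub_im, Complex.ofReal_im,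
        sub_zero] at a1 a2
      refine ⟨a1, a2.trans ?_⟩
      gcongr
      norm_num
    intro z hz w hw
    obtain ⟨z1, z2⟩ := hsmall _ hz
    obtain ⟨w1, w2⟩ := hsmall _ hw
    have hzw : |z.pt.re - w.pt.re| ≤ 1 / 3 ^ n := by
      have e : (1 : ℝ) / 3 ^ n = 1 / 2 / 3 ^ n + 1 / 2 / 3 ^ n := by ring
      rw [e]
      rw [abs_le] at z1 w1 ⊢
      constructor <;> linarith [z1.1, z1.2, w1.1, w1.2]
    have key := rhoEDist_le_scale h hA z.pt_mem w.pt_mem z2 w2 hzw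
    rw [vpt_re_im, vpt_re_im] at key
    refine lt_of_le_of_lt (key.trans ?_) hr
    rw [← ENNReal.ofReal_coe_nnreal]
    apply ENNReal.ofReal_le_ofReal
    refine le_trans ?_ hn.le
    have := triadicAt_le_pow h n z.pt.re
    gcongr
  have := hcau.map (UniformSpace.Completion.uniformContinuous_coe (RhoSpace ρ))
  obtain ⟨ξ, hξ⟩ := CompleteSpace.complete this
  exact ⟨ξ, hξ⟩

instance (ρ : HalfPlaneWeight) : Nonempty (RhoSpace ρ) :=
  ⟨RhoSpace.mk Complex.I (by simp [upperHalf])⟩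

instance (ρ : HalfPlaneWeight) : Nonempty (RhoClosure ρ) :=
  (inferInstance : Nonempty (RhoSpace ρ)).map (↑)

/-- The point of the completion that lies over the real point `x`. -/
noncomputable def boundaryPt (ρ : HalfPlaneWeight) (x : ℝ) : RhoClosure ρ :=
  limUnder (comap RhoSpace.pt (𝓝 (x : ℂ))) ((↑) : RhoSpace ρ → RhoClosure ρ)

theorem tendsto_boundaryPt (h : ExponentRange β lam) (hA : TriadicBounds β lam ρ A) (x : ℝ) :
    Tendsto ((↑) : RhoSpace ρ → RhoClosure ρ) (comap RhoSpace.pt (𝓝 (x : ℂ)))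
      (𝓝 (boundaryPt ρ x)) :=
  tendsto_nhds_limUnder (exists_tendsto_coe_real h hA x)

theorem boundaryProj_boundaryPt (h : ExponentRange β lam) (hA : TriadicBounds β lam ρ A) (x : ℝ) :
    boundaryProj ρ (boundaryPt ρ x) = x := by
  have := comap_pt_neBot (ρ := ρ) (a := (x : ℂ)) (by simp)
  have h1 := (continuous_boundaryProj.tendsto _).comp (tendsto_boundaryPt h hA x)
  have h2 : Tendsto (RhoSpace.pt : RhoSpace ρ → ℂ) (comap RhoSpace.pt (𝓝 (x : ℂ)))
      (𝓝 (x : ℂ)) := tendsto_comap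
  exact tendsto_nhds_unique (h1.congr fun z => boundaryProj_coe hA z) h2

/-- Approaching ξ in the completion forces Euclidean approach to its projection. If the latter
already determines a limit, that limit is ξ; hence the completion has only one point over each point
of the closed half-plane. -/
theorem eq_of_tendsto_coe (hA : TriadicBounds β lam ρ A) {ξ η : RhoClosure ρ}
    (hη : Tendsto ((↑) : RhoSpace ρ → RhoClosure ρ)
      (comap RhoSpace.pt (𝓝 (boundaryProj ρ ξ))) (𝓝 η)) : ξ = η := by
  have := comap_coe_neBot ξ
  have h1 := tendsto_iff_comap.1 (tendsto_pt_comap_coe hA ξ)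
  exact tendsto_nhds_unique (tendsto_comap (f := ((↑) : RhoSpace ρ → RhoClosure ρ)))
    (hη.mono_left h1)

theorem mem_rhoBoundary_iff (hA : TriadicBounds β lam ρ A) {ξ : RhoClosure ρ} :
    ξ ∈ rhoBoundary ρ ↔ (boundaryProj ρ ξ).im = 0 := by
  constructor
  · intro hξ
    by_contra hne
    have hpos : boundaryProj ρ ξ ∈ upperHalf :=
      lt_of_le_of_ne (boundaryProj_im_nonneg hA ξ) (Ne.symm hne)
    exact hξ ⟨_, (eq_of_tendsto_coe hA (tendsto_coe_of_mem hpos)).symm⟩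
  · rintro h ⟨z, rfl⟩
    rw [boundaryProj_coe hA] at h
    exact absurd h (ne_of_gt z.pt_mem)

theorem boundaryPt_mem (h : ExponentRange β lam) (hA : TriadicBounds β lam ρ A) (x : ℝ) :
    boundaryPt ρ x ∈ rhoBoundary ρ := by
  rw [mem_rhoBoundary_iff hA, boundaryProj_boundaryPt h hA, Complex.ofReal_im]

theorem eq_boundaryPt (h : ExponentRange β lam) (hA : TriadicBounds β lam ρ A) {ξ : RhoClosure ρ}
    (hξ : ξ ∈ rhoBoundary ρ) : ξ = boundaryPt ρ (boundaryProj ρ ξ).re := by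
  rw [mem_rhoBoundary_iff hA] at hξ
  refine eq_of_tendsto_coe hA ?_
  have : boundaryProj ρ ξ = ((boundaryProj ρ ξ).re : ℂ) :=
    Complex.ext (by simp) (by simpa using hξ)
  conv_lhs => rw [this]
  exact tendsto_boundaryPt h hA _

theorem rhoBoundary_eq_range (h : ExponentRange β lam) (hA : TriadicBounds β lam ρ A) :
    rhoBoundary ρ = range (boundaryPt ρ) := by
  ext ξ
  constructor
  · intro hξ
    exact ⟨_, (eq_boundaryPt h hA hξ).symm⟩
  · rintro ⟨x, rfl⟩
    exact boundaryPt_mem h hA x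

theorem liesOver_boundaryPt (h : ExponentRange β lam) (hA : TriadicBounds β lam ρ A) (x : ℝ) :
    LiesOver (boundaryPt ρ x) x :=
  (liesOver_iff hA).2 (boundaryProj_boundaryPt h hA x)

/-- A Euclidean-convergent sequence in H has its limit in the closed half-plane, so it converges in
the completion as well and has only one accumulation point there. -/
theorem isDensity_of_bounds (h : ExponentRange β lam) (hA : TriadicBounds β lam ρ A) :
    IsDensity ρ := by
  refine ⟨?_, ?_, ⟨_, boundaryPt_mem h hA 0⟩⟩
  · rintro u ⟨ξ, hξ⟩
    refine ⟨boundaryProj ρ ξ, ?_⟩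
    exact ((continuous_boundaryProj.tendsto ξ).comp hξ).congr fun n => boundaryProj_coe hA (u n)
  · rintro u ⟨a, ha⟩ ξ - η - hξ hη
    have him : 0 ≤ a.im := ge_of_tendsto ((Complex.continuous_im.tendsto _).comp ha)
      (Eventually.of_forall fun n => (u n).pt_mem.le)
    have hu : Tendsto u atTop (comap RhoSpace.pt (𝓝 a)) := tendsto_comap_iff.2 ha
    obtain ⟨ζ, hζ⟩ : ∃ ζ, Tendsto (fun n => (u n : RhoClosure ρ)) atTop (𝓝 ζ) := by
      rcases him.eq_or_lt with h0 | hpos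
      · have : a = (a.re : ℂ) := Complex.ext (by simp) (by simpa using h0.symm)
        rw [this] at hu
        exact ⟨_, (tendsto_boundaryPt h hA _).comp hu⟩
      · exact ⟨_, (tendsto_coe_of_mem hpos).comp hu⟩
    have key : ∀ ξ, MapClusterPt ξ atTop (fun n => (u n : RhoClosure ρ)) → ξ = ζ := by
      intro ξ hξ
      have : (𝓝 ξ ⊓ 𝓝 ζ).NeBot := hξ.neBot.mono (inf_le_inf_left _ hζ)
      exact eq_of_nhds_neBot this
    rw [key ξ hξ, key η hη]

/-! ### Distances of boundary points -/

theorem tendsto_column (h : ExponentRange β lam) (hA : TriadicBounds β lam ρ A) (x : ℝ) :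
    Tendsto (fun k : ℕ => ((RhoSpace.mk (vpt x (1 / 3 ^ k)) (vpt_mem (by positivity)) :
      RhoSpace ρ) : RhoClosure ρ)) atTop (𝓝 (boundaryPt ρ x)) := by
  refine (tendsto_boundaryPt h hA x).comp (tendsto_comap_iff.2 ?_)
  have h1 : Tendsto (fun k : ℕ => (1 : ℝ) / 3 ^ k) atTop (𝓝 0) := by
    simpa using tendsto_pow_atTop_nhds_zero_of_lt_one (r := (3 : ℝ)⁻¹) (by norm_num) (by norm_num)
  have h2 : Continuous fun t : ℝ => vpt x t := by
    unfold vpt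
    fun_prop
  have h3 := (h2.tendsto 0).comp h1
  simpa [vpt, Function.comp_def] using h3

/-- Estimates for points of H near the real line pass to boundary points by descending both columns
at equal heights. -/
theorem tendsto_edist_column (h : ExponentRange β lam) (hA : TriadicBounds β lam ρ A) (x y : ℝ) :
    Tendsto (fun k : ℕ => rhoEDist ρ (vpt x (1 / 3 ^ k)) (vpt y (1 / 3 ^ k))) atTop
      (𝓝 (edist (boundaryPt ρ x) (boundaryPt ρ y))) := by
  refine ((tendsto_column h hA x).edist (tendsto_column h hA y)).congr fun k => ?_
  rw [UniformSpace.Completion.edist_eq]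
  rfl

theorem one_div_three_pow_anti {n k : ℕ} (hnk : n ≤ k) : (1 : ℝ) / 3 ^ k ≤ 1 / 3 ^ n := by
  gcongr
  norm_num

theorem edist_boundaryPt_le (h : ExponentRange β lam) (hA : TriadicBounds β lam ρ A) {n : ℕ}
    {x y : ℝ} (hxy : |x - y| ≤ 1 / 3 ^ n) :
    edist (boundaryPt ρ x) (boundaryPt ρ y)
      ≤ ENNReal.ofReal ((28 * columnConst β lam A + A) * (triadicAt β lam n x / 3 ^ n)) := by
  refine le_of_tendsto (tendsto_edist_column h hA x y) ?_
  filter_upwards [eventually_ge_atTop n] with k hk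
  exact rhoEDist_le_scale h hA (by positivity) (by positivity) (one_div_three_pow_anti hk)
    (one_div_three_pow_anti hk) hxy

theorem le_edist_boundaryPt (h : ExponentRange β lam) (hA : TriadicBounds β lam ρ A) {n : ℕ}
    {x y : ℝ} (hxy : |x - y| ≤ 1 / 3 ^ n) :
    ENNReal.ofReal (triadicAt β lam n x / A * |x - y|)
      ≤ edist (boundaryPt ρ x) (boundaryPt ρ y) := by
  refine ge_of_tendsto (tendsto_edist_column h hA x y) ?_
  filter_upwards [eventually_ge_atTop n] with k hk
  have := le_rhoEDist_scale (ρ := ρ) h hA (n := n) (z := vpt x (1 / 3 ^ k)) (vpt y (1 / 3 ^ k))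
    (by rw [vpt_im]; exact one_div_three_pow_anti hk)
  rw [Complex.dist_of_im_eq (by simp), vpt_re, vpt_re, Real.dist_eq, abs_sub_comm, min_eq_right]
    at this
  · exact this
  · refine hxy.trans ?_
    gcongr
    norm_num

theorem edist_boundaryPt_le_far (h : ExponentRange β lam) (hA : TriadicBounds β lam ρ A)
    (x y : ℝ) : edist (boundaryPt ρ x) (boundaryPt ρ y)
      ≤ ENNReal.ofReal (2 * columnConst β lam A + A * |x - y|) := by
  refine le_of_tendsto (tendsto_edist_column h hA x y) (Eventually.of_forall fun k => ?_)
  have : (1 : ℝ) / 3 ^ k ≤ 1 := by simpa using one_div_three_pow_anti (Nat.zero_le k)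
  exact rhoEDist_le_far h hA (by positivity) (by positivity) this this

theorem le_edist_boundaryPt_far (h : ExponentRange β lam) (hA : TriadicBounds β lam ρ A)
    (x y : ℝ) : ENNReal.ofReal (1 / A * |x - y|) ≤ edist (boundaryPt ρ x) (boundaryPt ρ y) := by
  refine ge_of_tendsto (tendsto_edist_column h hA x y) (Eventually.of_forall fun k => ?_)
  have := le_rhoEDist_far hA (vpt x (1 / 3 ^ k)) (vpt y (1 / 3 ^ k))
  rwa [Complex.dist_of_im_eq (by simp), vpt_re, vpt_re, Real.dist_eq, abs_sub_comm] at this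

theorem exists_scale {d : ℝ} (h0 : 0 < d) (h1 : d ≤ 1) :
    ∃ n : ℕ, 1 / 3 / 3 ^ n ≤ d ∧ d ≤ 1 / 3 ^ n := by
  obtain ⟨m, hm, m1, m2⟩ := exists_level (n := 1) h0 (by simpa using h1)
  obtain ⟨n, rfl⟩ : ∃ n, m = n + 1 := ⟨m - 1, by omega⟩
  refine ⟨n, le_trans (le_of_eq ?_) m1, m2.trans (le_of_eq ?_)⟩ <;>
  · rw [pow_succ]
    field_simp

theorem ofReal_inv_mul_le_of_le {c P Q : ℝ} {a b : ℝ≥0∞} (hc : 0 < c) (ha : a ≤ ENNReal.ofReal P)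
    (hb : ENNReal.ofReal Q ≤ b) (hPQ : P ≤ c * Q) : ENNReal.ofReal c⁻¹ * a ≤ b := by
  refine le_trans (mul_le_mul_right ha _) (le_trans ?_ hb)
  rw [← ENNReal.ofReal_mul (by positivity)]
  apply ENNReal.ofReal_le_ofReal
  rwa [inv_mul_le_iff₀ hc]

theorem le_ofReal_mul_of_le {c P Q : ℝ} {a b : ℝ≥0∞} (hc : 0 < c) (ha : a ≤ ENNReal.ofReal P)
    (hb : ENNReal.ofReal Q ≤ b) (hPQ : P ≤ c * Q) : a ≤ ENNReal.ofReal c * b := by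
  refine ha.trans (le_trans ?_ (mul_le_mul_right hb _))
  rw [← ENNReal.ofReal_mul hc.le]
  exact ENNReal.ofReal_le_ofReal hPQ

/-- Both sides are compared with the same quantity: the weight times 3^(-n) when |x - y| is about
3^(-n) ≤ 1, and |x - y| itself when it is at least 1. -/
theorem gehringHayman_of_bounds (h : ExponentRange β lam) (hA : TriadicBounds β lam ρ A) :
    GehringHayman ρ := by
  have hA1 := hA.one_le
  have hA0 := hA.pos
  have hC := columnConst_pos h hA
  set B := columnConst β lam A with hB
  -- 28 B + A dominates both upper bounds, A comes from the lower bounds, and 3 from |x - y| ≥ 1 / 3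
  -- / 3^n.
  set c := 3 * A * (28 * B + A) with hc
  have hc1 : 1 ≤ c := by nlinarith [mul_pos hA0 hC]
  refine ⟨c, hc1, fun ξ hξ η hη => ?_⟩
  rw [rhoBoundary_eq_range h hA] at hξ hη
  obtain ⟨x, rfl⟩ := hξ
  obtain ⟨y, rfl⟩ := hη
  refine ⟨x, y, liesOver_boundaryPt h hA x, liesOver_boundaryPt h hA y, ?_⟩
  have c0 : 0 < c := by linarith
  rcases eq_or_ne x y with rfl | hne
  · simp [verticalLength]
  have hd0 : 0 < |x - y| := abs_pos.2 (sub_ne_zero.2 hne)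
  rcases le_total |x - y| 1 with h1 | h1
  · obtain ⟨n, n1, n2⟩ := exists_scale hd0 h1
    have px := triadicAt_pos h n x
    have h3 : (0 : ℝ) < 3 ^ n := by positivity
    have h13 : (1 : ℝ) / 3 ^ n ≤ 3 / 3 ^ n := by gcongr; norm_num
    have hyx : triadicAt β lam n y ≤ 27 * triadicAt β lam n x := by
      have := triadicAt_compare h n (x := y) (y := x) (R := 1) (by rwa [abs_sub_comm])
      linarith
    have u1 := edist_boundaryPt_le h hA n2
    have l1 := le_edist_boundaryPt h hA n2
    have hlow : triadicAt β lam n x / 3 ^ n ≤ 3 * A * (triadicAt β lam n x / A * |x - y|) := by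
      rw [div_le_iff₀ h3] at n1 ⊢
      have : 3 * A * (triadicAt β lam n x / A * |x - y|) * 3 ^ n
        = triadicAt β lam n x * (3 * (|x - y| * 3 ^ n)) := by field_simp
      rw [this]
      nlinarith
    have l2 : ENNReal.ofReal (triadicAt β lam n x / A * |x - y|)
        ≤ verticalLength ρ x |x - y| + verticalLength ρ y |x - y| :=
      (le_verticalLength h hA (n2.trans h13)).trans le_self_add
    have u2 : verticalLength ρ x |x - y| + verticalLength ρ y |x - y|
        ≤ ENNReal.ofReal (28 * B * (triadicAt β lam n x / 3 ^ n)) := by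
      have v1 := (verticalLength_mono ρ x (n2.trans h13)).trans (verticalLength_le h hA n x)
      have v2 := (verticalLength_mono ρ y (n2.trans h13)).trans (verticalLength_le h hA n y)
      have py := triadicAt_pos h n y
      refine (add_le_add v1 v2).trans ?_
      rw [← ENNReal.ofReal_add (by positivity) (by positivity)]
      apply ENNReal.ofReal_le_ofReal
      calc _ ≤ B * (triadicAt β lam n x / 3 ^ n) + B * (27 * triadicAt β lam n x / 3 ^ n) := by
            gcongr
        _ = _ := by ring
    refine ⟨ofReal_inv_mul_le_of_le c0 u1 l2 ?_, le_ofReal_mul_of_le c0 u2 l1 ?_⟩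
    · calc _ ≤ (28 * B + A) * (3 * A * (triadicAt β lam n x / A * |x - y|)) := by gcongr
        _ = _ := by rw [hc]; ring
    · calc _ ≤ (28 * B + A) * (3 * A * (triadicAt β lam n x / A * |x - y|)) := by
            gcongr
            linarith
        _ = _ := by rw [hc]; ring
  · have u1 := edist_boundaryPt_le_far h hA x y
    have l1 := le_edist_boundaryPt_far h hA x y
    have l2 : ENNReal.ofReal (1 / A * |x - y|)
        ≤ verticalLength ρ x |x - y| + verticalLength ρ y |x - y| :=
      (le_verticalLength_one hA x _).trans le_self_add
    have u2 : verticalLength ρ x |x - y| + verticalLength ρ y |x - y|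
        ≤ ENNReal.ofReal ((B + A * |x - y|) + (B + A * |x - y|)) := by
      rw [ENNReal.ofReal_add (by positivity) (by positivity)]
      exact add_le_add (verticalLength_le_of_one_le h hA x h1)
        (verticalLength_le_of_one_le h hA y h1)
    have e : c * (1 / A * |x - y|) = 3 * (28 * B + A) * |x - y| := by
      rw [hc]
      field_simp
    have hb : B ≤ B * |x - y| := le_mul_of_one_le_right hC.le h1
    have ha : 0 ≤ A * |x - y| := by positivity
    refine ⟨ofReal_inv_mul_le_of_le c0 u1 l2 ?_, le_ofReal_mul_of_le c0 u2 l1 ?_⟩ <;>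
    · rw [e]
      linarith

end

/-! ### Volume growth -/

/-- The rectangle `[a - l, a + l] × (0, t]`. -/
def lowerBox (a l t : ℝ) : Set ℂ := {w | w.re ∈ Icc (a - l) (a + l) ∧ w.im ∈ Ioc 0 t}

theorem measurableSet_lowerBox (a l t : ℝ) : MeasurableSet (lowerBox a l t) :=
  (Complex.measurable_re measurableSet_Icc).inter (Complex.measurable_im measurableSet_Ioc)

theorem setLIntegral_lowerBox (a l t : ℝ) {g : ℝ → ℝ≥0∞} (hg : Measurable g) :
    ∫⁻ w in lowerBox a l t, g w.im = ENNReal.ofReal (2 * l) * ∫⁻ s in Ioc 0 t, g s := by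
  have h1 := Complex.volume_preserving_equiv_real_prod.setLIntegral_comp_preimage_emb
    Complex.measurableEquivRealProd.measurableEmbedding (fun p : ℝ × ℝ => g p.2)
    (Icc (a - l) (a + l) ×ˢ Ioc 0 t)
  have hpre : Complex.measurableEquivRealProd ⁻¹' (Icc (a - l) (a + l) ×ˢ Ioc 0 t)
      = lowerBox a l t := rfl
  rw [hpre] at h1
  refine Eq.trans h1 ?_
  rw [Measure.volume_eq_prod, ← Measure.prod_restrict]
  rw [lintegral_prod (fun p : ℝ × ℝ => g p.2) (hg.comp measurable_snd).aemeasurable]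
  simp only [lintegral_const, Measure.restrict_apply MeasurableSet.univ, univ_inter,
    Real.volume_Icc]
  rw [mul_comm]
  congr 2
  ring

theorem abs_re_sub_le_dist (w z : ℂ) : |w.re - z.re| ≤ dist w z := by
  rw [Complex.dist_eq, ← Complex.sub_re]
  exact Complex.abs_re_le_norm _

theorem im_le_add_dist (w z : ℂ) : w.im ≤ z.im + dist w z := by
  have := (le_abs_self _).trans (Complex.abs_im_le_norm (w - z))
  rw [Complex.sub_im, ← Complex.dist_eq] at this
  linarith

section

variable {β lam : ℝ} {ρ : HalfPlaneWeight} {A : ℝ}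

theorem rhoEDist_lt_of_mem_ball {z w : RhoSpace ρ} {r : ℝ} (hw : w ∈ Metric.ball z r) :
    rhoEDist ρ z.pt w.pt < ENNReal.ofReal r := by
  rw [Metric.mem_ball, dist_comm, ← edist_lt_ofReal] at hw
  exact hw

theorem lt_of_mem_ball {z w : RhoSpace ρ} {r q : ℝ} (hw : w ∈ Metric.ball z r)
    (hq : ENNReal.ofReal q ≤ rhoEDist ρ z.pt w.pt) : q < r := by
  have h1 := hq.trans_lt (rhoEDist_lt_of_mem_ball hw)
  have hr : 0 < r := ENNReal.ofReal_pos.1 (bot_le.trans_lt h1)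
  exact (ENNReal.ofReal_lt_ofReal_iff hr).1 h1

theorem setLIntegral_image_le {S : Set ℂ} {T : Set ℂ} (hST : S ⊆ T) (hT : MeasurableSet T)
    {f : ℂ → ℝ} {g : ℂ → ℝ} (hfg : ∀ w ∈ T, f w ≤ g w) :
    ∫⁻ w in S, ENNReal.ofReal (f w) ≤ ∫⁻ w in T, ENNReal.ofReal (g w) :=
  (lintegral_mono_set hST).trans
    (setLIntegral_mono' hT fun w hw => ENNReal.ofReal_le_ofReal (hfg w hw))

/-- Such a `d_ρ`-ball cannot leave the Harnack ball of z, where ρ is within a factor c of ρ(z). It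
lies in a Euclidean ball of radius c r / ρ(z) on which ρ² ≤ (c ρ(z))²; the product gives c^4 π r².
-/
theorem volumeGrowth_small {c : ℝ} (hc : 1 ≤ c)
    (hH : ∀ z ∈ upperHalf, ∀ w ∈ upperHalf, dist w z < z.im / 2 → ρ w ≤ c * ρ z ∧ ρ z ≤ c * ρ w)
    (z : RhoSpace ρ) {r : ℝ} (hr : 0 < r) (hrz : r ≤ ρ z.pt * z.pt.im / (2 * c)) :
    ∫⁻ w in RhoSpace.pt '' Metric.ball z r, ENNReal.ofReal (ρ w ^ 2)
      ≤ ENNReal.ofReal (c ^ 4 * Real.pi * r ^ 2) := by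
  have pz := ρ.pos_toFun _ z.pt_mem
  have c0 : 0 < c := by linarith
  have him : 0 < z.pt.im := z.pt_mem
  have hball : ∀ w : ℂ, dist w z.pt < z.pt.im / 2 → w ∈ upperHalf := by
    intro w hw
    have := im_le_add_dist z.pt w
    rw [dist_comm] at this
    have : 0 < w.im := by linarith
    exact this
  set S : Set ℂ := Metric.ball z.pt (c * r / ρ z.pt) ∩ Metric.ball z.pt (z.pt.im / 2) with hS
  have hsub : RhoSpace.pt '' Metric.ball z r ⊆ S := by
    rintro _ ⟨w, hw, rfl⟩
    have h1 := le_rhoEDist (ρ := ρ) (z := z.pt) (w := w.pt) (κ := ρ z.pt / c) (R := z.pt.im / 2)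
      (by positivity) fun v hv hvz => by
        rw [div_le_iff₀' c0]
        exact (hH _ z.pt_mem v hv hvz).2
    have h2 := lt_of_mem_ball hw h1
    rw [div_mul_eq_mul_div, div_lt_iff₀ c0] at h2
    rw [le_div_iff₀ (by positivity)] at hrz
    have h3 : min (z.pt.im / 2) (dist w.pt z.pt) < z.pt.im / 2 := by
      by_contra hcon
      push Not at hcon
      nlinarith
    have h4 : dist w.pt z.pt < z.pt.im / 2 := by
      rcases min_lt_iff.1 h3 with h | h
      · exact absurd h (lt_irrefl _)
      · exact h
    rw [min_eq_right h4.le] at h2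
    refine ⟨?_, h4⟩
    rw [Metric.mem_ball, lt_div_iff₀ pz]
    linarith
  refine (setLIntegral_image_le hsub (Metric.isOpen_ball.measurableSet.inter
    Metric.isOpen_ball.measurableSet) (g := fun _ => (c * ρ z.pt) ^ 2) ?_).trans ?_
  · intro w hw
    have hwH := hball w hw.2
    have := ρ.pos_toFun w hwH
    exact pow_le_pow_left₀ this.le (hH _ z.pt_mem w hwH hw.2).1 2
  · rw [setLIntegral_const]
    refine (mul_le_mul_right (measure_mono inter_subset_left) _).trans ?_
    rw [Complex.volume_ball, ← ENNReal.ofReal_coe_nnreal, ← ENNReal.ofReal_pow (by positivity),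
      ← ENNReal.ofReal_mul (by positivity), ← ENNReal.ofReal_mul (by positivity)]
    apply ENNReal.ofReal_le_ofReal
    rw [NNReal.coe_real_pi]
    apply le_of_eq
    field_simp

theorem two_growth_lt_one (hβ : -(1 / 2) < β) (hlam : -(1 / 2) < lam) :
    2 * growthExponent β lam < 1 := by
  have : growthExponent β lam < 1 / 2 := max_lt (by linarith) (by linarith)
  linarith

theorem sq_rpow_neg {a p : ℝ} (ha : 0 ≤ a) : (a ^ (-p)) ^ 2 = a ^ (-(2 * p)) := by
  rw [← Real.rpow_natCast, ← Real.rpow_mul ha]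
  congr 1
  push_cast
  ring

/-- The radius is too small for the ball to move a Euclidean distance 3^(-n), so it stays in a box
of that scale at the boundary. There ρ² is bounded by a multiple of (3^n y)^(-2σ), integrable
because 2σ < 1. -/
theorem volumeGrowth_scale (h : ExponentRange β lam) (hA : TriadicBounds β lam ρ A)
    (hσ : 2 * growthExponent β lam < 1) (z : RhoSpace ρ) {r : ℝ} {n : ℕ}
    (hz : z.pt.im ≤ 1 / 3 ^ n) (hr : r ≤ 1 / A * (triadicAt β lam n z.pt.re / 3 ^ n)) :
    ∫⁻ w in RhoSpace.pt '' Metric.ball z r, ENNReal.ofReal (ρ w ^ 2)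
      ≤ ENNReal.ofReal (6 * A ^ 2 / (1 - 2 * growthExponent β lam) *
          (triadicAt β lam n z.pt.re / 3 ^ n) ^ 2) := by
  set x := z.pt.re with hx
  have px := triadicAt_pos h n x
  have hA0 := hA.pos
  have h3 : (0 : ℝ) < 3 ^ n := by positivity
  have hsub : RhoSpace.pt '' Metric.ball z r ⊆ lowerBox x (1 / 3 ^ n) (3 / 3 ^ n) := by
    rintro _ ⟨w, hw, rfl⟩
    have h1 := lt_of_mem_ball hw (le_rhoEDist_scale h hA w.pt hz)
    have h2 : dist w.pt z.pt < 1 / 3 ^ n := by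
      by_contra hcon
      push Not at hcon
      have h4 : 1 / 3 ^ n ≤ min (2 / 3 ^ n) (dist w.pt z.pt) :=
        le_min (by gcongr; norm_num) hcon
      have h5 := mul_le_mul_of_nonneg_left h4 (div_nonneg px.le hA0.le)
      have e : triadicAt β lam n x / A * (1 / 3 ^ n) = 1 / A * (triadicAt β lam n x / 3 ^ n) := by
        field_simp
      rw [e] at h5
      linarith
    have h6 := (abs_re_sub_le_dist w.pt z.pt).trans h2.le
    rw [abs_le] at h6
    have h7 := im_le_add_dist w.pt z.pt
    have e : (3 : ℝ) / 3 ^ n = 3 * (1 / 3 ^ n) := by ring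
    have : (0 : ℝ) < 1 / 3 ^ n := by positivity
    exact ⟨⟨by linarith, by linarith⟩, w.pt_mem, by linarith⟩
  refine (setLIntegral_image_le hsub (measurableSet_lowerBox _ _ _)
    (g := fun w => (A * triadicAt β lam n x) ^ 2 *
      (3 ^ n * w.im) ^ (-(2 * growthExponent β lam))) ?_).trans ?_
  · rintro w ⟨hw1, hw2⟩
    have h13 : (1 : ℝ) / 3 ^ n ≤ 3 / 3 ^ n := by gcongr; norm_num
    have := hA.upper n x w hw2.1 hw2.2 (abs_le.2 ⟨by linarith [hw1.1], by linarith [hw1.2]⟩)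
    have pw := ρ.pos_toFun w hw2.1
    have := pow_le_pow_left₀ pw.le this 2
    rwa [mul_pow, sq_rpow_neg (mul_nonneg h3.le hw2.1.le)] at this
  · have hm : Measurable fun s : ℝ => ENNReal.ofReal ((A * triadicAt β lam n x) ^ 2 *
        (3 ^ n * s) ^ (-(2 * growthExponent β lam))) := by fun_prop
    rw [setLIntegral_lowerBox x _ _ hm]
    simp only [ENNReal.ofReal_mul (sq_nonneg (A * triadicAt β lam n x))]
    rw [lintegral_const_mul' _ _ ENNReal.ofReal_ne_top]
    have := setLIntegral_scaled_rpow_neg_le (p := 2 * growthExponent β lam)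
      (by linarith [h.growth_pos]) hσ n
    refine (mul_le_mul_right (mul_le_mul_right this _) _).trans ?_
    rw [← ENNReal.ofReal_mul (by positivity), ← ENNReal.ofReal_mul (by positivity)]
    apply ENNReal.ofReal_le_ofReal
    apply le_of_eq
    have : 1 - 2 * growthExponent β lam ≠ 0 := by linarith
    field_simp
    ring

/-- Since ρ ≥ 1 / A, the ball fits into a box with sides of order T r. There ρ² ≤ A² (1 + y^(-2σ)):
the first term covers heights above 1, the second those below. -/
theorem volumeGrowth_large (h : ExponentRange β lam) (hA : TriadicBounds β lam ρ A)
    (hσ : 2 * growthExponent β lam < 1) {T κ : ℝ} (hAT : A ≤ T) (hκ0 : 0 < κ)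
    (z : RhoSpace ρ) {r : ℝ} (hr : κ ≤ r) (hz : z.pt.im + A * r ≤ T * r) :
    ∫⁻ w in RhoSpace.pt '' Metric.ball z r, ENNReal.ofReal (ρ w ^ 2)
      ≤ ENNReal.ofReal (2 * T * A ^ 2 * (T + (1 / κ + T) / (1 - 2 * growthExponent β lam))
          * r ^ 2) := by
  have hA0 := hA.pos
  have hr0 : 0 < r := hκ0.trans_le hr
  have hT0 : 0 < T := hA0.trans_le hAT
  have hs := h.growth_pos
  set σ := growthExponent β lam with hσdef
  have hσ1 : 0 < 1 - 2 * σ := by linarith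
  have hsub : RhoSpace.pt '' Metric.ball z r ⊆ lowerBox z.pt.re (T * r) (T * r) := by
    rintro _ ⟨w, hw, rfl⟩
    have h1 := lt_of_mem_ball hw (le_rhoEDist_far hA z.pt w.pt)
    rw [one_div, inv_mul_lt_iff₀ hA0] at h1
    have h6 := (abs_re_sub_le_dist w.pt z.pt).trans h1.le
    rw [abs_le] at h6
    have h7 := im_le_add_dist w.pt z.pt
    have h8 : A * r ≤ T * r := by gcongr
    exact ⟨⟨by linarith, by linarith⟩, w.pt_mem, by linarith⟩
  refine (setLIntegral_image_le hsub (measurableSet_lowerBox _ _ _)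
    (g := fun w => A ^ 2 * (1 + w.im ^ (-(2 * σ)))) ?_).trans ?_
  · rintro w ⟨hw1, hw2⟩
    have pw := ρ.pos_toFun w hw2.1
    have q0 : 0 < w.im ^ (-(2 * σ)) := Real.rpow_pos_of_pos hw2.1 _
    rcases le_total 1 w.im with h1 | h1
    · have := pow_le_pow_left₀ pw.le (hA.upper_one w h1) 2
      nlinarith [sq_nonneg A]
    · have := hA.upper 0 w.re w hw2.1 (by simp; linarith) (by simp)
      simp only [triadicAt_zero, pow_zero, one_mul, mul_one] at this
      have := pow_le_pow_left₀ pw.le this 2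
      rw [mul_pow, sq_rpow_neg hw2.1.le] at this
      nlinarith [sq_nonneg A]
  · have hm : Measurable fun s : ℝ => ENNReal.ofReal (A ^ 2 * (1 + s ^ (-(2 * σ)))) := by
      fun_prop
    rw [setLIntegral_lowerBox z.pt.re _ _ hm]
    simp only [ENNReal.ofReal_mul (sq_nonneg A)]
    rw [lintegral_const_mul' _ _ ENNReal.ofReal_ne_top]
    have hTr : 0 < T * r := by positivity
    have e : ∫⁻ s in Ioc 0 (T * r), ENNReal.ofReal (1 + s ^ (-(2 * σ)))
        = ENNReal.ofReal (T * r + (T * r) ^ (1 - 2 * σ) / (1 - 2 * σ)) := by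
      rw [ENNReal.ofReal_add hTr.le (by positivity), ← setLIntegral_rpow_neg hσ hTr.le]
      have : ENNReal.ofReal (T * r) = ∫⁻ _ in Ioc 0 (T * r), (1 : ℝ≥0∞) := by simp
      rw [this, ← lintegral_add_left measurable_const]
      refine setLIntegral_congr_fun measurableSet_Ioc fun s hs => ?_
      rw [ENNReal.ofReal_add zero_le_one (Real.rpow_nonneg hs.1.le _), ENNReal.ofReal_one]
    rw [e, ← ENNReal.ofReal_mul (by positivity), ← ENNReal.ofReal_mul (by positivity)]
    apply ENNReal.ofReal_le_ofReal
    -- The left side is at most max(1, T r), and 1 ≤ r / κ.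
    have hpow : (T * r) ^ (1 - 2 * σ) ≤ (1 / κ + T) * r := by
      have h1r : 1 ≤ 1 / κ * r := by
        rw [one_div, inv_mul_eq_div, le_div_iff₀ hκ0]
        linarith
      rcases le_total (T * r) 1 with h1 | h1
      · have := Real.rpow_le_one hTr.le h1 hσ1.le
        nlinarith
      · have := Real.rpow_le_rpow_of_exponent_le h1 (show 1 - 2 * σ ≤ 1 by linarith)
        rw [Real.rpow_one] at this
        nlinarith
    calc 2 * (T * r) * (A ^ 2 * (T * r + (T * r) ^ (1 - 2 * σ) / (1 - 2 * σ)))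
        ≤ 2 * (T * r) * (A ^ 2 * (T * r + (1 / κ + T) * r / (1 - 2 * σ))) := by gcongr
      _ = _ := by ring

/-! ### The triadic scale matching a `d_ρ`-radius -/

theorem triadicAt_div_anti (h : ExponentRange β lam) (x : ℝ) :
    Antitone fun n : ℕ => triadicAt β lam n x / 3 ^ n := by
  refine antitone_nat_of_succ_le fun n => ?_
  have h1 := triadicAt_succ_le h n x
  have h2 := three_rpow_growth_le h
  have := triadicAt_pos h n x
  rw [pow_succ, div_le_div_iff₀ (by positivity) (by positivity)]
  have h3 : (0 : ℝ) < 3 ^ n := by positivity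
  have : triadicAt β lam (n + 1) x ≤ 3 * triadicAt β lam n x := by nlinarith
  nlinarith

theorem tendsto_triadicAt_div (h : ExponentRange β lam) (x : ℝ) :
    Tendsto (fun n : ℕ => triadicAt β lam n x / 3 ^ n) atTop (𝓝 0) := by
  refine squeeze_zero (fun n => (div_pos (triadicAt_pos h n x) (by positivity)).le) (fun n => ?_)
    (tendsto_triadicAt_bound h 1)
  rw [one_mul]
  have := triadicAt_le_pow h n x
  gcongr

/-- The sequence a_n / 3^n starts at 1, decreases to 0 and drops by a factor of at most 3 each time,
since weights do not decrease. The last index before it falls below r / κ works. -/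
theorem exists_triadic_scale (h : ExponentRange β lam) (x : ℝ) {r κ : ℝ} (hr : 0 < r)
    (hκ : 0 < κ) (hrκ : r ≤ κ) :
    ∃ n : ℕ, r ≤ κ * (triadicAt β lam n x / 3 ^ n) ∧
      κ * (triadicAt β lam n x / 3 ^ n) ≤ 3 * r := by
  have hex : ∃ n : ℕ, κ * (triadicAt β lam (n + 1) x / 3 ^ (n + 1)) < r := by
    have := (((tendsto_triadicAt_div h x).comp (tendsto_add_atTop_nat 1)).const_mul κ)
    rw [mul_zero] at this
    exact (this.eventually_lt_const hr).exists
  classical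
  refine ⟨Nat.find hex, ?_, ?_⟩
  · rcases Nat.eq_zero_or_pos (Nat.find hex) with h0 | hpos
    · rw [h0, triadicAt_zero]
      simpa using hrκ
    · have := Nat.find_min hex (m := Nat.find hex - 1) (by omega)
      rw [Nat.sub_add_cancel hpos] at this
      exact not_lt.1 this
  · have h1 := Nat.find_spec hex
    generalize Nat.find hex = n at h1 ⊢
    have h2 := triadicAt_le_succ h n x
    have h3 : (0 : ℝ) < 3 ^ n := by positivity
    have h4 : triadicAt β lam n x / 3 ^ n
        ≤ 3 * (triadicAt β lam (n + 1) x / 3 ^ (n + 1)) := by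
      rw [pow_succ]
      have : 3 * (triadicAt β lam (n + 1) x / (3 ^ n * 3))
        = triadicAt β lam (n + 1) x / 3 ^ n := by field_simp
      rw [this]
      gcongr
    nlinarith

/-- Used in contrapositive form: when the radius is too large for the Harnack regime, z lies below
height 3^(-n) for the scale n attached to the radius. -/
theorem scale_le_of_lt (h : ExponentRange β lam) (hA : TriadicBounds β lam ρ A) {z : ℂ}
    (hz : z ∈ upperHalf) {n : ℕ} (hn : 1 / 3 ^ n < z.im) :
    triadicAt β lam n z.re / 3 ^ n ≤ A * (ρ z * z.im) := by
  have hA0 := hA.pos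
  have him : 0 < z.im := hz
  have pz := ρ.pos_toFun z hz
  rcases le_total z.im 3 with h3 | h3
  · obtain ⟨m, -, m1, m2⟩ := exists_level (n := 0) him (by simpa using h3)
    have hmn : m ≤ n := by
      by_contra hcon
      push Not at hcon
      have : (3 : ℝ) / 3 ^ m ≤ 1 / 3 ^ n := by
        have e : (1 : ℝ) / 3 ^ n = 3 / 3 ^ (n + 1) := by
          rw [pow_succ]
          field_simp
        rw [e]
        gcongr
        · norm_num
        · omega
      linarith
    have h4 := triadicAt_div_anti h z.re hmn
    have h5 := hA.lower m z.re z him m2 (by rw [sub_self, abs_zero]; positivity)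
    have := triadicAt_pos h m z.re
    simp only at h4
    refine h4.trans ?_
    rw [div_eq_mul_one_div]
    calc triadicAt β lam m z.re * (1 / 3 ^ m) ≤ (A * ρ z) * z.im := by gcongr
      _ = _ := by ring
  · have h4 := triadicAt_div_anti h z.re (Nat.zero_le n)
    simp only [triadicAt_zero, pow_zero, div_one] at h4
    have := hA.lower_one z hz
    nlinarith

theorem volumeGrowth_of_bounds (h : ExponentRange β lam) (hH : HarnackOn ρ upperHalf)
    (hA : TriadicBounds β lam ρ A) (hβ : -(1 / 2) < β) (hlam : -(1 / 2) < lam) :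
    VolumeGrowth ρ := by
  obtain ⟨c, hc, hH⟩ := hH.exists_le_mul
  have hσ := two_growth_lt_one hβ hlam
  have hA0 := hA.pos
  have hA1 := hA.one_le
  have c0 : 0 < c := by linarith
  set σ := growthExponent β lam with hσdef
  have hσ1 : 0 < 1 - 2 * σ := by linarith
  -- Chosen so that κ A ρ(z) y = ρ(z) y / (2 c), with y the height of z: this is the threshold of
  -- the small-radius case.
  set κ := 1 / (2 * c * A) with hκ
  have hκ0 : 0 < κ := by positivity
  have hκA : κ ≤ 1 / A := by
    rw [hκ]
    apply one_div_le_one_div_of_le hA0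
    nlinarith
  -- Beyond the small-radius case ρ(z) ≥ 1 / A gives height of z at most 2 c A r; the ball adds at
  -- most A r.
  set T := 2 * c * A + A with hT
  set C₁ := c ^ 4 * Real.pi with hC₁
  set C₂ := 6 * A ^ 2 / (1 - 2 * σ) * (3 / κ) ^ 2 with hC₂
  set C₃ := 2 * T * A ^ 2 * (T + (1 / κ + T) / (1 - 2 * σ)) with hC₃
  have hC₁0 : 0 ≤ C₁ := by positivity
  have hC₂0 : 0 ≤ C₂ := by positivity
  have hC₃0 : 0 ≤ C₃ := by positivity
  refine ⟨1 + C₁ + C₂ + C₃, by linarith, fun z r hr => ?_⟩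
  have hr2 : 0 ≤ r ^ 2 := sq_nonneg r
  have him : 0 < z.pt.im := z.pt_mem
  have pz := ρ.pos_toFun _ z.pt_mem
  rcases le_or_gt r (ρ z.pt * z.pt.im / (2 * c)) with h1 | h1
  · refine (volumeGrowth_small hc hH z hr h1).trans (ENNReal.ofReal_le_ofReal ?_)
    gcongr
    linarith
  rcases le_total r κ with h2 | h2
  · obtain ⟨n, n1, n2⟩ := exists_triadic_scale h z.pt.re hr hκ0 h2
    have pn := triadicAt_pos h n z.pt.re
    have hzn : z.pt.im ≤ 1 / 3 ^ n := by
      by_contra hcon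
      push Not at hcon
      have h3 := scale_le_of_lt h hA z.pt_mem hcon
      have h4 := mul_le_mul_of_nonneg_left h3 hκ0.le
      have e : κ * (A * (ρ z.pt * z.pt.im)) = ρ z.pt * z.pt.im / (2 * c) := by
        rw [hκ]
        field_simp
      rw [e] at h4
      linarith
    have h5 : r ≤ 1 / A * (triadicAt β lam n z.pt.re / 3 ^ n) := by
      refine n1.trans ?_
      gcongr
    refine (volumeGrowth_scale h hA hσ z hzn h5).trans (ENNReal.ofReal_le_ofReal ?_)
    have h6 : triadicAt β lam n z.pt.re / 3 ^ n ≤ 3 / κ * r := by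
      rw [div_mul_eq_mul_div, le_div_iff₀ hκ0]
      linarith
    calc 6 * A ^ 2 / (1 - 2 * σ) * (triadicAt β lam n z.pt.re / 3 ^ n) ^ 2
        ≤ 6 * A ^ 2 / (1 - 2 * σ) * (3 / κ * r) ^ 2 := by gcongr
      _ = C₂ * r ^ 2 := by rw [hC₂]; ring
      _ ≤ _ := by
        gcongr
        linarith
  · have hz : z.pt.im + A * r ≤ T * r := by
      have h3 := hA.lower_one _ z.pt_mem
      rw [div_lt_iff₀ (by positivity)] at h1
      have : z.pt.im ≤ 2 * c * A * r := by nlinarith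
      rw [hT]
      linarith
    refine (volumeGrowth_large h hA hσ (T := T) (by rw [hT]; nlinarith [mul_pos c0 hA0]) hκ0 z h2
      hz).trans (ENNReal.ofReal_le_ofReal ?_)
    gcongr
    linarith

end

/-! ### The Moran equation and the entropy ratio -/

/-- `s` is the solution of the Moran equation with ratios `3 ^ (-(1 + β))` (once) and
`3 ^ (-(1 + λ))` (twice). -/
structure MoranExponent (β lam s : ℝ) : Prop where
  pos : 0 < s
  sum_eq : (3 : ℝ) ^ (-(1 + β) * s) + 2 * (3 : ℝ) ^ (-(1 + lam) * s) = 1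

/-- Intermediate value theorem: the sum is 3 at s = 0, and at s = 1 / min(1 + β, 1 + λ) each of its
three powers is at most 1 / 3. -/
theorem ExponentRange.exists_moranExponent {β lam : ℝ} (h : ExponentRange β lam) :
    ∃ s, MoranExponent β lam s := by
  set g : ℝ → ℝ := fun s => (3 : ℝ) ^ (-(1 + β) * s) + 2 * (3 : ℝ) ^ (-(1 + lam) * s) with hg
  have h1 : 0 < 1 + β := by linarith [h.beta_gt]
  have h2 : 0 < 1 + lam := by linarith [h.lam_gt]
  have hcont : Continuous g := by
    have : ∀ a : ℝ, Continuous fun s : ℝ => (3 : ℝ) ^ (a * s) := fun a =>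
      (Real.continuous_const_rpow (by norm_num)).comp (continuous_const.mul continuous_id)
    exact (this _).add (continuous_const.mul (this _))
  set δ := min (1 + β) (1 + lam) with hδ
  have hδ0 : 0 < δ := lt_min h1 h2
  have key : ∀ a, δ ≤ a → (3 : ℝ) ^ (-a * (1 / δ)) ≤ 1 / 3 := by
    intro a ha
    have e : (1 : ℝ) / 3 = 3 ^ (-1 : ℝ) := by rw [Real.rpow_neg_one, one_div]
    rw [e]
    apply Real.rpow_le_rpow_of_exponent_le (by norm_num)
    rw [mul_one_div, neg_div, neg_le_neg_iff, le_div_iff₀ hδ0]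
    linarith
  have hg1 : g (1 / δ) ≤ 1 := by
    have k1 := key _ (min_le_left (1 + β) (1 + lam))
    have k2 := key _ (min_le_right (1 + β) (1 + lam))
    simp only [hg]
    linarith
  have hg0 : g 0 = 3 := by
    simp only [hg, mul_zero, Real.rpow_zero]
    norm_num
  obtain ⟨s, hs, hgs⟩ := intermediate_value_Icc' (show (0 : ℝ) ≤ 1 / δ by positivity)
    hcont.continuousOn ⟨hg1, by rw [hg0]; norm_num⟩
  refine ⟨s, lt_of_le_of_ne hs.1 ?_, hgs⟩
  rintro rfl
  rw [hg0] at hgs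
  norm_num at hgs

theorem gibbs_le {t p : ℝ} (ht : 0 ≤ t) (hp : 0 < p) :
    -t * Real.log t + t * Real.log p ≤ p - t := by
  rcases ht.eq_or_lt with rfl | ht
  · simpa using hp.le
  · have h1 := Real.log_le_sub_one_of_pos (div_pos hp ht)
    rw [Real.log_div hp.ne' ht.ne'] at h1
    have h2 := mul_le_mul_of_nonneg_left h1 ht.le
    have e : t * (p / t - 1) = p - t := by field_simp
    linarith

/-- The numerator is the entropy of (t, (1 - t)/2, (1 - t)/2). By `gibbs_le`, summed over the three
entries, it is at most the cross entropy with (p, q, q), where p + 2 q = 1 by the Moran equation.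
Since log p and log q are multiples of s, that cross entropy is s times the denominator. Equality
holds at t = p. -/
theorem MoranExponent.isMaxOn_entropyRatio {β lam s : ℝ} (h : ExponentRange β lam)
    (hs : MoranExponent β lam s) :
    ∃ t ∈ Icc (0 : ℝ) 1, IsMaxOn (entropyRatio β lam) (Icc 0 1) t ∧ entropyRatio β lam t = s := by
  set p := (3 : ℝ) ^ (-(1 + β) * s) with hp
  set q := (3 : ℝ) ^ (-(1 + lam) * s) with hq
  have hp0 : 0 < p := Real.rpow_pos_of_pos (by norm_num) _
  have hq0 : 0 < q := Real.rpow_pos_of_pos (by norm_num) _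
  have hpq : p + 2 * q = 1 := hs.sum_eq
  have lp : Real.log p = -(1 + β) * s * Real.log 3 := Real.log_rpow (by norm_num) _
  have lq : Real.log q = -(1 + lam) * s * Real.log 3 := Real.log_rpow (by norm_num) _
  have l3 : 0 < Real.log 3 := Real.log_pos (by norm_num)
  have h1 := h.beta_gt
  have h2 := h.lam_gt
  have hden : ∀ t ∈ Icc (0 : ℝ) 1, 0 < (1 + t * β + (1 - t) * lam) * Real.log 3 := by
    intro t ht
    have e : 1 + t * β + (1 - t) * lam = t * (1 + β) + (1 - t) * (1 + lam) := by ring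
    rw [e]
    refine mul_pos ?_ l3
    rcases ht.1.eq_or_lt with h0 | h0
    · rw [← h0]
      linarith
    · have := mul_pos h0 (show 0 < 1 + β by linarith)
      have := mul_nonneg (sub_nonneg.2 ht.2) (show 0 ≤ 1 + lam by linarith)
      linarith
  have hmul : ∀ t, s * ((1 + t * β + (1 - t) * lam) * Real.log 3)
      = -t * Real.log p - (1 - t) * Real.log q := by
    intro t
    rw [lp, lq]
    ring
  have hp1 : p ∈ Icc (0 : ℝ) 1 := ⟨hp0.le, by linarith⟩
  have heq : entropyRatio β lam p = s := by
    rw [entropyRatio, div_eq_iff (hden p hp1).ne', hmul]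
    have : (1 - p) / 2 = q := by linarith
    rw [this]
    ring
  refine ⟨p, hp1, ?_, heq⟩
  rw [isMaxOn_iff]
  intro t ht
  rw [heq, entropyRatio, div_le_iff₀ (hden t ht), hmul]
  have g1 := gibbs_le ht.1 hp0
  have g2 := gibbs_le (t := (1 - t) / 2) (by linarith [ht.2]) hq0
  have e : (t - 1) * Real.log ((1 - t) / 2)
      = 2 * (-((1 - t) / 2) * Real.log ((1 - t) / 2)) := by ring
  rw [e]
  linarith

/-! ### The distribution function -/

/-- The mass of the triadic interval `[j / 3 ^ n, (j + 1) / 3 ^ n]`. -/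
noncomputable def triadicMass (β lam s : ℝ) (n : ℕ) (j : ℤ) : ℝ :=
  (triadicValue β lam n j / 3 ^ n) ^ s

/-- The relative position, inside the image of its parent, of the left endpoint of the image of the
child with last digit `j % 3`. -/
noncomputable def digitOffset (β lam s : ℝ) (j : ℤ) : ℝ :=
  if j % 3 = 0 then 0 else if j % 3 = 1 then (3 : ℝ) ^ (-(1 + lam) * s)
    else (3 : ℝ) ^ (-(1 + lam) * s) + (3 : ℝ) ^ (-(1 + β) * s)

/-- The value of the distribution function at `j / 3 ^ n`. -/
noncomputable def cumulative (β lam s : ℝ) : ℕ → ℤ → ℝ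
  | 0, j => j
  | n + 1, j => cumulative β lam s n (j / 3) +
      triadicMass β lam s n (j / 3) * digitOffset β lam s j

/-- The distribution function of the self-similar measure. -/
noncomputable def distFun (β lam s x : ℝ) : ℝ :=
  ⨆ n : ℕ, cumulative β lam s n ⌊(3 : ℝ) ^ n * x⌋

section

variable {β lam s : ℝ}

theorem triadicMass_pos (h : ExponentRange β lam) (n : ℕ) (j : ℤ) :
    0 < triadicMass β lam s n j :=
  Real.rpow_pos_of_pos (div_pos (triadicValue_pos h n j) (by positivity)) _

theorem triadicMass_succ (h : ExponentRange β lam) (n : ℕ) (j : ℤ) :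
    triadicMass β lam s (n + 1) j = triadicMass β lam s n (j / 3) *
      if j % 3 = 1 then (3 : ℝ) ^ (-(1 + β) * s) else (3 : ℝ) ^ (-(1 + lam) * s) := by
  have hv := triadicValue_pos h n (j / 3)
  have hf := one_le_digitFactor h j
  have e : triadicValue β lam (n + 1) j / 3 ^ (n + 1)
      = triadicValue β lam n (j / 3) / 3 ^ n * (digitFactor β lam j / 3) := by
    rw [triadicValue, pow_succ]
    field_simp
  have key : ∀ a : ℝ, ((3 : ℝ) ^ (-a) / 3) ^ s = (3 : ℝ) ^ (-(1 + a) * s) := by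
    intro a
    rw [Real.rpow_mul (by norm_num)]
    congr 1
    rw [neg_add_rev, ← sub_eq_add_neg, Real.rpow_sub (by norm_num), Real.rpow_one]
  unfold triadicMass
  rw [e, Real.mul_rpow (by positivity) (by linarith [hf])]
  congr 1
  unfold digitFactor
  split_ifs <;> exact key _

/-- Within one parent this is the definition of the offsets. Passing from the child with digit 2 to
the next parent is where the Moran equation enters: the three children exhaust the mass of their
parent. -/
theorem cumulative_add_one (h : ExponentRange β lam) (hs : MoranExponent β lam s) (n : ℕ) (j : ℤ) :
    cumulative β lam s n (j + 1) = cumulative β lam s n j + triadicMass β lam s n j := by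
  induction n generalizing j with
  | zero => simp [cumulative, triadicMass, triadicValue]
  | succ n ih =>
    have hsum := hs.sum_eq
    rw [triadicMass_succ h]
    simp only [cumulative, digitOffset]
    rcases (by omega : j % 3 = 0 ∨ j % 3 = 1 ∨ j % 3 = 2) with e | e | e
    · rw [show (j + 1) / 3 = j / 3 by omega, show (j + 1) % 3 = 1 by omega, e]
      norm_num
    · rw [show (j + 1) / 3 = j / 3 by omega, show (j + 1) % 3 = 2 by omega, e]
      norm_num
      ring
    · rw [show (j + 1) / 3 = j / 3 + 1 by omega, show (j + 1) % 3 = 0 by omega, e, ih]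
      norm_num
      norm_num at hsum
      linear_combination (-triadicMass β lam s n (j / 3)) * hsum

theorem cumulative_strictMono (h : ExponentRange β lam) (hs : MoranExponent β lam s) (n : ℕ) :
    StrictMono (cumulative β lam s n) :=
  strictMono_int_of_lt_succ fun j => by
    rw [cumulative_add_one h hs]
    linarith [triadicMass_pos (s := s) h n j]

theorem cumulative_parent_le (h : ExponentRange β lam) (n : ℕ) (j : ℤ) :
    cumulative β lam s n (j / 3) ≤ cumulative β lam s (n + 1) j := by
  have : 0 ≤ digitOffset β lam s j := by
    unfold digitOffset
    split_ifs <;> positivity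
  have := mul_nonneg (triadicMass_pos (s := s) h n (j / 3)).le this
  rw [cumulative]
  linarith

theorem cumulative_le_parent (h : ExponentRange β lam) (hs : MoranExponent β lam s) (n : ℕ)
    (j : ℤ) : cumulative β lam s (n + 1) (j + 1) ≤ cumulative β lam s n (j / 3 + 1) := by
  have h1 : cumulative β lam s (n + 1) (j + 1) ≤ cumulative β lam s (n + 1) (3 * (j / 3 + 1)) :=
    (cumulative_strictMono h hs (n + 1)).monotone (by omega)
  refine h1.trans (le_of_eq ?_)
  rw [cumulative, digitOffset, if_pos (by omega), mul_zero, add_zero]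
  congr 1
  omega

/-- The intervals between consecutive cumulative values along the address of x are nested, and the
supremum of the left ends lies in all of them. -/
theorem distFun_mem (h : ExponentRange β lam) (hs : MoranExponent β lam s) (x : ℝ) (n : ℕ) :
    distFun β lam s x ∈ Icc (cumulative β lam s n ⌊(3 : ℝ) ^ n * x⌋)
      (cumulative β lam s n (⌊(3 : ℝ) ^ n * x⌋ + 1)) := by
  have hanti : Antitone fun n : ℕ => Icc (cumulative β lam s n ⌊(3 : ℝ) ^ n * x⌋)
      (cumulative β lam s n (⌊(3 : ℝ) ^ n * x⌋ + 1)) := by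
    refine antitone_nat_of_succ_le fun n => Icc_subset_Icc ?_ ?_
    · have := cumulative_parent_le (s := s) h n ⌊(3 : ℝ) ^ (n + 1) * x⌋
      rwa [floor_three_pow_succ] at this
    · have := cumulative_le_parent h hs n ⌊(3 : ℝ) ^ (n + 1) * x⌋
      rwa [floor_three_pow_succ] at this
  have := ciSup_mem_iInter_Icc_of_antitone_Icc hanti fun n =>
    (cumulative_strictMono h hs n).monotone (by omega)
  exact mem_iInter.1 this n

theorem floor_add_one_lt {n : ℕ} {x y : ℝ} (hxy : 1 / 3 / 3 ^ n ≤ y - x) :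
    ⌊(3 : ℝ) ^ (n + 2) * x⌋ + 2 ≤ ⌊(3 : ℝ) ^ (n + 2) * y⌋ := by
  rw [Int.le_floor]
  push_cast
  have h1 := Int.floor_le ((3 : ℝ) ^ (n + 2) * x)
  have h3 : (0 : ℝ) < 3 ^ n := by positivity
  rw [div_le_iff₀ h3] at hxy
  have h4 : (3 : ℝ) ^ (n + 2) * y - 3 ^ (n + 2) * x = 9 * ((y - x) * 3 ^ n) := by ring
  linarith

/-- A gap of 3^(-n) / 3 is three intervals of level n + 2, so a whole one lies between x and y,
adjacent to the one containing x. In 27 = 9 · 3 the factors come from the two extra levels and from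
adjacency. -/
theorem distFun_sub_ge (h : ExponentRange β lam) (hs : MoranExponent β lam s) {n : ℕ} {x y : ℝ}
    (hxy : 1 / 3 / 3 ^ n ≤ y - x) :
    (triadicAt β lam n x / 3 ^ n / 27) ^ s ≤ distFun β lam s y - distFun β lam s x := by
  set j := ⌊(3 : ℝ) ^ (n + 2) * x⌋ with hj
  have h1 := (distFun_mem h hs x (n + 2)).2
  have h2 := (distFun_mem h hs y (n + 2)).1
  have h3 := (cumulative_strictMono h hs (n + 2)).monotone (floor_add_one_lt hxy)
  rw [show j + 2 = j + 1 + 1 by ring, cumulative_add_one h hs] at h3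
  have h4 : (triadicAt β lam n x / 3 ^ n / 27) ^ s ≤ triadicMass β lam s (n + 2) (j + 1) := by
    have px := triadicAt_pos h n x
    have h5 := (triadicValue_adjacent h (n + 2) j).2
    have h6 : triadicAt β lam n x ≤ triadicValue β lam (n + 2) j :=
      triadicAt_mono h x (Nat.le_add_right n 2)
    refine Real.rpow_le_rpow (by positivity) ?_ hs.pos.le
    rw [div_div, div_le_div_iff₀ (by positivity) (by positivity), pow_add]
    have h7 : (0 : ℝ) < 3 ^ n := by positivity
    nlinarith
  linarith

theorem distFun_strictMono (h : ExponentRange β lam) (hs : MoranExponent β lam s) :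
    StrictMono (distFun β lam s) := by
  intro x y hxy
  have h0 : Tendsto (fun n : ℕ => (1 : ℝ) / 3 / 3 ^ n) atTop (𝓝 0) := by
    simpa [div_eq_mul_inv] using (tendsto_pow_atTop_nhds_zero_of_lt_one (r := (3 : ℝ)⁻¹)
      (by norm_num) (by norm_num)).const_mul (3 : ℝ)⁻¹
  obtain ⟨n, hn⟩ := (h0.eventually_lt_const (sub_pos.2 hxy)).exists
  have h1 := distFun_sub_ge h hs hn.le
  have h2 : 0 < (triadicAt β lam n x / 3 ^ n / 27) ^ s :=
    Real.rpow_pos_of_pos (by have := triadicAt_pos h n x; positivity) _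
  linarith

/-- The increment is carried by the interval containing x and its right neighbour, whose weight is
at most three times as large. -/
theorem distFun_sub_le (h : ExponentRange β lam) (hs : MoranExponent β lam s) {n : ℕ} {x y : ℝ}
    (hd : y - x ≤ 1 / 3 ^ n) :
    distFun β lam s y - distFun β lam s x ≤ 2 * (3 * (triadicAt β lam n x / 3 ^ n)) ^ s := by
  set j := ⌊(3 : ℝ) ^ n * x⌋ with hj
  have h3 : (0 : ℝ) < 3 ^ n := by positivity
  have hjy : ⌊(3 : ℝ) ^ n * y⌋ ≤ j + 1 := by
    rw [hj, ← Int.floor_add_one]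
    apply Int.floor_le_floor
    rw [le_div_iff₀ h3] at hd
    linarith
  have h1 := (distFun_mem h hs y n).2
  have h2 := (distFun_mem h hs x n).1
  have h4 := (cumulative_strictMono h hs n).monotone (show ⌊(3 : ℝ) ^ n * y⌋ + 1 ≤ j + 1 + 1 by
    omega)
  rw [cumulative_add_one h hs n (j + 1), cumulative_add_one h hs n j] at h4
  have hv := triadicValue_pos h n j
  have hv1 := triadicValue_pos h n (j + 1)
  have e : triadicAt β lam n x = triadicValue β lam n j := rfl
  have h5 : triadicMass β lam s n j ≤ (3 * (triadicAt β lam n x / 3 ^ n)) ^ s := by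
    refine Real.rpow_le_rpow (by positivity) ?_ hs.pos.le
    rw [e]
    have : 0 < triadicValue β lam n j / 3 ^ n := by positivity
    linarith
  have h6 : triadicMass β lam s n (j + 1) ≤ (3 * (triadicAt β lam n x / 3 ^ n)) ^ s := by
    refine Real.rpow_le_rpow (by positivity) ?_ hs.pos.le
    rw [e, ← mul_div_assoc]
    have := (triadicValue_adjacent h n j).1
    gcongr
  linarith

theorem abs_distFun_sub_le (h : ExponentRange β lam) (hs : MoranExponent β lam s) {n : ℕ} {x y : ℝ}
    (hd : |x - y| ≤ 1 / 3 ^ n) :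
    |distFun β lam s x - distFun β lam s y| ≤ 2 * (81 * (triadicAt β lam n x / 3 ^ n)) ^ s := by
  have px := triadicAt_pos h n x
  have py := triadicAt_pos h n y
  have hyx : triadicAt β lam n y ≤ 27 * triadicAt β lam n x := by
    have := triadicAt_compare h n (x := y) (y := x) (R := 1) (by rwa [abs_sub_comm])
    linarith
  rcases le_total x y with hxy | hxy
  · rw [abs_sub_comm, abs_of_nonneg (sub_nonneg.2 ((distFun_strictMono h hs).monotone hxy))]
    rw [abs_sub_comm, abs_of_nonneg (sub_nonneg.2 hxy)] at hd
    refine (distFun_sub_le h hs hd).trans ?_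
    have := hs.pos
    gcongr
    norm_num
  · rw [abs_of_nonneg (sub_nonneg.2 ((distFun_strictMono h hs).monotone hxy))]
    rw [abs_of_nonneg (sub_nonneg.2 hxy)] at hd
    refine (distFun_sub_le h hs hd).trans ?_
    have e : 81 * (triadicAt β lam n x / 3 ^ n) = 3 * (27 * triadicAt β lam n x / 3 ^ n) := by ring
    rw [e]
    have := hs.pos
    gcongr

/-- 729 = 27 · 27: the constant of `distFun_sub_ge` times the comparison of the weights at x and y,
needed when y is the left point. -/
theorem le_abs_distFun_sub (h : ExponentRange β lam) (hs : MoranExponent β lam s) {n : ℕ} {x y : ℝ}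
    (hd : 1 / 3 / 3 ^ n ≤ |x - y|) (hd' : |x - y| ≤ 1 / 3 ^ n) :
    (triadicAt β lam n x / 3 ^ n / 729) ^ s ≤ |distFun β lam s x - distFun β lam s y| := by
  have px := triadicAt_pos h n x
  have py := triadicAt_pos h n y
  have hxy : triadicAt β lam n x ≤ 27 * triadicAt β lam n y := by
    have := triadicAt_compare h n (R := 1) hd'
    linarith
  rcases le_total x y with hle | hle
  · rw [abs_sub_comm, abs_of_nonneg (sub_nonneg.2 hle)] at hd
    rw [abs_sub_comm]
    refine le_trans ?_ ((distFun_sub_ge h hs hd).trans (le_abs_self _))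
    refine Real.rpow_le_rpow (by positivity) ?_ hs.pos.le
    gcongr
    norm_num
  · rw [abs_of_nonneg (sub_nonneg.2 hle)] at hd
    refine le_trans ?_ ((distFun_sub_ge h hs hd).trans (le_abs_self _))
    refine Real.rpow_le_rpow (by positivity) ?_ hs.pos.le
    rw [div_div, div_div, div_le_div_iff₀ (by positivity) (by positivity)]
    have h3 : (0 : ℝ) < 3 ^ n := by positivity
    nlinarith

theorem continuous_distFun (h : ExponentRange β lam) (hs : MoranExponent β lam s) :
    Continuous (distFun β lam s) := by
  rw [Metric.continuous_iff]
  intro x ε hε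
  have h1 : Tendsto (fun n : ℕ => 2 * (81 * (triadicAt β lam n x / 3 ^ n)) ^ s) atTop (𝓝 0) := by
    have h2 := ((tendsto_triadicAt_div h x).const_mul 81).rpow_const (p := s) (Or.inr hs.pos.le)
    rw [mul_zero, Real.zero_rpow hs.pos.ne'] at h2
    simpa using h2.const_mul 2
  obtain ⟨n, hn⟩ := (h1.eventually_lt_const hε).exists
  refine ⟨1 / 3 ^ n, by positivity, fun y hy => ?_⟩
  rw [dist_comm, Real.dist_eq] at hy ⊢
  exact (abs_distFun_sub_le h hs hy.le).trans_lt hn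

end

/-! ### Hausdorff dimension -/

theorem holderOnWith_of_dist_le {X Y : Type*} [PseudoMetricSpace X] [PseudoMetricSpace Y]
    {f : X → Y} {S : Set X} {C r : ℝ} (hC : 0 ≤ C) (hr : 0 ≤ r)
    (hf : ∀ x ∈ S, ∀ y ∈ S, dist (f x) (f y) ≤ C * dist x y ^ r) :
    HolderOnWith C.toNNReal r.toNNReal f S := by
  intro x hx y hy
  rw [edist_dist, edist_dist, Real.coe_toNNReal r hr,
    ENNReal.ofReal_rpow_of_nonneg dist_nonneg hr]
  change _ ≤ ENNReal.ofReal C * _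
  rw [← ENNReal.ofReal_mul hC]
  exact ENNReal.ofReal_le_ofReal (hf x hx y hy)

section

variable {β lam s : ℝ} {ρ : HalfPlaneWeight} {A : ℝ}

theorem dist_distFun_le (h : ExponentRange β lam) (hA : TriadicBounds β lam ρ A)
    (hs : MoranExponent β lam s) {x y : ℝ} (hxy : |x - y| ≤ 1) :
    dist (distFun β lam s x) (distFun β lam s y)
      ≤ 2 * (243 * A) ^ s * dist (boundaryPt ρ x) (boundaryPt ρ y) ^ s := by
  have hA0 := hA.pos
  rcases eq_or_ne x y with rfl | hne
  · rw [dist_self]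
    positivity
  obtain ⟨n, n1, n2⟩ := exists_scale (abs_pos.2 (sub_ne_zero.2 hne)) hxy
  have px := triadicAt_pos h n x
  have h3 : (0 : ℝ) < 3 ^ n := by positivity
  have h1 := le_edist_boundaryPt h hA n2
  rw [edist_dist, ENNReal.ofReal_le_ofReal_iff dist_nonneg] at h1
  have h2 : 81 * (triadicAt β lam n x / 3 ^ n)
      ≤ 243 * A * dist (boundaryPt ρ x) (boundaryPt ρ y) := by
    have h4 : triadicAt β lam n x / A * (1 / 3 / 3 ^ n) ≤ dist (boundaryPt ρ x) (boundaryPt ρ y) :=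
      le_trans (by gcongr) h1
    have e : 81 * (triadicAt β lam n x / 3 ^ n)
        = 243 * A * (triadicAt β lam n x / A * (1 / 3 / 3 ^ n)) := by
      field_simp
      norm_num
    rw [e]
    gcongr
  rw [Real.dist_eq, mul_assoc, ← Real.mul_rpow (by positivity) dist_nonneg]
  refine (abs_distFun_sub_le h hs n2).trans ?_
  have := hs.pos
  gcongr

theorem dist_boundaryPt_le (h : ExponentRange β lam) (hA : TriadicBounds β lam ρ A)
    (hs : MoranExponent β lam s) {x y : ℝ} (hxy : |x - y| ≤ 1) :
    dist (boundaryPt ρ x) (boundaryPt ρ y)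
      ≤ 729 * (28 * columnConst β lam A + A) *
        dist (distFun β lam s x) (distFun β lam s y) ^ s⁻¹ := by
  have hA0 := hA.pos
  have hC := columnConst_pos h hA
  have hs0 := hs.pos
  rcases eq_or_ne x y with rfl | hne
  · rw [dist_self]
    positivity
  obtain ⟨n, n1, n2⟩ := exists_scale (abs_pos.2 (sub_ne_zero.2 hne)) hxy
  have px := triadicAt_pos h n x
  have h3 : (0 : ℝ) < 3 ^ n := by positivity
  have h1 := edist_boundaryPt_le h hA n2
  rw [edist_le_ofReal (by positivity)] at h1
  have h2 := le_abs_distFun_sub h hs n1 n2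
  rw [← Real.dist_eq] at h2
  have h4 := Real.rpow_le_rpow (by positivity) h2 (inv_nonneg.2 hs0.le)
  rw [Real.rpow_rpow_inv (by positivity) hs0.ne', div_le_iff₀ (by norm_num)] at h4
  refine h1.trans ?_
  calc _ ≤ (28 * columnConst β lam A + A) *
        (dist (distFun β lam s x) (distFun β lam s y) ^ s⁻¹ * 729) := by gcongr
    _ = _ := by ring

/-- The distribution function, read on the boundary over [0, 1], is s-Hölder and its image contains
a nondegenerate interval, so 1 ≤ dim / s. -/
theorem le_dimH_rhoBoundary (h : ExponentRange β lam) (hA : TriadicBounds β lam ρ A)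
    (hs : MoranExponent β lam s) : ENNReal.ofReal s ≤ dimH (rhoBoundary ρ) := by
  have hA0 := hA.pos
  have hs0 := hs.pos
  set f : RhoClosure ρ → ℝ := fun ξ => distFun β lam s (boundaryProj ρ ξ).re with hf
  have hfE : ∀ x, f (boundaryPt ρ x) = distFun β lam s x := by
    intro x
    simp only [hf, boundaryProj_boundaryPt h hA, Complex.ofReal_re]
  have hhol : HolderOnWith (2 * (243 * A) ^ s).toNNReal s.toNNReal f
      (boundaryPt ρ '' Icc 0 1) := by
    refine holderOnWith_of_dist_le (by positivity) hs0.le ?_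
    rintro _ ⟨x, hx, rfl⟩ _ ⟨y, hy, rfl⟩
    rw [hfE, hfE]
    refine dist_distFun_le h hA hs (abs_le.2 ⟨?_, ?_⟩) <;> linarith [hx.1, hx.2, hy.1, hy.2]
  have h1 := hhol.dimH_image_le (Real.toNNReal_pos.2 hs0)
  have hsub : Icc (distFun β lam s 0) (distFun β lam s 1) ⊆ f '' (boundaryPt ρ '' Icc 0 1) := by
    refine (intermediate_value_Icc zero_le_one (continuous_distFun h hs).continuousOn).trans ?_
    rintro _ ⟨x, hx, rfl⟩
    exact ⟨_, ⟨x, hx, rfl⟩, hfE x⟩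
  have h01 : distFun β lam s 0 < distFun β lam s 1 := distFun_strictMono h hs zero_lt_one
  have h2 : dimH (Icc (distFun β lam s 0) (distFun β lam s 1)) = 1 := by
    rw [Real.dimH_of_nonempty_interior (by rw [interior_Icc]; exact nonempty_Ioo.2 h01)]
    simp
  have h3 : 1 ≤ dimH (boundaryPt ρ '' Icc 0 1) / (s.toNNReal : ℝ≥0∞) := by
    rw [← h2]
    exact (dimH_mono hsub).trans h1
  have hsne : (s.toNNReal : ℝ≥0∞) ≠ 0 := by simpa using hs0
  rw [ENNReal.le_div_iff_mul_le (Or.inl hsne) (Or.inl ENNReal.coe_ne_top), one_mul] at h3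
  refine h3.trans (dimH_mono ?_)
  rintro _ ⟨x, -, rfl⟩
  exact boundaryPt_mem h hA x

/-- The inverse map is 1/s-Hölder from a subset of ℝ onto the part of the boundary over a unit
interval. The Hölder bound needs |x - y| ≤ 1, and countably many such parts cover the boundary. -/
theorem dimH_rhoBoundary_le (h : ExponentRange β lam) (hA : TriadicBounds β lam ρ A)
    (hs : MoranExponent β lam s) : dimH (rhoBoundary ρ) ≤ ENNReal.ofReal s := by
  have hA0 := hA.pos
  have hs0 := hs.pos
  have hC := columnConst_pos h hA
  have hinj := (distFun_strictMono h hs).injective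
  have hcover : rhoBoundary ρ = ⋃ m : ℤ, boundaryPt ρ '' Icc (m : ℝ) (m + 1) := by
    rw [rhoBoundary_eq_range h hA, ← image_iUnion, ← image_univ]
    congr 1
    refine (iUnion_eq_univ_iff.2 fun x => ?_).symm
    exact ⟨⌊x⌋, Int.floor_le x, (Int.lt_floor_add_one x).le⟩
  rw [hcover, dimH_iUnion]
  refine iSup_le fun m => ?_
  -- Values outside the range of the distribution function are arbitrary; only its images of unit
  -- intervals matter.
  set g : ℝ → RhoClosure ρ := fun u => boundaryPt ρ (Function.invFun (distFun β lam s) u) with hg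
  have hgF : ∀ x, g (distFun β lam s x) = boundaryPt ρ x := fun x =>
    congrArg (boundaryPt ρ) (Function.leftInverse_invFun hinj x)
  have himg : boundaryPt ρ '' Icc (m : ℝ) (m + 1)
      = g '' (distFun β lam s '' Icc (m : ℝ) (m + 1)) := by
    rw [image_image]
    exact image_congr fun x _ => (hgF x).symm
  have hhol : HolderOnWith (729 * (28 * columnConst β lam A + A)).toNNReal s⁻¹.toNNReal g
      (distFun β lam s '' Icc (m : ℝ) (m + 1)) := by
    refine holderOnWith_of_dist_le (by positivity) (inv_nonneg.2 hs0.le) ?_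
    rintro _ ⟨x, hx, rfl⟩ _ ⟨y, hy, rfl⟩
    rw [hgF, hgF]
    refine dist_boundaryPt_le h hA hs (abs_le.2 ⟨?_, ?_⟩) <;> linarith [hx.1, hx.2, hy.1, hy.2]
  rw [himg]
  refine (hhol.dimH_image_le (Real.toNNReal_pos.2 (inv_pos.2 hs0))).trans ?_
  have h1 : dimH (distFun β lam s '' Icc (m : ℝ) (m + 1)) ≤ 1 :=
    (dimH_mono (subset_univ _)).trans Real.dimH_univ.le
  rw [Real.toNNReal_inv, ENNReal.coe_inv (Real.toNNReal_pos.2 hs0).ne', ENNReal.div_eq_inv_mul,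
    inv_inv]
  calc _ ≤ (s.toNNReal : ℝ≥0∞) * 1 := by gcongr
    _ = _ := mul_one _

end

theorem mainTheorem6 (β lam : ℝ) (hβ : -1 < β) (hβ' : β < 0) (hlam : -1 < lam) (hlam' : lam < 0)
    (hne : β ≠ lam) :
    (∃ ρ₀ : ℂ → ℝ, IsTriadicOnRect β lam ρ₀) ∧
    (∀ ρ₀ : ℂ → ℝ, IsTriadicOnRect β lam ρ₀ →
      ∃ ρ : HalfPlaneWeight, IsTriadicOnHalfPlane β lam ρ ∧ EqOn ρ ρ₀ baseRect) ∧
    (∀ ρ : HalfPlaneWeight, IsTriadicOnHalfPlane β lam ρ →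
      IsDensity ρ ∧
      HarnackOn ρ upperHalf ∧
      (∀ x : ℝ, ∃ ξ ∈ rhoBoundary ρ, LiesOver ξ x) ∧
      GehringHayman ρ ∧
      (-(1 / 2) < β → -(1 / 2) < lam → IsConformalDensity ρ) ∧
      ∃ t ∈ Icc (0 : ℝ) 1, IsMaxOn (entropyRatio β lam) (Icc 0 1) t ∧
        dimH (rhoBoundary ρ) = ENNReal.ofReal (entropyRatio β lam t)) := by
  have h : ExponentRange β lam := ⟨hβ, hβ', hlam, hlam'⟩
  refine ⟨exists_isTriadicOnRect h, fun ρ₀ => exists_extension_of_isTriadicOnRect, fun ρ hρ => ?_⟩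
  obtain ⟨A, hA⟩ := hρ.exists_triadicBounds h
  have hdens := isDensity_of_bounds h hA
  refine ⟨hdens, hρ.1, fun x => ⟨_, boundaryPt_mem h hA x, liesOver_boundaryPt h hA x⟩,
    gehringHayman_of_bounds h hA,
    fun h1 h2 => ⟨hdens, hρ.1, volumeGrowth_of_bounds h hρ.1 hA h1 h2⟩, ?_⟩
  obtain ⟨s, hs⟩ := h.exists_moranExponent
  obtain ⟨t, ht, hmax, hval⟩ := hs.isMaxOn_entropyRatio h
  refine ⟨t, ht, hmax, ?_⟩
  rw [hval]
  exact le_antisymm (dimH_rhoBoundary_le h hA hs) (le_dimH_rhoBoundary h hA hs)
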